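/- Let $n\ge 1$, let $0\le a<b<\infty$, and let $\varphi=(\varphi_1,\varphi_2)$ be a pair of real functions on $[a,b]$. Assume condition (C1): $\varphi_1,\varphi_2$ are (weakly) increasing, Lipschitz and $C^1$ on $[a,b]$, $\varphi_1+\varphi_2$ is strictly increasing on $[a,b]$, and $\varphi_1'(x)+\varphi_2'(x)>0$ for all $x\in[a,b]\setminus\{0\}$. Put $\psi_i(x)=\varphi_i(\sqrt{x})$ and assume moreover that $\psi_1,\psi_2\in C^{n-1}[a^2,b^2]$ (derivatives at end points are one-sided). Let $M_n[a,b]$ be the set of complex $n\times n$ matrices $X$ such that the spectrum of $|X|=(X^*X)^{1/2}$ is contained in $[a,b]$, and for $X\in M_n[a,b]$ put $\varphi(X)=\varphi_1(|X|)-\varphi_2(|X^*|)$. Then, for every $T\in M_n[a,b]$ (diagonalizable or not), the initial value problem $$\frac{dX(t)}{dt}=[\varphi(X(t)),X(t)],\qquad X(0)=T,$$ has a unique solution $X:[0,\infty)\to M_n[a,b]$, and this solution, i.e. the flow $F^\varphi_t(T):=X(t)$, converges to a normal matrix as $t\to\infty$. -/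

import Mathlib

open Filter Topology Set
open scoped MatrixOrder

/-- Condition (C0): `φ₁` and `φ₂` are continuous and increasing (in the weak sense) on `[a, b]`,
and `φ₁ + φ₂` is strictly increasing there. -/
structure CondC0 (φ₁ φ₂ : ℝ → ℝ) (a b : ℝ) : Prop where
  continuousOn_left : ContinuousOn φ₁ (Icc a b)
  continuousOn_right : ContinuousOn φ₂ (Icc a b)
  monotoneOn_left : MonotoneOn φ₁ (Icc a b)
  monotoneOn_right : MonotoneOn φ₂ (Icc a b)
  strictMonoOn_add : StrictMonoOn (fun x => φ₁ x + φ₂ x) (Icc a b)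

/-- Condition (CL): (C0), and both functions are Lipschitz on `[a, b]`. -/
structure CondCL (φ₁ φ₂ : ℝ → ℝ) (a b : ℝ) : Prop extends CondC0 φ₁ φ₂ a b where
  lipschitz_left : ∃ K, LipschitzOnWith K φ₁ (Icc a b)
  lipschitz_right : ∃ K, LipschitzOnWith K φ₂ (Icc a b)

/-- Condition (C1): (CL), both functions are `C¹` on `[a, b]` (one-sided at the end points), and
`φ₁' + φ₂' > 0` on `[a, b] \ {0}`. -/
structure CondC1 (φ₁ φ₂ : ℝ → ℝ) (a b : ℝ) : Prop extends CondCL φ₁ φ₂ a b where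
  contDiffOn_left : ContDiffOn ℝ 1 φ₁ (Icc a b)
  contDiffOn_right : ContDiffOn ℝ 1 φ₂ (Icc a b)
  deriv_add_pos : ∀ x ∈ Icc a b \ {0},
    0 < derivWithin φ₁ (Icc a b) x + derivWithin φ₂ (Icc a b) x

/-- `M_n[a, b]`: the complex `n × n` matrices `X` with `σ(|X|) ⊆ [a, b]`, where
`|X| = (X* X)^{1/2}`. Since `|X|` is Hermitian, its complex spectrum is real, so that nothing is
lost by using the real spectrum. -/
def matrixInterval (n : ℕ) (a b : ℝ) : Set (Matrix (Fin n) (Fin n) ℂ) :=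
  {X | spectrum ℝ (CFC.abs X) ⊆ Icc a b}

/-- `φ(X) = φ₁(|X|) - φ₂(|X*|)`, by functional calculus for Hermitian matrices. -/
noncomputable def phiOf {n : ℕ} (φ₁ φ₂ : ℝ → ℝ) (X : Matrix (Fin n) (Fin n) ℂ) :
    Matrix (Fin n) (Fin n) ℂ :=
  cfc φ₁ (CFC.abs X) - cfc φ₂ (CFC.abs (star X))

/-- `X : [0, ∞) → M_n[a, b]` is a global solution of `X'(t) = [φ(X(t)), X(t)]`, `X(0) = T`
(with the right derivative at `t = 0`). Values of `X` at negative times are irrelevant. -/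
structure IsGlobalSolution {n : ℕ} (φ₁ φ₂ : ℝ → ℝ) (a b : ℝ) (T : Matrix (Fin n) (Fin n) ℂ)
    (X : ℝ → Matrix (Fin n) (Fin n) ℂ) : Prop where
  initial : X 0 = T
  mem : ∀ t, 0 ≤ t → X t ∈ matrixInterval n a b
  hasDeriv : ∀ t, 0 ≤ t → HasDerivWithinAt X ⁅phiOf φ₁ φ₂ (X t), X t⁆ (Ici 0) t

open Classical in
/-- The flow `F^φ_t(T) = X(t)`, where `X` is the global solution with `X(0) = T`
(and `0` by convention if there is none). -/
noncomputable def phiFlow {n : ℕ} (φ₁ φ₂ : ℝ → ℝ) (a b : ℝ) (t : ℝ)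
    (T : Matrix (Fin n) (Fin n) ℂ) : Matrix (Fin n) (Fin n) ℂ :=
  if h : ∃ X, IsGlobalSolution φ₁ φ₂ a b T X then h.choose t else 0

section FrobeniusFlow

attribute [local instance] Matrix.frobeniusNormedRing Matrix.frobeniusNormedAlgebra

variable {n : Type*} [Fintype n] [DecidableEq n]

/-! ### The Frobenius norm -/

/-! Put ψᵢ = φᵢ ∘ √, so that φ(X) = H(X) := ψ₁(X*X) − ψ₂(XX*). For n = 1 all commutators vanish. For
n ≥ 2 the ψᵢ are at least C¹ and extend to increasing C¹ functions on the line
(`CondC1.exists_increasingPair`). Norms are Frobenius norms.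

Existence and invariance. X*X and XX* have the same eigenvalues, so a rearrangement inequality gives
Re tr(H(X)(h(XX*) − h(X*X))) ≤ 0 for every increasing h (`trace_flowField_mul_nonpos`). The
derivative of tr (X*X)^k along the flow is 2k times such a trace with h(x) = x^k, so all power sums
of the squared singular values decrease. For invertible X the inverse satisfies the same Lax
equation, and its power sums decrease as well. This keeps the singular values in [a, b]; with the
Lipschitz bound for the functional calculus in the Frobenius norm it gives unique global solutions.

Approach to normal matrices. For every polynomial p, p(X)' = [H, p(X)]; polynomial equations and the
traces tr p(X) therefore persist. ‖X‖² decreases strictly off the normal matrices, and a compactness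
argument of LaSalle type (`IsFlowLine.tendsto_zero`) shows that X(t) approaches the normal matrices
that satisfy the polynomial equations of X(0).

Convergence. Let D = q(X) be the semisimple part of X in the Jordan–Chevalley decomposition; the
same q serves for all t. Since X − D is nilpotent, and a normal nilpotent matrix is zero, X − D → 0;
likewise κ = ‖DD* − D*D‖ → 0. The Lyapunov function is V = ‖D‖² − Σ|λ|² over the eigenvalues λ of D,
where the sum is constant in time. Three estimates hold: V = O(κ²)
(`exists_abs_norm_sq_sub_trace_le`), ‖D'‖ = O(κ) (`exists_norm_commutator_flowField_le`), and V' ≤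
−cκ² for large t (`exists_trace_flowField_mul_le`). They make the speed of D integrable
(`exists_tendsto_of_dissipation`), so D converges, X has the same limit, and κ → 0 makes that limit
normal. -/

theorem frobenius_norm_sq (M : Matrix n n ℂ) : ‖M‖ ^ 2 = ∑ i, ∑ j, ‖M i j‖ ^ 2 := by
  have h := Matrix.frobenius_norm_def M
  have h' : ‖M‖ = (∑ i, ∑ j, ‖M i j‖ ^ (2 : ℝ)) ^ (1 / 2 : ℝ) := h
  rw [h', ← Real.sqrt_eq_rpow, Real.sq_sqrt (by positivity)]
  simp

theorem frobenius_norm_star (M : Matrix n n ℂ) : ‖star M‖ = ‖M‖ :=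
  Matrix.frobenius_norm_conjTranspose M

theorem frobenius_norm_sq_eq_trace (M : Matrix n n ℂ) :
    ‖M‖ ^ 2 = (star M * M).trace.re := by
  rw [frobenius_norm_sq, Finset.sum_comm, Matrix.trace, Complex.re_sum]
  refine Finset.sum_congr rfl fun i _ => ?_
  rw [Matrix.diag_apply, Matrix.mul_apply, Complex.re_sum]
  refine Finset.sum_congr rfl fun j _ => ?_
  rw [Matrix.star_apply, Complex.star_def, ← Complex.normSq_eq_conj_mul_self,
    Complex.normSq_eq_norm_sq, Complex.ofReal_re]

theorem norm_trace_mul_le (A B : Matrix n n ℂ) : ‖(A * B).trace‖ ≤ ‖A‖ * ‖B‖ := by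
  have h1 : ‖(A * B).trace‖ ≤ ∑ p : n × n, ‖A p.1 p.2‖ * ‖B p.2 p.1‖ := by
    rw [Matrix.trace, Fintype.sum_prod_type]
    refine (norm_sum_le _ _).trans (Finset.sum_le_sum fun i _ => ?_)
    rw [Matrix.diag_apply, Matrix.mul_apply]
    refine (norm_sum_le _ _).trans (Finset.sum_le_sum fun j _ => ?_)
    rw [norm_mul]
  refine h1.trans (abs_le_of_sq_le_sq' ?_ (by positivity)).2
  refine (Finset.sum_mul_sq_le_sq_mul_sq _ _ _).trans (le_of_eq ?_)
  rw [mul_pow, frobenius_norm_sq, frobenius_norm_sq, Fintype.sum_prod_type, Fintype.sum_prod_type]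
  congr 1
  exact Finset.sum_comm

theorem frobenius_norm_isometry_mul {U : Matrix n n ℂ} (hU : star U * U = 1)
    (M : Matrix n n ℂ) : ‖U * M‖ = ‖M‖ := by
  refine (sq_eq_sq₀ (norm_nonneg _) (norm_nonneg _)).1 ?_
  rw [frobenius_norm_sq_eq_trace, frobenius_norm_sq_eq_trace, star_mul, mul_assoc, ← mul_assoc _ U,
    hU, one_mul]

theorem frobenius_norm_mul_coisometry {U : Matrix n n ℂ} (hU : star U * U = 1)
    (M : Matrix n n ℂ) : ‖M * star U‖ = ‖M‖ := by
  rw [← frobenius_norm_star, star_mul, star_star, frobenius_norm_isometry_mul hU,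
    frobenius_norm_star]

theorem isHermitian_star_mul {m : Type*} [Fintype m] (X : Matrix m m ℂ) : (star X * X).IsHermitian :=
  Matrix.isHermitian_conjTranspose_mul_self X

theorem isHermitian_mul_star {m : Type*} [Fintype m] (X : Matrix m m ℂ) : (X * star X).IsHermitian :=
  Matrix.isHermitian_mul_conjTranspose_self X

/-! ### Functional calculus of Hermitian matrices -/

theorem Matrix.IsHermitian.eigenvectorUnitary_star_mul {A : Matrix n n ℂ} (hA : A.IsHermitian) :
    star (hA.eigenvectorUnitary : Matrix n n ℂ) * hA.eigenvectorUnitary = 1 :=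
  Unitary.coe_star_mul_self _

theorem Matrix.IsHermitian.eigenvectorUnitary_mul_star {A : Matrix n n ℂ} (hA : A.IsHermitian) :
    (hA.eigenvectorUnitary : Matrix n n ℂ) * star (hA.eigenvectorUnitary : Matrix n n ℂ) = 1 :=
  Unitary.coe_mul_star_self _

theorem Matrix.IsHermitian.cfc_eq_diagonal {A : Matrix n n ℂ} (hA : A.IsHermitian) (f : ℝ → ℝ) :
    _root_.cfc f A = (hA.eigenvectorUnitary : Matrix n n ℂ) *
      Matrix.diagonal (fun i => (f (hA.eigenvalues i) : ℂ)) *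
        star (hA.eigenvectorUnitary : Matrix n n ℂ) := by
  rw [hA.cfc_eq, Matrix.IsHermitian.cfc, Unitary.conjStarAlgAut_apply]
  rfl

theorem Matrix.IsHermitian.eq_diagonal {A : Matrix n n ℂ} (hA : A.IsHermitian) :
    A = (hA.eigenvectorUnitary : Matrix n n ℂ) *
      Matrix.diagonal (fun i => (hA.eigenvalues i : ℂ)) *
        star (hA.eigenvectorUnitary : Matrix n n ℂ) := by
  conv_lhs => rw [hA.spectral_theorem, Unitary.conjStarAlgAut_apply]
  rfl

/-- A function that is Lipschitz on the spectra is operator Lipschitz for the Frobenius norm, also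
in its intertwining form. -/
theorem norm_cfc_mul_sub_mul_cfc_le {A B : Matrix n n ℂ} (hA : A.IsHermitian)
    (hB : B.IsHermitian) {f : ℝ → ℝ} {L : ℝ} (hL : 0 ≤ L)
    (hf : ∀ i j, |f (hA.eigenvalues i) - f (hB.eigenvalues j)| ≤
      L * |hA.eigenvalues i - hB.eigenvalues j|) (Z : Matrix n n ℂ) :
    ‖cfc f A * Z - Z * cfc f B‖ ≤ L * ‖A * Z - Z * B‖ := by
  set U : Matrix n n ℂ := hA.eigenvectorUnitary.1 with hU
  set W : Matrix n n ℂ := hB.eigenvectorUnitary.1 with hW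
  have hU1 : star U * U = 1 := hA.eigenvectorUnitary_star_mul
  have hW1 : star W * W = 1 := hB.eigenvectorUnitary_star_mul
  have hU2 : U * star U = 1 := hA.eigenvectorUnitary_mul_star
  have hW2 : W * star W = 1 := hB.eigenvectorUnitary_mul_star
  -- In the two eigenbases both expressions become entrywise multiplications, by f(aᵢ) − f(bⱼ) and
  -- by aᵢ − bⱼ, and the Frobenius norm only sees the moduli of the entries.
  have key : ∀ d e : n → ℂ,
      ‖(U * Matrix.diagonal d * star U) * Z - Z * (W * Matrix.diagonal e * star W)‖ =
      ‖Matrix.diagonal d * (star U * Z * W) - (star U * Z * W) * Matrix.diagonal e‖ := by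
    intro d e
    have h : ∀ M, ‖U * (M * star W)‖ = ‖M‖ := fun M => by
      rw [frobenius_norm_isometry_mul hU1, frobenius_norm_mul_coisometry hW1]
    rw [← h (Matrix.diagonal d * (star U * Z * W) - (star U * Z * W) * Matrix.diagonal e)]
    congr 1
    calc _ = (U * Matrix.diagonal d * star U) * Z * (W * star W) -
          (U * star U) * Z * (W * Matrix.diagonal e * star W) := by rw [hU2, hW2, mul_one, one_mul]
      _ = _ := by noncomm_ring
  conv_lhs => rw [hA.cfc_eq_diagonal, hB.cfc_eq_diagonal]
  conv_rhs => rw [hA.eq_diagonal, hB.eq_diagonal]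
  rw [key, key]
  refine (abs_le_of_sq_le_sq' ?_ (by positivity)).2
  rw [mul_pow, frobenius_norm_sq, frobenius_norm_sq, Finset.mul_sum]
  refine Finset.sum_le_sum fun i _ => ?_
  rw [Finset.mul_sum]
  refine Finset.sum_le_sum fun j _ => ?_
  generalize star U * Z * W = M
  rw [Matrix.sub_apply, Matrix.sub_apply, Matrix.diagonal_mul, Matrix.diagonal_mul,
    Matrix.mul_diagonal, Matrix.mul_diagonal, mul_comm (M i j), mul_comm (M i j), ← sub_mul,
    ← sub_mul, norm_mul, norm_mul, ← mul_pow, ← Complex.ofReal_sub, ← Complex.ofReal_sub,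
    Complex.norm_real, Complex.norm_real, Real.norm_eq_abs, Real.norm_eq_abs, ← mul_assoc]
  have := hf i j
  gcongr

theorem trace_cfc {A : Matrix n n ℂ} (hA : A.IsHermitian) (f : ℝ → ℝ) :
    (cfc f A).trace = ((∑ i, f (hA.eigenvalues i) : ℝ) : ℂ) := by
  rw [hA.cfc_eq_diagonal, Matrix.trace_mul_comm, ← mul_assoc, hA.eigenvectorUnitary_star_mul,
    one_mul, Matrix.trace_diagonal]
  push_cast
  rfl

/-- The weights are the squared moduli of the entries of the unitary change of basis between the two
eigenbases, so a single `w` serves all `f` and `g`. -/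
theorem exists_doublyStochastic_trace {A B : Matrix n n ℂ} (hA : A.IsHermitian)
    (hB : B.IsHermitian) : ∃ w ∈ doublyStochastic ℝ n, ∀ f g : ℝ → ℝ,
      (cfc f A * cfc g B).trace =
        ((∑ i, ∑ j, f (hA.eigenvalues i) * g (hB.eigenvalues j) * w i j : ℝ) : ℂ) := by
  set U : Matrix n n ℂ := hA.eigenvectorUnitary.1 with hU
  set W : Matrix n n ℂ := hB.eigenvectorUnitary.1 with hW
  have hU1 : star U * U = 1 := hA.eigenvectorUnitary_star_mul
  have hW1 : star W * W = 1 := hB.eigenvectorUnitary_star_mul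
  have hU2 : U * star U = 1 := hA.eigenvectorUnitary_mul_star
  have hW2 : W * star W = 1 := hB.eigenvectorUnitary_mul_star
  set M := star U * W with hM
  have hM1 : M * star M = 1 := by
    rw [hM, star_mul, star_star, mul_assoc, ← mul_assoc W, hW2, one_mul, hU1]
  have hM2 : star M * M = 1 := by
    rw [hM, star_mul, star_star, mul_assoc, ← mul_assoc U, hU2, one_mul, hW1]
  have hsq : ∀ z : ℂ, z * star z = ((‖z‖ ^ 2 : ℝ) : ℂ) := fun z => by
    rw [Complex.star_def, Complex.mul_conj, Complex.normSq_eq_norm_sq]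
  refine ⟨Matrix.of fun i j => ‖M i j‖ ^ 2, ?_, fun f g => ?_⟩
  · rw [mem_doublyStochastic_iff_sum]
    refine ⟨fun i j => by simp, fun i => ?_, fun j => ?_⟩
    · have := congrFun (congrFun hM1 i) i
      rw [Matrix.mul_apply] at this
      simp only [Matrix.star_apply, hsq, Matrix.one_apply_eq] at this
      exact_mod_cast this
    · have := congrFun (congrFun hM2 j) j
      rw [Matrix.mul_apply] at this
      simp only [Matrix.star_apply, mul_comm (star _), hsq, Matrix.one_apply_eq] at this
      exact_mod_cast this
  · rw [hA.cfc_eq_diagonal, hB.cfc_eq_diagonal]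
    set d := Matrix.diagonal (fun i => (f (hA.eigenvalues i) : ℂ))
    set e := Matrix.diagonal (fun i => (g (hB.eigenvalues i) : ℂ))
    have : (U * d * star U * (W * e * star W)).trace = (d * (M * (e * star M))).trace := by
      rw [hM, mul_assoc, mul_assoc, Matrix.trace_mul_comm, star_mul, star_star]
      simp only [mul_assoc]
    rw [this, Matrix.trace, Complex.ofReal_sum]
    refine Finset.sum_congr rfl fun i _ => ?_
    rw [Matrix.diag_apply, Matrix.diagonal_mul, Matrix.mul_apply, Finset.mul_sum,
      Complex.ofReal_sum]
    refine Finset.sum_congr rfl fun j _ => ?_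
    rw [Matrix.diagonal_mul, Matrix.star_apply, Matrix.of_apply, Complex.ofReal_mul, ← hsq]
    push_cast
    ring

end FrobeniusFlow

section FrobeniusFlow

attribute [local instance] Matrix.frobeniusNormedRing Matrix.frobeniusNormedAlgebra

variable {n : Type*} [Fintype n] [DecidableEq n]

/-! ### Rearrangement inequalities for traces -/

/-- By Birkhoff's theorem `w` is a convex combination of permutation matrices, and for each of these
the claim is the classical rearrangement inequality. -/
theorem sum_mul_mul_doublyStochastic_le {f g : n → ℝ} (hfg : Monovary f g) {w : Matrix n n ℝ}
    (hw : w ∈ doublyStochastic ℝ n) : ∑ i, ∑ j, f i * g j * w i j ≤ ∑ i, f i * g i := by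
  obtain ⟨c, hc0, hc1, rfl⟩ := exists_eq_sum_perm_of_mem_doublyStochastic hw
  have key : ∑ i, ∑ j, f i * g j * (∑ σ, c σ • Equiv.Perm.permMatrix ℝ σ) i j =
      ∑ σ, c σ * ∑ i, f i * g (σ i) := by
    simp_rw [Matrix.sum_apply, Finset.mul_sum]
    rw [Finset.sum_congr rfl fun i _ => Finset.sum_comm, Finset.sum_comm]
    refine Finset.sum_congr rfl fun σ _ => Finset.sum_congr rfl fun i _ => ?_
    rw [Finset.sum_eq_single (σ i)]
    · simp [Equiv.Perm.permMatrix, PEquiv.toMatrix_apply]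
      ring
    · intro j _ hj
      simp [Equiv.Perm.permMatrix, PEquiv.toMatrix_apply, hj.symm]
    · simp
  rw [key]
  calc _ ≤ ∑ σ, c σ * ∑ i, f i * g i := Finset.sum_le_sum fun σ _ =>
        mul_le_mul_of_nonneg_left hfg.sum_mul_comp_perm_le_sum_mul (hc0 σ)
    _ = _ := by rw [← Finset.sum_mul, hc1, one_mul]

theorem continuousOn_spectrum (A : Matrix n n ℂ) (f : ℝ → ℝ) :
    ContinuousOn f (spectrum ℝ A) :=
  (Matrix.finite_real_spectrum).continuousOn f

theorem cfc_mul_cfc {A : Matrix n n ℂ} (f g : ℝ → ℝ) :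
    cfc f A * cfc g A = cfc (fun x => f x * g x) A :=
  (cfc_mul f g A (continuousOn_spectrum A f) (continuousOn_spectrum A g)).symm

theorem trace_cfc_mul_sub_nonneg {A B : Matrix n n ℂ} (hA : A.IsHermitian) (hB : B.IsHermitian)
    (hAB : A.charpoly = B.charpoly) {S : Set ℝ} (hS : ∀ i, hA.eigenvalues i ∈ S) {f h : ℝ → ℝ}
    (hf : MonotoneOn f S) (hh : MonotoneOn h S) :
    0 ≤ (cfc f A * (cfc h A - cfc h B)).trace.re := by
  obtain ⟨w, hw, hwt⟩ := exists_doublyStochastic_trace hA hB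
  have he := (hA.eigenvalues_eq_eigenvalues_iff hB).2 hAB
  rw [mul_sub, Matrix.trace_sub, cfc_mul_cfc, trace_cfc hA, hwt, ← he, Complex.sub_re,
    Complex.ofReal_re, Complex.ofReal_re, sub_nonneg]
  refine sum_mul_mul_doublyStochastic_le (f := fun i => f (hA.eigenvalues i))
    (g := fun i => h (hA.eigenvalues i)) (fun i j hij => ?_) hw
  refine hf (hS i) (hS j) (le_of_not_gt fun hlt => ?_)
  exact absurd (hh (hS j) (hS i) hlt.le) (not_le.2 hij)

/-- The sum of the two Bregman gaps of the potentials `Ψ₁`, `Ψ₂` with gradients `ψ₁`, `ψ₂`. -/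
def bregmanGap (Ψ₁ ψ₁ Ψ₂ ψ₂ : ℝ → ℝ) (x y : ℝ) : ℝ :=
  (Ψ₁ y - Ψ₁ x - ψ₁ x * (y - x)) + (Ψ₂ x - Ψ₂ y - ψ₂ y * (x - y))

/-- In the eigenbases the trace is Σ (ψ₁(αᵢ) − ψ₂(αⱼ))(αᵢ − αⱼ) wᵢⱼ, whose terms have no definite
sign. As `w` is doubly stochastic and `A`, `B` share their eigenvalues, differences of potentials
sum to zero against `w`. Adding them turns the terms into Bregman gaps, which are bounded below one
by one. -/
theorem le_trace_of_le_bregmanGap {A B : Matrix n n ℂ} (hA : A.IsHermitian) (hB : B.IsHermitian)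
    (hAB : A.charpoly = B.charpoly) {Ψ₁ ψ₁ Ψ₂ ψ₂ : ℝ → ℝ} {c : ℝ}
    (hc : ∀ i j, c * (hA.eigenvalues i - hA.eigenvalues j) ^ 2 ≤
      bregmanGap Ψ₁ ψ₁ Ψ₂ ψ₂ (hA.eigenvalues i) (hA.eigenvalues j)) :
    c * ‖A - B‖ ^ 2 ≤ ((cfc ψ₁ A - cfc ψ₂ B) * (A - B)).trace.re := by
  obtain ⟨w, hw, hwt⟩ := exists_doublyStochastic_trace hA hB
  have he := (hA.eigenvalues_eq_eigenvalues_iff hB).2 hAB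
  set α := hA.eigenvalues with hα
  obtain ⟨hw0, hw1, hw2⟩ := mem_doublyStochastic_iff_sum.1 hw
  have hsA : IsSelfAdjoint A := hA
  have hsB : IsSelfAdjoint B := hB
  have hrow : ∀ f : ℝ → ℝ, ∑ i, ∑ j, f (α i) * w i j = ∑ i, f (α i) := fun f =>
    Finset.sum_congr rfl fun i _ => by rw [← Finset.mul_sum, hw1, mul_one]
  have hcol : ∀ f : ℝ → ℝ, ∑ i, ∑ j, f (α j) * w i j = ∑ i, f (α i) := fun f => by
    rw [Finset.sum_comm]
    exact Finset.sum_congr rfl fun i _ => by rw [← Finset.mul_sum, hw2, mul_one]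
  have tAA : ∀ f g, (cfc f A * cfc g A).trace.re = ∑ i, ∑ j, f (α i) * g (α i) * w i j := by
    intro f g
    rw [cfc_mul_cfc, trace_cfc hA, Complex.ofReal_re, hrow (fun x => f x * g x)]
  have tBB : ∀ f g, (cfc f B * cfc g B).trace.re = ∑ i, ∑ j, f (α j) * g (α j) * w i j := by
    intro f g
    rw [cfc_mul_cfc, trace_cfc hB, Complex.ofReal_re, hcol (fun x => f x * g x), ← he]
  have tAB : ∀ f g, (cfc f A * cfc g B).trace.re = ∑ i, ∑ j, f (α i) * g (α j) * w i j := by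
    intro f g
    rw [hwt, Complex.ofReal_re, ← he]
  have hid : ∀ M : Matrix n n ℂ, IsSelfAdjoint M → cfc (fun x : ℝ => x) M = M :=
    fun M hM => cfc_id' ℝ M hM
  have hnorm : ‖A - B‖ ^ 2 = ∑ i, ∑ j, (α i - α j) ^ 2 * w i j := by
    rw [frobenius_norm_sq_eq_trace, star_sub, hsA.star_eq, hsB.star_eq]
    have : (A - B) * (A - B) = A * A - A * B - B * A + B * B := by noncomm_ring
    rw [this, Matrix.trace_add, Matrix.trace_sub, Matrix.trace_sub, Matrix.trace_mul_comm B A]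
    have h1 := tAA (fun x => x) (fun x => x)
    have h2 := tAB (fun x => x) (fun x => x)
    have h3 := tBB (fun x => x) (fun x => x)
    rw [hid A hsA] at h1 h2
    rw [hid B hsB] at h2 h3
    rw [Complex.add_re, Complex.sub_re, Complex.sub_re, h1, h2, h3]
    simp only [← Finset.sum_sub_distrib, ← Finset.sum_add_distrib]
    exact Finset.sum_congr rfl fun i _ => Finset.sum_congr rfl fun j _ => by ring
  have htr : ((cfc ψ₁ A - cfc ψ₂ B) * (A - B)).trace.re =
      ∑ i, ∑ j, bregmanGap Ψ₁ ψ₁ Ψ₂ ψ₂ (α i) (α j) * w i j := by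
    have : (cfc ψ₁ A - cfc ψ₂ B) * (A - B) =
        cfc ψ₁ A * A - cfc ψ₁ A * B - cfc ψ₂ B * A + cfc ψ₂ B * B := by noncomm_ring
    rw [this, Matrix.trace_add, Matrix.trace_sub, Matrix.trace_sub,
      Matrix.trace_mul_comm (cfc ψ₂ B) A]
    have h1 := tAA ψ₁ (fun x => x)
    have h2 := tAB ψ₁ (fun x => x)
    have h3 := tAB (fun x => x) ψ₂
    have h4 := tBB ψ₂ (fun x => x)
    have h5 : ∑ i, ∑ j, (Ψ₁ (α j) - Ψ₁ (α i) - (Ψ₂ (α j) - Ψ₂ (α i))) * w i j = 0 := by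
      simp only [sub_mul, Finset.sum_sub_distrib]
      rw [hcol, hrow, hcol, hrow]
      ring
    rw [hid A hsA] at h1 h3
    rw [hid B hsB] at h2 h4
    rw [Complex.add_re, Complex.sub_re, Complex.sub_re, h1, h2, h3, h4, ← add_zero (_ + _), ← h5]
    simp only [← Finset.sum_sub_distrib, ← Finset.sum_add_distrib]
    exact Finset.sum_congr rfl fun i _ => Finset.sum_congr rfl fun j _ => by
      simp only [bregmanGap]; ring
  rw [hnorm, htr, Finset.mul_sum]
  refine Finset.sum_le_sum fun i _ => ?_
  rw [Finset.mul_sum]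
  refine Finset.sum_le_sum fun j _ => ?_
  rw [← mul_assoc]
  exact mul_le_mul_of_nonneg_right (hc i j) (hw0 i j)

/-! ### Pairs of increasing functions -/

/-- A pair of increasing `C¹` functions on the line, the sum of which has a positive derivative on
the positive half-line. -/
structure IncreasingPair (ψ₁ ψ₂ : ℝ → ℝ) : Prop where
  contDiff_left : ContDiff ℝ 1 ψ₁
  contDiff_right : ContDiff ℝ 1 ψ₂
  monotone_left : Monotone ψ₁
  monotone_right : Monotone ψ₂
  deriv_add_pos : ∀ x, 0 < x → 0 < deriv ψ₁ x + deriv ψ₂ x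

theorem Monotone.mul_sub_le_of_hasDerivAt {Ψ ψ : ℝ → ℝ} (hψ : Monotone ψ)
    (hΨ : ∀ x, HasDerivAt Ψ (ψ x) x) (x y : ℝ) : ψ x * (y - x) ≤ Ψ y - Ψ x := by
  rcases lt_trichotomy x y with h | rfl | h
  · obtain ⟨z, hz, he⟩ := exists_hasDerivAt_eq_slope Ψ ψ h
      (fun z _ => (hΨ z).continuousAt.continuousWithinAt) (fun z _ => hΨ z)
    rw [eq_div_iff (sub_pos.2 h).ne'] at he
    rw [← he]
    exact mul_le_mul_of_nonneg_right (hψ hz.1.le) (sub_nonneg.2 h.le)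
  · simp
  · obtain ⟨z, hz, he⟩ := exists_hasDerivAt_eq_slope Ψ ψ h
      (fun z _ => (hΨ z).continuousAt.continuousWithinAt) (fun z _ => hΨ z)
    rw [eq_div_iff (sub_pos.2 h).ne'] at he
    nlinarith [mul_le_mul_of_nonneg_right (hψ hz.2.le) (sub_nonneg.2 h.le)]

/-- Each potential is split at the quarter point farther from its base point, with a tangent
inequality on both pieces. Quarter points are used because they stay away from 0 as soon as one of
`x`, `y ≥ 0` does, and at 0 the derivative of ψ₁ + ψ₂ may vanish. -/
theorem le_bregmanGap {Ψ₁ ψ₁ Ψ₂ ψ₂ : ℝ → ℝ} (h₁ : Monotone ψ₁) (h₂ : Monotone ψ₂)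
    (hΨ₁ : ∀ x, HasDerivAt Ψ₁ (ψ₁ x) x) (hΨ₂ : ∀ x, HasDerivAt Ψ₂ (ψ₂ x) x) (x y : ℝ) :
    ((ψ₁ ((x + 3 * y) / 4) + ψ₂ ((x + 3 * y) / 4)) -
      (ψ₁ ((3 * x + y) / 4) + ψ₂ ((3 * x + y) / 4))) * (y - x) / 4 ≤
      bregmanGap Ψ₁ ψ₁ Ψ₂ ψ₂ x y := by
  have a1 := h₁.mul_sub_le_of_hasDerivAt hΨ₁ x ((x + 3 * y) / 4)
  have a2 := h₁.mul_sub_le_of_hasDerivAt hΨ₁ ((x + 3 * y) / 4) y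
  have b1 := h₂.mul_sub_le_of_hasDerivAt hΨ₂ y ((3 * x + y) / 4)
  have b2 := h₂.mul_sub_le_of_hasDerivAt hΨ₂ ((3 * x + y) / 4) x
  have c1 : 0 ≤ (ψ₁ ((3 * x + y) / 4) - ψ₁ x) * (y - x) := by
    rcases le_total x y with h | h
    · exact mul_nonneg (sub_nonneg.2 (h₁ (by linarith))) (by linarith)
    · exact mul_nonneg_of_nonpos_of_nonpos (sub_nonpos.2 (h₁ (by linarith))) (by linarith)
  have c2 : 0 ≤ (ψ₂ y - ψ₂ ((x + 3 * y) / 4)) * (y - x) := by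
    rcases le_total x y with h | h
    · exact mul_nonneg (sub_nonneg.2 (h₂ (by linarith))) (by linarith)
    · exact mul_nonneg_of_nonpos_of_nonpos (sub_nonpos.2 (h₂ (by linarith))) (by linarith)
  simp only [bregmanGap]
  linear_combination a1 + a2 + b1 + b2 + c1 / 4 + c2 / 4

theorem ContDiff.exists_potential {ψ : ℝ → ℝ} (h : ContDiff ℝ 1 ψ) :
    ∃ Ψ : ℝ → ℝ, ∀ x, HasDerivAt Ψ (ψ x) x :=
  ⟨fun x => ∫ t in (0 : ℝ)..x, ψ t, fun x =>
    (h.continuous.integral_hasStrictDerivAt 0 x).hasDerivAt⟩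

namespace IncreasingPair

variable {ψ₁ ψ₂ : ℝ → ℝ}

theorem continuous_deriv_add (h : IncreasingPair ψ₁ ψ₂) :
    Continuous fun x => deriv ψ₁ x + deriv ψ₂ x :=
  (h.contDiff_left.continuous_deriv le_rfl).add (h.contDiff_right.continuous_deriv le_rfl)

theorem exists_mul_sub_le (h : IncreasingPair ψ₁ ψ₂) {σ : ℝ} (hσ : 0 < σ) (R : ℝ) :
    ∃ c, 0 < c ∧ ∀ x y, σ ≤ x → x ≤ y → y ≤ R →
      c * (y - x) ≤ (ψ₁ y + ψ₂ y) - (ψ₁ x + ψ₂ x) := by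
  have : ∃ c, 0 < c ∧ ∀ x ∈ Icc σ R, c ≤ deriv ψ₁ x + deriv ψ₂ x := by
    rcases (Icc σ R).eq_empty_or_nonempty with he | hne
    · exact ⟨1, one_pos, by simp [he]⟩
    · obtain ⟨z, hz, hmin⟩ := isCompact_Icc.exists_isMinOn hne h.continuous_deriv_add.continuousOn
      exact ⟨_, h.deriv_add_pos z (hσ.trans_le hz.1), fun x hx => hmin hx⟩
  obtain ⟨c, hc, hcd⟩ := this
  refine ⟨c, hc, fun x y hx hxy hy => ?_⟩
  have hd : ∀ z, HasDerivAt (fun z => ψ₁ z + ψ₂ z) (deriv ψ₁ z + deriv ψ₂ z) z := fun z =>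
    ((h.contDiff_left.differentiable one_ne_zero z).hasDerivAt).add
      ((h.contDiff_right.differentiable one_ne_zero z).hasDerivAt)
  rcases hxy.eq_or_lt with rfl | hlt
  · simp
  obtain ⟨z, hz, he⟩ := exists_hasDerivAt_eq_slope _ _ hlt
    (fun z _ => (hd z).continuousAt.continuousWithinAt) (fun z _ => hd z)
  rw [eq_div_iff (sub_pos.2 hlt).ne'] at he
  rw [← he]
  exact mul_le_mul_of_nonneg_right (hcd z ⟨hx.trans hz.1.le, hz.2.le.trans hy⟩)
    (sub_nonneg.2 hxy)

theorem exists_le_bregmanGap (h : IncreasingPair ψ₁ ψ₂) : ∃ Ψ₁ Ψ₂ : ℝ → ℝ,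
    ∀ σ, 0 < σ → ∀ R, ∃ c, 0 < c ∧ ∀ x ∈ Icc 0 R, ∀ y ∈ Icc 0 R, (σ ≤ x ∨ σ ≤ y) →
      c * (x - y) ^ 2 ≤ bregmanGap Ψ₁ ψ₁ Ψ₂ ψ₂ x y := by
  obtain ⟨Ψ₁, hΨ₁⟩ := h.contDiff_left.exists_potential
  obtain ⟨Ψ₂, hΨ₂⟩ := h.contDiff_right.exists_potential
  refine ⟨Ψ₁, Ψ₂, fun σ hσ R => ?_⟩
  obtain ⟨c, hc, hcs⟩ := h.exists_mul_sub_le (by positivity : 0 < σ / 4) R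
  -- The quarter points are |x − y| / 2 apart, and `le_bregmanGap` carries a further factor 1/4.
  refine ⟨c / 8, by positivity, fun x hx y hy hxy => ?_⟩
  refine le_trans ?_ (le_bregmanGap h.monotone_left h.monotone_right hΨ₁ hΨ₂ x y)
  obtain ⟨hx0, hxR⟩ := hx
  obtain ⟨hy0, hyR⟩ := hy
  rcases le_total x y with hle | hle
  · have := hcs ((3 * x + y) / 4) ((x + 3 * y) / 4)
      (by rcases hxy with h | h <;> linarith) (by linarith) (by linarith)
    linear_combination (y - x) / 4 * this
  · have := hcs ((x + 3 * y) / 4) ((3 * x + y) / 4)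
      (by rcases hxy with h | h <;> linarith) (by linarith) (by linarith)
    linear_combination (x - y) / 4 * this

end IncreasingPair

/-! ### The vector field and its dissipation -/

/-- The Hermitian matrix `ψ₁(X* X) - ψ₂(X X*)`. -/
noncomputable def flowField (ψ₁ ψ₂ : ℝ → ℝ) (X : Matrix n n ℂ) : Matrix n n ℂ :=
  cfc ψ₁ (star X * X) - cfc ψ₂ (X * star X)

theorem charpoly_star_mul_self (X : Matrix n n ℂ) :
    (star X * X).charpoly = (X * star X).charpoly :=
  Matrix.charpoly_mul_comm _ _

theorem star_flowField (ψ₁ ψ₂ : ℝ → ℝ) (X : Matrix n n ℂ) :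
    star (flowField ψ₁ ψ₂ X) = flowField ψ₁ ψ₂ X := by
  have h1 : IsSelfAdjoint (cfc ψ₁ (star X * X)) := cfc_predicate _ _
  have h2 : IsSelfAdjoint (cfc ψ₂ (X * star X)) := cfc_predicate _ _
  rw [flowField, star_sub, h1.star_eq, h2.star_eq]

open scoped ComplexOrder in
theorem eigenvalues_star_mul_self_nonneg (X : Matrix n n ℂ) (i : n) :
    0 ≤ (isHermitian_star_mul X).eigenvalues i :=
  (Matrix.posSemidef_conjTranspose_mul_self X).eigenvalues_nonneg i

theorem Matrix.IsHermitian.sq_eigenvalues_le {A : Matrix n n ℂ} (hA : A.IsHermitian) (i : n) :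
    hA.eigenvalues i ^ 2 ≤ ‖A‖ ^ 2 := by
  have h : star A = A := hA
  have hsA : IsSelfAdjoint A := hA
  rw [frobenius_norm_sq_eq_trace, h]
  have : A * A = _root_.cfc (fun x : ℝ => x * x) A := by
    rw [← cfc_mul_cfc, cfc_id' ℝ A hsA]
  rw [this, trace_cfc hA, Complex.ofReal_re, sq]
  exact Finset.single_le_sum (f := fun i => hA.eigenvalues i * hA.eigenvalues i)
    (fun i _ => mul_self_nonneg _) (Finset.mem_univ i)

theorem Matrix.IsHermitian.abs_eigenvalues_le {A : Matrix n n ℂ} (hA : A.IsHermitian) (i : n) :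
    |hA.eigenvalues i| ≤ ‖A‖ :=
  abs_le_of_sq_le_sq (hA.sq_eigenvalues_le i) (norm_nonneg _)

theorem eigenvalues_star_mul_self_le (X : Matrix n n ℂ) (i : n) :
    (isHermitian_star_mul X).eigenvalues i ≤ ‖X‖ ^ 2 := by
  refine (le_abs_self _).trans (((isHermitian_star_mul X).abs_eigenvalues_le i).trans ?_)
  refine (norm_mul_le _ _).trans (le_of_eq ?_)
  rw [frobenius_norm_star, sq]

theorem trace_flowField_mul_nonpos {ψ₁ ψ₂ : ℝ → ℝ} (h₁ : Monotone ψ₁) (h₂ : Monotone ψ₂)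
    (X : Matrix n n ℂ) {S : Set ℝ} (hS : ∀ i, (isHermitian_star_mul X).eigenvalues i ∈ S)
    {h : ℝ → ℝ} (hh : MonotoneOn h S) :
    (flowField ψ₁ ψ₂ X * (cfc h (X * star X) - cfc h (star X * X))).trace.re ≤ 0 := by
  have hS' : ∀ i, (isHermitian_mul_star X).eigenvalues i ∈ S := by
    rw [← (Matrix.IsHermitian.eigenvalues_eq_eigenvalues_iff (isHermitian_star_mul X)
      (isHermitian_mul_star X)).2 (charpoly_star_mul_self X)]
    exact hS
  have a1 := trace_cfc_mul_sub_nonneg (isHermitian_star_mul X) (isHermitian_mul_star X)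
    (charpoly_star_mul_self X) hS (h₁.monotoneOn S) hh
  have a2 := trace_cfc_mul_sub_nonneg (isHermitian_mul_star X) (isHermitian_star_mul X)
    (charpoly_star_mul_self X).symm hS' (h₂.monotoneOn S) hh
  have : flowField ψ₁ ψ₂ X * (cfc h (X * star X) - cfc h (star X * X)) =
      -(cfc ψ₁ (star X * X) * (cfc h (star X * X) - cfc h (X * star X))) -
      (cfc ψ₂ (X * star X) * (cfc h (X * star X) - cfc h (star X * X))) := by
    rw [flowField]; noncomm_ring
  rw [this, Matrix.trace_sub, Matrix.trace_neg, Complex.sub_re, Complex.neg_re]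
  linarith

/-- The constant is uniform over a ball once the nonzero eigenvalues of X*X stay above `σ`. -/
theorem IncreasingPair.exists_trace_flowField_le {ψ₁ ψ₂ : ℝ → ℝ} (h : IncreasingPair ψ₁ ψ₂)
    {σ : ℝ} (hσ : 0 < σ) (R : ℝ) : ∃ c, 0 < c ∧ ∀ X : Matrix n n ℂ, ‖X‖ ≤ R →
      (∀ i, (isHermitian_star_mul X).eigenvalues i = 0 ∨
        σ ≤ (isHermitian_star_mul X).eigenvalues i) →
      (flowField ψ₁ ψ₂ X * (X * star X - star X * X)).trace.re ≤
        -(c * ‖X * star X - star X * X‖ ^ 2) := by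
  obtain ⟨Ψ₁, Ψ₂, hb⟩ := h.exists_le_bregmanGap
  obtain ⟨c, hc, hcb⟩ := hb σ hσ (R ^ 2)
  refine ⟨c, hc, fun X hX hev => ?_⟩
  have hmem : ∀ i, (isHermitian_star_mul X).eigenvalues i ∈ Icc 0 (R ^ 2) := fun i =>
    ⟨eigenvalues_star_mul_self_nonneg X i, (eigenvalues_star_mul_self_le X i).trans
      (pow_le_pow_left₀ (norm_nonneg _) hX 2)⟩
  have key := le_trace_of_le_bregmanGap (isHermitian_star_mul X) (isHermitian_mul_star X)
    (charpoly_star_mul_self X) (Ψ₁ := Ψ₁) (ψ₁ := ψ₁) (Ψ₂ := Ψ₂) (ψ₂ := ψ₂) (c := c) (fun i j => ?_)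
  · rw [norm_sub_rev, flowField, ← neg_sub (star X * X), mul_neg, Matrix.trace_neg,
      Complex.neg_re]
    exact neg_le_neg key
  · rcases hev i with hi | hi
    · rcases hev j with hj | hj
      -- Two zero eigenvalues contribute nothing to either side, so only pairs with a member above
      -- `σ` matter.
      · rw [hi, hj]; simp [bregmanGap]
      · exact hcb _ (hmem i) _ (hmem j) (Or.inr hj)
    · exact hcb _ (hmem i) _ (hmem j) (Or.inl hi)

/-- The dissipation vanishes only at normal matrices. -/
theorem IncreasingPair.exists_trace_flowField_le_self {ψ₁ ψ₂ : ℝ → ℝ}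
    (h : IncreasingPair ψ₁ ψ₂) (X : Matrix n n ℂ) : ∃ c, 0 < c ∧
      (flowField ψ₁ ψ₂ X * (X * star X - star X * X)).trace.re ≤
        -(c * ‖X * star X - star X * X‖ ^ 2) := by
  have : ∃ σ, 0 < σ ∧ ∀ i, (isHermitian_star_mul X).eigenvalues i = 0 ∨
      σ ≤ (isHermitian_star_mul X).eigenvalues i := by
    let s := (Finset.univ.image (isHermitian_star_mul X).eigenvalues).filter (0 < ·)
    rcases s.eq_empty_or_nonempty with hs | hs
    · refine ⟨1, one_pos, fun i => Or.inl ?_⟩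
      by_contra hne
      have : (isHermitian_star_mul X).eigenvalues i ∈ s := by
        simp only [s, Finset.mem_filter, Finset.mem_image, Finset.mem_univ, true_and]
        exact ⟨⟨i, rfl⟩, lt_of_le_of_ne (eigenvalues_star_mul_self_nonneg X i) (Ne.symm hne)⟩
      rw [hs] at this
      exact absurd this (Finset.notMem_empty _)
    · refine ⟨s.min' hs, (Finset.mem_filter.1 (s.min'_mem hs)).2, fun i => ?_⟩
      rcases (eigenvalues_star_mul_self_nonneg X i).eq_or_lt with h0 | h0
      · exact Or.inl h0.symm
      · refine Or.inr (s.min'_le _ ?_)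
        simp only [s, Finset.mem_filter, Finset.mem_image, Finset.mem_univ, true_and]
        exact ⟨⟨i, rfl⟩, h0⟩
  obtain ⟨σ, hσ, hev⟩ := this
  obtain ⟨c, hc, hcX⟩ := h.exists_trace_flowField_le (n := n) hσ ‖X‖
  exact ⟨c, hc, hcX X le_rfl hev⟩

end FrobeniusFlow

section FrobeniusFlow

attribute [local instance] Matrix.frobeniusNormedRing Matrix.frobeniusNormedAlgebra

variable {n : Type*} [Fintype n] [DecidableEq n]

/-! ### Commutator estimates for the functional calculus -/

theorem ContDiff.exists_abs_sub_le {ψ : ℝ → ℝ} (h : ContDiff ℝ 1 ψ) (R : ℝ) :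
    ∃ L, 0 ≤ L ∧ ∀ x ∈ Icc (-R) R, ∀ y ∈ Icc (-R) R, |ψ x - ψ y| ≤ L * |x - y| := by
  obtain ⟨L, hL⟩ := isCompact_Icc.exists_bound_of_continuousOn (s := Icc (-R) R)
    (h.continuous_deriv le_rfl).continuousOn
  refine ⟨max L 0, le_max_right _ _, fun x hx y hy => ?_⟩
  exact (convex_Icc (-R) R).norm_image_sub_le_of_norm_deriv_le
    (fun z _ => h.differentiable one_ne_zero z)
    (fun z hz => (hL z hz).trans (le_max_left _ _)) hy hx

theorem ContDiff.exists_norm_cfc_le {ψ : ℝ → ℝ} (h : ContDiff ℝ 1 ψ) (R : ℝ) :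
    ∃ L, 0 ≤ L ∧ ∀ A B : Matrix n n ℂ, A.IsHermitian → B.IsHermitian → ‖A‖ ≤ R → ‖B‖ ≤ R →
      ∀ Z : Matrix n n ℂ, ‖cfc ψ A * Z - Z * cfc ψ B‖ ≤ L * ‖A * Z - Z * B‖ := by
  obtain ⟨L, hL, hLip⟩ := h.exists_abs_sub_le R
  refine ⟨L, hL, fun A B hA hB hAR hBR Z => ?_⟩
  exact norm_cfc_mul_sub_mul_cfc_le hA hB hL (fun i j => hLip _
    (abs_le.1 ((hA.abs_eigenvalues_le i).trans hAR)) _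
    (abs_le.1 ((hB.abs_eigenvalues_le j).trans hBR))) Z

theorem Polynomial.exists_derivative_eq (q : Polynomial ℝ) :
    ∃ p : Polynomial ℝ, Polynomial.derivative p = q := by
  induction q using Polynomial.induction_on' with
  | add p q hp hq =>
    obtain ⟨p', rfl⟩ := hp
    obtain ⟨q', rfl⟩ := hq
    exact ⟨p' + q', Polynomial.derivative_add⟩
  | monomial k a =>
    refine ⟨Polynomial.monomial (k + 1) (a / (k + 1)), ?_⟩
    rw [Polynomial.derivative_monomial]
    have : (k : ℝ) + 1 ≠ 0 := by positivity
    congr 1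
    push_cast
    field_simp

/-- Weierstrass approximation is applied to ψ' and the polynomial is integrated, so that the
remainder has Lipschitz constant ε. -/
theorem ContDiff.exists_polynomial_abs_sub_le {ψ : ℝ → ℝ} (h : ContDiff ℝ 1 ψ) (R : ℝ) {ε : ℝ}
    (hε : 0 < ε) : ∃ p : Polynomial ℝ, ∀ x ∈ Icc (-R) R, ∀ y ∈ Icc (-R) R,
      |(ψ x - p.eval x) - (ψ y - p.eval y)| ≤ ε * |x - y| := by
  obtain ⟨q, hq⟩ := exists_polynomial_near_of_continuousOn (-R) R (deriv ψ)
    (h.continuous_deriv le_rfl).continuousOn ε hε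
  obtain ⟨p, rfl⟩ := q.exists_derivative_eq
  refine ⟨p, fun x hx y hy => ?_⟩
  have hd : ∀ z, HasDerivAt (fun z => ψ z - p.eval z)
      (deriv ψ z - (Polynomial.derivative p).eval z) z := fun z =>
    ((h.differentiable one_ne_zero z).hasDerivAt).sub (p.hasDerivAt z)
  exact (convex_Icc (-R) R).norm_image_sub_le_of_norm_hasDerivWithin_le
    (f := fun z => ψ z - p.eval z) (fun z _ => (hd z).hasDerivWithinAt)
    (fun z hz => by rw [Real.norm_eq_abs, abs_sub_comm]; exact (hq z hz).le) hy hx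

/-- All four bounds come from the Leibniz rule, by induction on the degree. The third also serves to
show that a matrix commuting with `a` commutes with every polynomial in `a`. -/
theorem Polynomial.exists_norm_commutator_le {𝕜 : Type*} [CommRing 𝕜] [Algebra 𝕜 (Matrix n n ℂ)]
    (p : Polynomial 𝕜) {R : ℝ} (hR : 0 ≤ R) :
    ∃ K, 0 ≤ K ∧ ∀ a b D : Matrix n n ℂ, ‖a‖ ≤ R → ‖b‖ ≤ R →
      ‖Polynomial.aeval a p‖ ≤ K ∧
      ‖Polynomial.aeval a p - Polynomial.aeval b p‖ ≤ K * ‖a - b‖ ∧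
      ‖Polynomial.aeval a p * D - D * Polynomial.aeval a p‖ ≤ K * ‖a * D - D * a‖ ∧
      ‖(Polynomial.aeval a p - Polynomial.aeval b p) * D -
          D * (Polynomial.aeval a p - Polynomial.aeval b p)‖ ≤
        K * (‖a - b‖ * (‖a * D - D * a‖ + ‖b * D - D * b‖) +
          ‖(a - b) * D - D * (a - b)‖) := by
  induction p using Polynomial.induction_on with
  | C c =>
    refine ⟨‖algebraMap 𝕜 (Matrix n n ℂ) c‖, norm_nonneg _, fun a b D _ _ => ?_⟩
    have : algebraMap 𝕜 (Matrix n n ℂ) c * D - D * algebraMap 𝕜 (Matrix n n ℂ) c = 0 :=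
      sub_eq_zero.2 (Algebra.commutes c D)
    simp only [Polynomial.aeval_C, this, sub_self, zero_mul, mul_zero, norm_zero]
    exact ⟨le_rfl, by positivity, by positivity, by positivity⟩
  | add p q hp hq =>
    obtain ⟨K, hK, hp⟩ := hp
    obtain ⟨K', hK', hq⟩ := hq
    refine ⟨K + K', add_nonneg hK hK', fun a b D ha hb => ?_⟩
    obtain ⟨p1, p2, p3, p4⟩ := hp a b D ha hb
    obtain ⟨q1, q2, q3, q4⟩ := hq a b D ha hb
    simp only [map_add, add_mul K K']
    refine ⟨(norm_add_le _ _).trans (add_le_add p1 q1), ?_, ?_, ?_⟩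
    · refine le_trans (le_of_eq ?_) ((norm_add_le _ _).trans (add_le_add p2 q2))
      congr 1; abel
    · refine le_trans (le_of_eq ?_) ((norm_add_le _ _).trans (add_le_add p3 q3))
      congr 1; noncomm_ring
    · refine le_trans (le_of_eq ?_) ((norm_add_le _ _).trans (add_le_add p4 q4))
      congr 1; noncomm_ring
  | monomial k c h =>
    obtain ⟨K, hK, h⟩ := h
    refine ⟨K * (1 + R), by positivity, fun a b D ha hb => ?_⟩
    obtain ⟨p1, p2, p3, p4⟩ := h a b D ha hb
    have hX : ∀ x : Matrix n n ℂ, Polynomial.aeval x (Polynomial.C c * Polynomial.X ^ (k + 1)) =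
        x * Polynomial.aeval x (Polynomial.C c * Polynomial.X ^ k) := fun x => by
      rw [pow_succ', mul_left_comm, map_mul, Polynomial.aeval_X]
    rw [hX, hX]
    generalize Polynomial.aeval a (Polynomial.C c * Polynomial.X ^ k) = pa at *
    generalize Polynomial.aeval b (Polynomial.C c * Polynomial.X ^ k) = pb at *
    have hm : ∀ {x y : Matrix n n ℂ} {s t : ℝ}, ‖x‖ ≤ s → ‖y‖ ≤ t → 0 ≤ s → ‖x * y‖ ≤ s * t :=
      fun hx hy hs => (norm_mul_le _ _).trans (mul_le_mul hx hy (norm_nonneg _) hs)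
    refine ⟨?_, ?_, ?_, ?_⟩
    · have := hm ha p1 hR
      linarith
    · have e : a * pa - b * pb = (a - b) * pa + b * (pa - pb) := by noncomm_ring
      rw [e]
      have h1 := hm (le_refl ‖a - b‖) p1 (norm_nonneg _)
      have h2 := hm hb p2 hR
      exact (norm_add_le _ _).trans ((add_le_add h1 h2).trans (by linarith))
    · have e : a * pa * D - D * (a * pa) = (a * D - D * a) * pa + a * (pa * D - D * pa) := by
        noncomm_ring
      rw [e]
      have h1 := hm (le_refl ‖a * D - D * a‖) p1 (norm_nonneg _)
      have h2 := hm ha p3 hR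
      exact (norm_add_le _ _).trans ((add_le_add h1 h2).trans (by linarith))
    · have e : (a * pa - b * pb) * D - D * (a * pa - b * pb) =
          ((a - b) * D - D * (a - b)) * pa + (a - b) * (pa * D - D * pa) +
          (b * D - D * b) * (pa - pb) + b * ((pa - pb) * D - D * (pa - pb)) := by noncomm_ring
      rw [e]
      have h1 := hm (le_refl ‖(a - b) * D - D * (a - b)‖) p1 (norm_nonneg _)
      have h2 := hm (le_refl ‖a - b‖) p3 (norm_nonneg _)
      have h3 := hm (le_refl ‖b * D - D * b‖) p2 (norm_nonneg _)
      have h4 := hm hb p4 hR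
      refine (norm_add_le _ _).trans (add_le_add ((norm_add_le _ _).trans (add_le_add
        ((norm_add_le _ _).trans (add_le_add h1 h2)) h3)) h4) |>.trans (le_of_eq ?_)
      ring

/-- For C¹ functions the second-order estimate available for polynomials may fail. Splitting off a
polynomial leaves a remainder with Lipschitz constant ε, which costs only the ε-term. -/
theorem ContDiff.exists_norm_commutator_cfc_sub_le {ψ : ℝ → ℝ} (h : ContDiff ℝ 1 ψ) {R : ℝ}
    (hR : 0 ≤ R) {ε : ℝ} (hε : 0 < ε) : ∃ K, 0 ≤ K ∧ ∀ a b : Matrix n n ℂ, a.IsHermitian →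
      b.IsHermitian → ‖a‖ ≤ R → ‖b‖ ≤ R → ∀ D : Matrix n n ℂ,
      ‖(cfc ψ a - cfc ψ b) * D - D * (cfc ψ a - cfc ψ b)‖ ≤
        ε * (‖a * D - D * a‖ + ‖b * D - D * b‖) +
        K * (‖a - b‖ * (‖a * D - D * a‖ + ‖b * D - D * b‖) +
          ‖(a - b) * D - D * (a - b)‖) := by
  obtain ⟨p, hp⟩ := h.exists_polynomial_abs_sub_le R hε
  obtain ⟨K, hK, hKp⟩ := p.exists_norm_commutator_le (n := n) hR
  refine ⟨K, hK, fun a b ha hb haR hbR D => ?_⟩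
  have hsplit : ∀ x : Matrix n n ℂ, x.IsHermitian →
      cfc ψ x = cfc (fun t => ψ t - p.eval t) x + Polynomial.aeval x p := by
    intro x hx
    have hs : IsSelfAdjoint x := hx
    rw [cfc_sub ψ (fun t => p.eval t) x (continuousOn_spectrum x _) (continuousOn_spectrum x _),
      cfc_polynomial p x hs, sub_add_cancel]
  have hrem : ∀ x : Matrix n n ℂ, x.IsHermitian → ‖x‖ ≤ R →
      ‖cfc (fun t => ψ t - p.eval t) x * D - D * cfc (fun t => ψ t - p.eval t) x‖ ≤
        ε * ‖x * D - D * x‖ := fun x hx hxR =>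
    norm_cfc_mul_sub_mul_cfc_le hx hx hε.le (fun i j => hp _
      (abs_le.1 ((hx.abs_eigenvalues_le i).trans hxR)) _
      (abs_le.1 ((hx.abs_eigenvalues_le j).trans hxR))) D
  have h1 := hrem a ha haR
  have h2 := hrem b hb hbR
  have h3 := (hKp a b D haR hbR).2.2.2
  rw [hsplit a ha, hsplit b hb]
  generalize cfc (fun t => ψ t - p.eval t) a = ea at *
  generalize cfc (fun t => ψ t - p.eval t) b = eb at *
  generalize Polynomial.aeval a p = pa at *
  generalize Polynomial.aeval b p = pb at *
  have : (ea + pa - (eb + pb)) * D - D * (ea + pa - (eb + pb)) =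
    (ea * D - D * ea) - (eb * D - D * eb) + ((pa - pb) * D - D * (pa - pb)) := by noncomm_ring
  rw [this, mul_add]
  exact (norm_add_le _ _).trans (add_le_add ((norm_sub_le _ _).trans (add_le_add h1 h2)) h3)

end FrobeniusFlow

section GlobalExistence

variable {E : Type*} [NormedAddCommGroup E] [NormedSpace ℝ E]

/-! ### Global solutions of autonomous differential equations -/

theorem eqOn_Icc_of_lipschitzOnWith {v : E → E} {s : Set E} {K : NNReal}
    (hv : LipschitzOnWith K v s) {X Y : ℝ → E} {b : ℝ}
    (hX : ∀ t ∈ Icc 0 b, HasDerivWithinAt X (v (X t)) (Icc 0 b) t)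
    (hY : ∀ t ∈ Icc 0 b, HasDerivWithinAt Y (v (Y t)) (Icc 0 b) t)
    (hXs : ∀ t ∈ Icc 0 b, X t ∈ s) (hYs : ∀ t ∈ Icc 0 b, Y t ∈ s) (h0 : X 0 = Y 0) :
    EqOn X Y (Icc 0 b) := by
  have hright : ∀ {Z : ℝ → E} (t : ℝ), t ∈ Ico 0 b →
      HasDerivWithinAt Z (v (Z t)) (Icc 0 b) t → HasDerivWithinAt Z (v (Z t)) (Ici t) t :=
    fun t ht h => h.mono_of_mem_nhdsWithin (mem_of_superset (Icc_mem_nhdsGE ht.2)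
      (Icc_subset_Icc_left ht.1))
  exact ODE_solution_unique_of_mem_Icc_right (v := fun _ => v) (s := fun _ => s)
    (fun _ _ => hv) (fun t ht => (hX t ht).continuousWithinAt)
    (fun t ht => hright t ht (hX t (Ico_subset_Icc_self ht)))
    (fun t ht => hXs t (Ico_subset_Icc_self ht))
    (fun t ht => (hY t ht).continuousWithinAt)
    (fun t ht => hright t ht (hY t (Ico_subset_Icc_self ht)))
    (fun t ht => hYs t (Ico_subset_Icc_self ht)) h0

theorem LipschitzWith.exists_global_solution [CompleteSpace E] {v : E → E} {K L : NNReal}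
    (hv : LipschitzWith K v) (hL : ∀ x, ‖v x‖ ≤ L) (x₀ : E) :
    ∃ X : ℝ → E, X 0 = x₀ ∧ ∀ t, 0 ≤ t → HasDerivWithinAt X (v (X t)) (Ici 0) t := by
  have hloc : ∀ k : ℕ, ∃ α : ℝ → E, α 0 = x₀ ∧
      ∀ t ∈ Icc (0 : ℝ) (k + 1), HasDerivWithinAt α (v (α t)) (Icc 0 (k + 1)) t := by
    intro k
    -- A curve of speed at most `L` stays within `L * (k + 1)` of its start during time `k + 1`, so
    -- no smallness of the interval is needed.
    have hPL : IsPicardLindelof (fun _ => v) (tmin := 0) (tmax := (k : ℝ) + 1)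
        ⟨0, left_mem_Icc.2 (by positivity)⟩ x₀ (L * (k + 1)) 0 L K :=
      { lipschitzOnWith := fun t _ => hv.lipschitzOnWith
        continuousOn := fun x _ => continuousOn_const
        norm_le := fun t _ x _ => hL x
        mul_max_le := by
          have : (0 : ℝ) ≤ (k : ℝ) + 1 := by positivity
          simp [this] }
    exact hPL.exists_eq_forall_mem_Icc_hasDerivWithinAt (Metric.mem_closedBall_self le_rfl)
  choose α hα0 hα using hloc
  have hle : ∀ k l : ℕ, k ≤ l → EqOn (α k) (α l) (Icc 0 (k + 1)) := by
    intro k l hkl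
    have hsub : Icc (0 : ℝ) (k + 1) ⊆ Icc 0 (l + 1) :=
      Icc_subset_Icc_right (by have : (k : ℝ) ≤ l := by exact_mod_cast hkl
                               linarith)
    exact eqOn_Icc_of_lipschitzOnWith (hv.lipschitzOnWith (s := univ)) (hα k)
      (fun t ht => (hα l t (hsub ht)).mono hsub) (fun _ _ => mem_univ _) (fun _ _ => mem_univ _)
      ((hα0 k).trans (hα0 l).symm)
  have hX : ∀ (k : ℕ) (s : ℝ), 0 ≤ s → s < k + 1 → α ⌊s⌋₊ s = α k s := by
    intro k s hs hsk
    refine hle _ k ?_ ⟨hs, (Nat.lt_floor_add_one s).le⟩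
    rw [← Nat.lt_succ_iff, Nat.floor_lt hs]
    push_cast
    exact hsk
  -- The solutions on [0, k + 1] agree where they overlap. The index ⌊t⌋ leaves `t < k + 1`
  -- strictly, so near `t` the glued curve is a single `α k`.
  refine ⟨fun t => α ⌊t⌋₊ t, by simpa using hα0 0, fun t ht => ?_⟩
  set k := ⌊t⌋₊ with hk
  have htk : t < k + 1 := Nat.lt_floor_add_one t
  have h1 := hα k t ⟨ht, htk.le⟩
  have h2 : HasDerivWithinAt (α k) (v (α k t)) (Ici 0) t := by
    refine h1.mono_of_mem_nhdsWithin ?_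
    rw [← Ici_inter_Iic]
    exact inter_mem self_mem_nhdsWithin (mem_nhdsWithin_of_mem_nhds (Iic_mem_nhds htk))
  refine h2.congr_of_eventuallyEq ?_ rfl
  filter_upwards [self_mem_nhdsWithin, mem_nhdsWithin_of_mem_nhds (Iio_mem_nhds htk)] with s hs hsk
  exact hX k s hs hsk

theorem LipschitzOnWith.exists_bound {F : Type*} [NormedAddCommGroup F] {w : F → F} {K : NNReal} {R : ℝ}
    (h : LipschitzOnWith K w (Metric.closedBall 0 R)) :
    ∃ M : NNReal, ∀ x, ‖x‖ ≤ R → ‖w x‖ ≤ M := by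
  refine ⟨⟨‖w 0‖ + K * max R 0, by positivity⟩, fun x hx => ?_⟩
  have hR : 0 ≤ R := (norm_nonneg x).trans hx
  have h1 := h.dist_le_mul x (by simpa using hx) 0 (by simpa using hR)
  rw [dist_eq_norm, dist_zero_right] at h1
  have h2 : ‖w x‖ ≤ ‖w 0‖ + ‖w x - w 0‖ := by
    have := norm_add_le (w 0) (w x - w 0)
    rwa [add_sub_cancel] at this
  have h3 : (K : ℝ) * ‖x‖ ≤ K * max R 0 :=
    mul_le_mul_of_nonneg_left (hx.trans (le_max_left _ _)) K.2
  change ‖w x‖ ≤ ‖w 0‖ + K * max R 0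
  linarith

/-- A locally Lipschitz vector field for which the norm does not increase along the solutions, even
after a nonnegative change of speed, has global forward solutions. -/
theorem exists_global_solution_of_norm_le [CompleteSpace E] {w : E → E}
    (hw : ∀ R : ℝ, ∃ K : NNReal, LipschitzOnWith K w (Metric.closedBall 0 R))
    (hnorm : ∀ (X : ℝ → E) (χ : ℝ → ℝ), (∀ t, 0 ≤ χ t) →
      (∀ t, 0 ≤ t → HasDerivWithinAt X (χ t • w (X t)) (Ici 0) t) →
      ∀ t, 0 ≤ t → ‖X t‖ ≤ ‖X 0‖) (x₀ : E) :
    ∃ X : ℝ → E, X 0 = x₀ ∧ ∀ t, 0 ≤ t → HasDerivWithinAt X (w (X t)) (Ici 0) t := by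
  set R := ‖x₀‖ with hR
  obtain ⟨K, hK⟩ := hw (R + 1)
  obtain ⟨M, hM⟩ := hK.exists_bound
  -- The cutoff makes the field bounded and globally Lipschitz. It is a nonnegative change of speed,
  -- so the norm hypothesis keeps the solution in the ball of radius `R`, where the cutoff equals 1.
  let χ : E → ℝ := fun x => max 0 (min 1 (R + 1 - ‖x‖))
  have hχ0 : ∀ x, 0 ≤ χ x := fun x => le_max_left _ _
  have hχ1 : ∀ x, χ x ≤ 1 := fun x => max_le zero_le_one (min_le_left _ _)
  have hχout : ∀ x, R + 1 < ‖x‖ → χ x = 0 := fun x hx =>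
    max_eq_left ((min_le_right _ _).trans (by linarith))
  have hχin : ∀ x, ‖x‖ ≤ R → χ x = 1 := fun x hx => by
    simp only [χ]
    rw [min_eq_left (by linarith), max_eq_right zero_le_one]
  have hχlip : ∀ x y, |χ x - χ y| ≤ ‖x - y‖ := fun x y => by
    refine (abs_max_sub_max_le_max _ _ _ _).trans ?_
    refine max_le (by simp) ((abs_min_sub_min_le_max _ _ _ _).trans (max_le (by simp) ?_))
    rw [show R + 1 - ‖x‖ - (R + 1 - ‖y‖) = -(‖x‖ - ‖y‖) by ring, abs_neg]
    exact abs_norm_sub_norm_le x y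
  have hbound : ∀ x, ‖χ x • w x‖ ≤ M := fun x => by
    rcases le_or_gt ‖x‖ (R + 1) with hx | hx
    · rw [norm_smul, Real.norm_eq_abs, abs_of_nonneg (hχ0 x)]
      exact (mul_le_of_le_one_left (norm_nonneg _) (hχ1 x)).trans (hM x hx)
    · simp [hχout x hx]
  -- Only one point has to lie in the ball: if the other is outside, its cutoff vanishes.
  have hhalf : ∀ x y, ‖x‖ ≤ R + 1 → ‖χ x • w x - χ y • w y‖ ≤ (K + M : NNReal) * ‖x - y‖ := by
    intro x y hx
    have hyterm : ‖χ y • (w x - w y)‖ ≤ K * ‖x - y‖ := by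
      rcases le_or_gt ‖y‖ (R + 1) with hy | hy
      · rw [norm_smul, Real.norm_eq_abs, abs_of_nonneg (hχ0 y)]
        have := hK.dist_le_mul x (by simpa using hx) y (by simpa using hy)
        rw [dist_eq_norm, dist_eq_norm] at this
        exact (mul_le_of_le_one_left (norm_nonneg _) (hχ1 y)).trans this
      · rw [hχout y hy, zero_smul, norm_zero]; positivity
    have hxterm : ‖(χ x - χ y) • w x‖ ≤ ‖x - y‖ * M := by
      rw [norm_smul, Real.norm_eq_abs]
      exact mul_le_mul (hχlip x y) (hM x hx) (norm_nonneg _) (norm_nonneg _)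
    have : χ x • w x - χ y • w y = (χ x - χ y) • w x + χ y • (w x - w y) := by module
    rw [this]
    refine (norm_add_le _ _).trans ((add_le_add hxterm hyterm).trans (le_of_eq ?_))
    push_cast
    ring
  have hlip : LipschitzWith (K + M) fun x => χ x • w x := by
    refine LipschitzWith.of_dist_le_mul fun x y => ?_
    rw [dist_eq_norm, dist_eq_norm]
    rcases le_or_gt ‖x‖ (R + 1) with hx | hx
    · exact hhalf x y hx
    rcases le_or_gt ‖y‖ (R + 1) with hy | hy
    · rw [norm_sub_rev, norm_sub_rev x]
      exact hhalf y x hy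
    · simp only [hχout x hx, hχout y hy, zero_smul, sub_self, norm_zero]
      positivity
  obtain ⟨X, hX0, hX⟩ := hlip.exists_global_solution hbound x₀
  refine ⟨X, hX0, fun t ht => ?_⟩
  have hle := hnorm X (fun t => χ (X t)) (fun t => hχ0 _) hX t ht
  have := hX t ht
  rwa [hχin (X t) (by rw [hX0] at hle; exact hle), one_smul] at this

end GlobalExistence

section FrobeniusFlow

attribute [local instance] Matrix.frobeniusNormedRing Matrix.frobeniusNormedAlgebra

variable {n : Type*} [Fintype n] [DecidableEq n]

/-! ### Lax equations -/

theorem HasDerivWithinAt.trace_re {A : ℝ → Matrix n n ℂ} {A' : Matrix n n ℂ} {s : Set ℝ} {t : ℝ}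
    (h : HasDerivWithinAt A A' s t) :
    HasDerivWithinAt (fun t => (A t).trace.re) A'.trace.re s t := by
  let ℓ : Matrix n n ℂ →ₗ[ℝ] ℝ := Complex.reLm ∘ₗ (Matrix.traceLinearMap n ℝ ℂ)
  exact (LinearMap.toContinuousLinearMap ℓ).hasFDerivAt.comp_hasDerivWithinAt t h

theorem HasDerivWithinAt.trace_pow_re {A : ℝ → Matrix n n ℂ} {A' : Matrix n n ℂ} {s : Set ℝ}
    {t : ℝ} (h : HasDerivWithinAt A A' s t) (k : ℕ) :
    HasDerivWithinAt (fun t => (A t ^ (k + 1)).trace.re)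
      ((k + 1) * (A t ^ k * A').trace.re) s t := by
  have h1 := (h.fun_pow' (k + 1)).trace_re
  convert h1 using 1
  rw [Matrix.trace_sum, Complex.re_sum, Finset.sum_congr rfl (g := fun _ => (A t ^ k * A').trace.re)]
  · simp
  · intro i hi
    rw [Matrix.trace_mul_comm, ← mul_assoc, ← pow_add]
    have : i + ((k + 1).pred - i) = k := by
      have := Finset.mem_range.1 hi
      simp only [Nat.pred_succ]
      omega
    rw [this]

theorem trace_star_mul_pow_deriv {H : Matrix n n ℂ} (hH : star H = H) (Y : Matrix n n ℂ) (k : ℕ) :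
    ((star Y * Y) ^ k * (star ⁅H, Y⁆ * Y + star Y * ⁅H, Y⁆)).trace =
      2 * (H * ((Y * star Y) ^ (k + 1) - (star Y * Y) ^ (k + 1))).trace := by
  have hpow : Y * (star Y * Y) ^ k * star Y = (Y * star Y) ^ (k + 1) := by
    rw [pow_succ, ← mul_assoc]
    congr 1
    induction k with
    | zero => simp
    | succ k ih => rw [pow_succ', pow_succ', mul_assoc (Y * star Y), ← ih]; simp only [mul_assoc]
  have e : star ⁅H, Y⁆ * Y + star Y * ⁅H, Y⁆ =
      2 • (star Y * H * Y) - H * (star Y * Y) - (star Y * Y) * H := by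
    rw [Ring.lie_def, star_sub, star_mul, star_mul, hH]
    noncomm_ring
  have c1 : ((star Y * Y) ^ k * (star Y * H * Y)).trace = (H * (Y * star Y) ^ (k + 1)).trace := by
    rw [← hpow, Matrix.trace_mul_comm, Matrix.trace_mul_comm H]
    rw [mul_assoc, Matrix.trace_mul_comm]
    simp only [mul_assoc]
  have c2 : ((star Y * Y) ^ k * (H * (star Y * Y))).trace =
      (H * (star Y * Y) ^ (k + 1)).trace := by
    rw [Matrix.trace_mul_comm, mul_assoc, ← pow_succ']
  have c3 : ((star Y * Y) ^ k * ((star Y * Y) * H)).trace =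
      (H * (star Y * Y) ^ (k + 1)).trace := by
    rw [← mul_assoc, ← pow_succ, Matrix.trace_mul_comm]
  rw [e, mul_sub, mul_sub, mul_smul_comm, Matrix.trace_sub, Matrix.trace_sub, Matrix.trace_smul, c1,
    c2, c3, mul_sub, Matrix.trace_sub]
  simp only [nsmul_eq_mul, Nat.cast_ofNat]
  ring

/-- `H` may be any Hermitian matrix, unrelated to `Y`: the formula is applied not only to X but also
to polynomials in X, with the same H(X). -/
theorem HasDerivWithinAt.trace_star_mul_pow {Y : ℝ → Matrix n n ℂ} {H : Matrix n n ℂ} {s : Set ℝ}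
    {t : ℝ} (hH : star H = H) (h : HasDerivWithinAt Y ⁅H, Y t⁆ s t) (k : ℕ) :
    HasDerivWithinAt (fun t => ((star (Y t) * Y t) ^ (k + 1)).trace.re)
      (2 * (k + 1) * (H * ((Y t * star (Y t)) ^ (k + 1) -
        (star (Y t) * Y t) ^ (k + 1))).trace.re) s t := by
  have h1 := (h.star.mul h).trace_pow_re k
  simp only [Pi.mul_apply] at h1
  rw [trace_star_mul_pow_deriv hH] at h1
  convert h1 using 1
  rw [show (2 : ℂ) = ((2 : ℝ) : ℂ) by norm_num, Complex.re_ofReal_mul]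
  ring

theorem HasDerivWithinAt.frobenius_norm_sq {Y : ℝ → Matrix n n ℂ} {H : Matrix n n ℂ} {s : Set ℝ}
    {t : ℝ} (hH : star H = H) (h : HasDerivWithinAt Y ⁅H, Y t⁆ s t) :
    HasDerivWithinAt (fun t => ‖Y t‖ ^ 2)
      (2 * (H * (Y t * star (Y t) - star (Y t) * Y t)).trace.re) s t := by
  have := h.trace_star_mul_pow hH 0
  simpa [frobenius_norm_sq_eq_trace] using this

theorem antitoneOn_Ici_of_hasDerivWithinAt {f f' : ℝ → ℝ} {a : ℝ}
    (h : ∀ t, a ≤ t → HasDerivWithinAt f (f' t) (Ici a) t) (h0 : ∀ t, a ≤ t → f' t ≤ 0) :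
    AntitoneOn f (Ici a) := by
  refine antitoneOn_of_hasDerivWithinAt_nonpos (convex_Ici a)
    (fun t ht => (h t ht).continuousWithinAt) (f' := f') ?_ ?_
  · intro t ht
    rw [interior_Ici] at ht ⊢
    exact (h t (le_of_lt ht)).mono Ioi_subset_Ici_self
  · intro t ht
    rw [interior_Ici] at ht
    exact h0 t (le_of_lt ht)

/-- `X` solves the Lax equation `X' = [ψ₁(X* X) - ψ₂(X X*), X]` on `[0, ∞)`. -/
def IsFlowLine (ψ₁ ψ₂ : ℝ → ℝ) (X : ℝ → Matrix n n ℂ) : Prop :=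
  ∀ t, 0 ≤ t → HasDerivWithinAt X ⁅flowField ψ₁ ψ₂ (X t), X t⁆ (Ici 0) t

variable {ψ₁ ψ₂ : ℝ → ℝ}

theorem IncreasingPair.norm_le_of_hasDerivWithinAt (h : IncreasingPair ψ₁ ψ₂)
    {X : ℝ → Matrix n n ℂ} {χ : ℝ → ℝ} (hχ : ∀ t, 0 ≤ χ t)
    (hX : ∀ t, 0 ≤ t → HasDerivWithinAt X (χ t • ⁅flowField ψ₁ ψ₂ (X t), X t⁆) (Ici 0) t)
    {t : ℝ} (ht : 0 ≤ t) : ‖X t‖ ≤ ‖X 0‖ := by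
  have hd : ∀ t, 0 ≤ t → HasDerivWithinAt (fun t => ‖X t‖ ^ 2)
      (2 * ((χ t • flowField ψ₁ ψ₂ (X t)) *
        (X t * star (X t) - star (X t) * X t)).trace.re) (Ici 0) t := by
    intro t ht
    refine HasDerivWithinAt.frobenius_norm_sq ?_ ?_
    · rw [star_smul, star_flowField, star_trivial]
    · have := hX t ht
      -- The scalar moves into the Hermitian factor: χ[H, X] = [χH, X].
      rwa [Ring.lie_def, smul_sub, ← smul_mul_assoc, ← mul_smul_comm, ← Ring.lie_def] at this
  have hanti := antitoneOn_Ici_of_hasDerivWithinAt hd (fun t _ => by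
    have h1 := trace_flowField_mul_nonpos h.monotone_left h.monotone_right (X t)
      (S := univ) (fun _ => mem_univ _) (h := fun x => x) (monotone_id.monotoneOn _)
    have hs1 : IsSelfAdjoint (X t * star (X t)) := isHermitian_mul_star _
    have hs2 : IsSelfAdjoint (star (X t) * X t) := isHermitian_star_mul _
    rw [cfc_id' ℝ _ hs1, cfc_id' ℝ _ hs2] at h1
    rw [smul_mul_assoc, Matrix.trace_smul, Complex.real_smul, Complex.re_ofReal_mul]
    have := mul_nonpos_of_nonneg_of_nonpos (hχ t) h1
    linarith)
  exact (abs_le_of_sq_le_sq' (hanti self_mem_Ici ht ht) (norm_nonneg _)).2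

theorem IsFlowLine.norm_le {X : ℝ → Matrix n n ℂ} (hX : IsFlowLine ψ₁ ψ₂ X)
    (h : IncreasingPair ψ₁ ψ₂) {t : ℝ} (ht : 0 ≤ t) : ‖X t‖ ≤ ‖X 0‖ :=
  h.norm_le_of_hasDerivWithinAt (χ := fun _ => 1) (fun _ => zero_le_one)
    (fun t ht => by rw [one_smul]; exact hX t ht) ht

theorem norm_star_mul_sub_le {X Y : Matrix n n ℂ} {R : ℝ} (hX : ‖X‖ ≤ R) (hY : ‖Y‖ ≤ R) :
    ‖star X * X - star Y * Y‖ ≤ 2 * R * ‖X - Y‖ := by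
  have : star X * X - star Y * Y = star (X - Y) * X + star Y * (X - Y) := by
    rw [star_sub]; noncomm_ring
  rw [this]
  refine (norm_add_le _ _).trans ((add_le_add (norm_mul_le _ _) (norm_mul_le _ _)).trans ?_)
  rw [frobenius_norm_star, frobenius_norm_star]
  nlinarith [norm_nonneg (X - Y)]

theorem norm_mul_star_sub_le {X Y : Matrix n n ℂ} {R : ℝ} (hX : ‖X‖ ≤ R) (hY : ‖Y‖ ≤ R) :
    ‖X * star X - Y * star Y‖ ≤ 2 * R * ‖X - Y‖ := by
  have := norm_star_mul_sub_le (X := star X) (Y := star Y) (R := R)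
    (by rwa [frobenius_norm_star]) (by rwa [frobenius_norm_star])
  rwa [star_star, star_star, ← star_sub, frobenius_norm_star] at this

theorem norm_star_mul_self_le {X : Matrix n n ℂ} {R : ℝ} (hX : ‖X‖ ≤ R) :
    ‖star X * X‖ ≤ R ^ 2 := by
  refine (norm_mul_le _ _).trans ?_
  rw [frobenius_norm_star, ← sq]
  exact pow_le_pow_left₀ (norm_nonneg _) hX 2

theorem norm_mul_star_self_le {X : Matrix n n ℂ} {R : ℝ} (hX : ‖X‖ ≤ R) :
    ‖X * star X‖ ≤ R ^ 2 := by
  refine (norm_mul_le _ _).trans ?_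
  rw [frobenius_norm_star, ← sq]
  exact pow_le_pow_left₀ (norm_nonneg _) hX 2

theorem IncreasingPair.exists_norm_flowField_sub_le (h : IncreasingPair ψ₁ ψ₂) {R : ℝ}
    (hR : 0 ≤ R) : ∃ L, 0 ≤ L ∧ ∀ X Y : Matrix n n ℂ, ‖X‖ ≤ R → ‖Y‖ ≤ R →
      ‖flowField ψ₁ ψ₂ X - flowField ψ₁ ψ₂ Y‖ ≤ L * ‖X - Y‖ := by
  obtain ⟨L₁, hL₁, h₁⟩ := h.contDiff_left.exists_norm_cfc_le (n := n) (R ^ 2)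
  obtain ⟨L₂, hL₂, h₂⟩ := h.contDiff_right.exists_norm_cfc_le (n := n) (R ^ 2)
  refine ⟨L₁ * (2 * R) + L₂ * (2 * R), by positivity, fun X Y hX hY => ?_⟩
  have e1 := h₁ _ _ (isHermitian_star_mul X) (isHermitian_star_mul Y) (norm_star_mul_self_le hX)
    (norm_star_mul_self_le hY) 1
  have e2 := h₂ _ _ (isHermitian_mul_star X) (isHermitian_mul_star Y) (norm_mul_star_self_le hX)
    (norm_mul_star_self_le hY) 1
  rw [mul_one, one_mul, mul_one, one_mul] at e1 e2
  have e3 := mul_le_mul_of_nonneg_left (norm_star_mul_sub_le hX hY) hL₁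
  have e4 := mul_le_mul_of_nonneg_left (norm_mul_star_sub_le hX hY) hL₂
  rw [flowField, flowField, sub_sub_sub_comm]
  refine (norm_sub_le _ _).trans ((add_le_add (e1.trans e3) (e2.trans e4)).trans (le_of_eq ?_))
  ring

theorem IncreasingPair.exists_norm_flowField_le (h : IncreasingPair ψ₁ ψ₂) (R : ℝ) :
    ∃ M, 0 ≤ M ∧ ∀ X : Matrix n n ℂ, ‖X‖ ≤ R → ‖flowField ψ₁ ψ₂ X‖ ≤ M := by
  rcases lt_or_ge R 0 with hR | hR
  · exact ⟨0, le_rfl, fun X hX => absurd ((norm_nonneg X).trans hX) (not_le.2 hR)⟩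
  obtain ⟨L, hL, hLip⟩ := h.exists_norm_flowField_sub_le (n := n) hR
  refine ⟨‖flowField ψ₁ ψ₂ (0 : Matrix n n ℂ)‖ + L * R, by positivity, fun X hX => ?_⟩
  have h1 := hLip X 0 hX (by simpa using hR)
  rw [sub_zero] at h1
  have h2 := norm_add_le (flowField ψ₁ ψ₂ (0 : Matrix n n ℂ))
    (flowField ψ₁ ψ₂ X - flowField ψ₁ ψ₂ 0)
  rw [add_sub_cancel] at h2
  have h3 := mul_le_mul_of_nonneg_left hX hL
  linarith

theorem norm_lie_le (A B : Matrix n n ℂ) : ‖⁅A, B⁆‖ ≤ 2 * ‖A‖ * ‖B‖ := by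
  rw [Ring.lie_def]
  refine (norm_sub_le _ _).trans ((add_le_add (norm_mul_le _ _) (norm_mul_le _ _)).trans
    (le_of_eq ?_))
  ring

theorem IncreasingPair.exists_lipschitzOnWith_lie (h : IncreasingPair ψ₁ ψ₂) (R : ℝ) :
    ∃ K : NNReal, LipschitzOnWith K (fun X : Matrix n n ℂ => ⁅flowField ψ₁ ψ₂ X, X⁆)
      (Metric.closedBall 0 R) := by
  rcases lt_or_ge R 0 with hR | hR
  · rw [Metric.closedBall_eq_empty.2 hR]
    exact ⟨0, lipschitzOnWith_empty _ _⟩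
  obtain ⟨L, hL, hLip⟩ := h.exists_norm_flowField_sub_le (n := n) hR
  obtain ⟨M, hM, hbd⟩ := h.exists_norm_flowField_le (n := n) R
  refine ⟨⟨2 * (L * R) + 2 * M, by positivity⟩, LipschitzOnWith.of_dist_le_mul
    fun X hX Y hY => ?_⟩
  rw [mem_closedBall_zero_iff] at hX hY
  rw [dist_eq_norm, dist_eq_norm]
  change _ ≤ (2 * (L * R) + 2 * M) * ‖X - Y‖
  have e : ⁅flowField ψ₁ ψ₂ X, X⁆ - ⁅flowField ψ₁ ψ₂ Y, Y⁆ =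
      ⁅flowField ψ₁ ψ₂ X - flowField ψ₁ ψ₂ Y, X⁆ + ⁅flowField ψ₁ ψ₂ Y, X - Y⁆ := by
    simp only [Ring.lie_def]; noncomm_ring
  rw [e]
  have h1 : ‖flowField ψ₁ ψ₂ X - flowField ψ₁ ψ₂ Y‖ * ‖X‖ ≤ (L * ‖X - Y‖) * R :=
    mul_le_mul (hLip X Y hX hY) hX (norm_nonneg _) (by positivity)
  have h2 : ‖flowField ψ₁ ψ₂ Y‖ * ‖X - Y‖ ≤ M * ‖X - Y‖ :=
    mul_le_mul_of_nonneg_right (hbd Y hY) (norm_nonneg _)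
  refine (norm_add_le _ _).trans ((add_le_add (norm_lie_le _ _) (norm_lie_le _ _)).trans ?_)
  linarith

theorem IncreasingPair.exists_isFlowLine (h : IncreasingPair ψ₁ ψ₂) (T : Matrix n n ℂ) :
    ∃ X, X 0 = T ∧ IsFlowLine ψ₁ ψ₂ X := by
  have : CompleteSpace (Matrix n n ℂ) := FiniteDimensional.complete ℝ _
  exact exists_global_solution_of_norm_le h.exists_lipschitzOnWith_lie
    (fun X χ hχ hX t ht => h.norm_le_of_hasDerivWithinAt hχ hX ht) T

theorem IsFlowLine.eq_of_eq_zero {X Y : ℝ → Matrix n n ℂ} (h : IncreasingPair ψ₁ ψ₂)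
    (hX : IsFlowLine ψ₁ ψ₂ X) (hY : IsFlowLine ψ₁ ψ₂ Y) (h0 : X 0 = Y 0) {t : ℝ} (ht : 0 ≤ t) :
    X t = Y t := by
  obtain ⟨K, hK⟩ := h.exists_lipschitzOnWith_lie (n := n) ‖X 0‖
  refine eqOn_Icc_of_lipschitzOnWith hK (b := t)
    (fun s hs => (hX s hs.1).mono Icc_subset_Ici_self)
    (fun s hs => (hY s hs.1).mono Icc_subset_Ici_self)
    (fun s hs => mem_closedBall_zero_iff.2 (hX.norm_le h hs.1))
    (fun s hs => mem_closedBall_zero_iff.2 ?_) h0 (right_mem_Icc.2 ht)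
  rw [h0]
  exact hY.norm_le h hs.1

/-! ### Polynomials along a flow line -/

/-- Bracketing with H is a derivation of the matrix algebra that kills scalars, so every polynomial
in X obeys the Lax equation of X. -/
theorem HasDerivWithinAt.aeval_lie {X : ℝ → Matrix n n ℂ} {H : Matrix n n ℂ} {s : Set ℝ} {t : ℝ}
    (h : HasDerivWithinAt X ⁅H, X t⁆ s t) (p : Polynomial ℂ) :
    HasDerivWithinAt (fun t => Polynomial.aeval (X t) p) ⁅H, Polynomial.aeval (X t) p⁆ s t := by
  induction p using Polynomial.induction_on with
  | C c =>
    simp only [Polynomial.aeval_C]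
    rw [Ring.lie_def, Algebra.commutes, sub_self]
    exact hasDerivWithinAt_const _ _ _
  | add p q hp hq =>
    simp only [map_add]
    have e : ∀ x y : Matrix n n ℂ, ⁅H, x + y⁆ = ⁅H, x⁆ + ⁅H, y⁆ := fun x y => by
      simp only [Ring.lie_def]; noncomm_ring
    rw [e]
    exact hp.add hq
  | monomial k c hk =>
    have hX : ∀ x : Matrix n n ℂ, Polynomial.aeval x (Polynomial.C c * Polynomial.X ^ (k + 1)) =
        x * Polynomial.aeval x (Polynomial.C c * Polynomial.X ^ k) := fun x => by
      rw [pow_succ', mul_left_comm, map_mul, Polynomial.aeval_X]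
    simp only [hX]
    have e : ∀ x y : Matrix n n ℂ, ⁅H, x * y⁆ = ⁅H, x⁆ * y + x * ⁅H, y⁆ := fun x y => by
      simp only [Ring.lie_def]; noncomm_ring
    rw [e]
    exact h.mul hk

theorem eq_zero_of_hasDerivWithinAt_lie {Z H : ℝ → Matrix n n ℂ} {M : ℝ}
    (hH : ∀ t, 0 ≤ t → ‖H t‖ ≤ M)
    (hZ : ∀ t, 0 ≤ t → HasDerivWithinAt Z ⁅H t, Z t⁆ (Ici 0) t) (h0 : Z 0 = 0) {t : ℝ}
    (ht : 0 ≤ t) : Z t = 0 := by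
  have := norm_le_gronwallBound_of_norm_deriv_right_le (f := Z) (f' := fun t => ⁅H t, Z t⁆)
    (δ := 0) (K := 2 * M) (ε := 0) (a := 0) (b := t)
    (fun s hs => (hZ s hs.1).continuousWithinAt.mono Icc_subset_Ici_self)
    (fun s hs => (hZ s hs.1).mono (Ici_subset_Ici.2 hs.1)) (by rw [h0, norm_zero])
    (fun s hs => by
      have := mul_le_mul_of_nonneg_right (hH s hs.1) (norm_nonneg (Z s))
      have := norm_lie_le (H s) (Z s)
      linarith) t (right_mem_Icc.2 ht)
  rw [gronwallBound_ε0_δ0] at this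
  exact norm_le_zero_iff.1 this

/-- p(X) solves the linear equation Z' = [H, Z] with bounded H and starts at zero, so Grönwall's
inequality keeps it there. -/
theorem IsFlowLine.aeval_eq_zero {X : ℝ → Matrix n n ℂ} (hX : IsFlowLine ψ₁ ψ₂ X)
    (h : IncreasingPair ψ₁ ψ₂) {p : Polynomial ℂ} (hp : Polynomial.aeval (X 0) p = 0) {t : ℝ}
    (ht : 0 ≤ t) : Polynomial.aeval (X t) p = 0 := by
  obtain ⟨M, hM, hbd⟩ := h.exists_norm_flowField_le (n := n) ‖X 0‖
  exact eq_zero_of_hasDerivWithinAt_lie (Z := fun t => Polynomial.aeval (X t) p)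
    (H := fun t => flowField ψ₁ ψ₂ (X t)) (M := M)
    (fun t ht => hbd _ (hX.norm_le h ht)) (fun t ht => (hX t ht).aeval_lie p) hp ht

theorem IsFlowLine.trace_aeval {X : ℝ → Matrix n n ℂ} (hX : IsFlowLine ψ₁ ψ₂ X)
    (p : Polynomial ℂ) {t : ℝ} (ht : 0 ≤ t) :
    (Polynomial.aeval (X t) p).trace.re = (Polynomial.aeval (X 0) p).trace.re := by
  have hd : ∀ s, 0 ≤ s → HasDerivWithinAt (fun s => (Polynomial.aeval (X s) p).trace.re) 0
      (Ici 0) s := fun s hs => by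
    have := ((hX s hs).aeval_lie p).trace_re
    rwa [Ring.lie_def, Matrix.trace_sub, Matrix.trace_mul_comm, sub_self, Complex.zero_re] at this
  have h1 := antitoneOn_Ici_of_hasDerivWithinAt hd (fun _ _ => le_rfl) self_mem_Ici ht ht
  have h2 := antitoneOn_Ici_of_hasDerivWithinAt (fun s hs => (hd s hs).neg)
    (fun _ _ => by simp) self_mem_Ici ht ht
  simp only [Pi.neg_apply] at h2
  linarith

end FrobeniusFlow

section FrobeniusFlow

attribute [local instance] Matrix.frobeniusNormedRing Matrix.frobeniusNormedAlgebra

variable {n : Type*} [Fintype n] [DecidableEq n] {ψ₁ ψ₂ : ℝ → ℝ}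

/-! ### Invariance of the bounds on the singular values -/

/-- Powers of x/y > 1 would outgrow `N`; this extracts the largest eigenvalue from power sums. -/
theorem le_of_forall_pow_le_mul_pow {x y N : ℝ} (hy : 0 ≤ y)
    (h : ∀ k : ℕ, x ^ (k + 1) ≤ N * y ^ (k + 1)) : x ≤ y := by
  by_contra! hlt
  rcases hy.eq_or_lt with rfl | hy
  · have := h 0
    simp at this
    linarith
  have hr : 1 < x / y := (one_lt_div hy).2 hlt
  obtain ⟨k, hk⟩ := ((tendsto_pow_atTop_atTop_of_one_lt hr).eventually_gt_atTop N).exists_forall_of_atTop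
  have h1 := hk (k + 1) (Nat.le_succ k)
  rw [div_pow, lt_div_iff₀ (by positivity)] at h1
  exact absurd (h k) (not_le.2 h1)

theorem cfc_pow_eq {A : Matrix n n ℂ} (hA : A.IsHermitian) (k : ℕ) :
    cfc (fun x : ℝ => x ^ k) A = A ^ k := by
  have hs : IsSelfAdjoint A := hA
  exact cfc_pow_id A k

theorem Matrix.IsHermitian.trace_pow_re {A : Matrix n n ℂ} (hA : A.IsHermitian) (k : ℕ) :
    (A ^ k).trace.re = ∑ i, hA.eigenvalues i ^ k := by
  rw [← cfc_pow_eq hA, trace_cfc hA, Complex.ofReal_re]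

theorem Matrix.IsHermitian.le_of_trace_pow_le {A B : Matrix n n ℂ} (hA : A.IsHermitian)
    (hB : B.IsHermitian) (hA0 : ∀ i, 0 ≤ hA.eigenvalues i) (hB0 : ∀ i, 0 ≤ hB.eigenvalues i)
    (h : ∀ k, (A ^ (k + 1)).trace.re ≤ (B ^ (k + 1)).trace.re) {β : ℝ} (hβ : 0 ≤ β)
    (hBβ : ∀ i, hB.eigenvalues i ≤ β) (i : n) : hA.eigenvalues i ≤ β := by
  refine le_of_forall_pow_le_mul_pow (N := Fintype.card n) hβ fun k => ?_
  calc hA.eigenvalues i ^ (k + 1) ≤ ∑ i, hA.eigenvalues i ^ (k + 1) :=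
        Finset.single_le_sum (f := fun i => hA.eigenvalues i ^ (k + 1))
          (fun i _ => pow_nonneg (hA0 i) _) (Finset.mem_univ i)
    _ = (A ^ (k + 1)).trace.re := (hA.trace_pow_re _).symm
    _ ≤ (B ^ (k + 1)).trace.re := h k
    _ = ∑ i, hB.eigenvalues i ^ (k + 1) := hB.trace_pow_re _
    _ ≤ ∑ _i : n, β ^ (k + 1) := Finset.sum_le_sum fun j _ => pow_le_pow_left₀ (hB0 j) (hBβ j) _
    _ = Fintype.card n * β ^ (k + 1) := by simp

/-- Every power sum tr (X*X)^(k+1) decreases, since x ↦ x^(k+1) is increasing on [0, ∞); letting k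
grow bounds the largest eigenvalue. -/
theorem IsFlowLine.eigenvalues_le {X : ℝ → Matrix n n ℂ} (hX : IsFlowLine ψ₁ ψ₂ X)
    (h : IncreasingPair ψ₁ ψ₂) {β : ℝ} (hβ : 0 ≤ β)
    (h0 : ∀ i, (isHermitian_star_mul (X 0)).eigenvalues i ≤ β) {t : ℝ} (ht : 0 ≤ t) (i : n) :
    (isHermitian_star_mul (X t)).eigenvalues i ≤ β := by
  refine Matrix.IsHermitian.le_of_trace_pow_le _ (isHermitian_star_mul (X 0))
    (eigenvalues_star_mul_self_nonneg _) (eigenvalues_star_mul_self_nonneg _) (fun k => ?_) hβ h0 i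
  refine antitoneOn_Ici_of_hasDerivWithinAt
    (fun t ht => (hX t ht).trace_star_mul_pow (star_flowField ψ₁ ψ₂ (X t)) k)
    (fun t ht => ?_) self_mem_Ici ht ht
  have h1 := trace_flowField_mul_nonpos h.monotone_left h.monotone_right (X t) (S := Ici 0)
    (eigenvalues_star_mul_self_nonneg _) (h := fun x => x ^ (k + 1))
    (fun x hx y _ hxy => pow_le_pow_left₀ hx hxy _)
  rw [cfc_pow_eq (isHermitian_star_mul _), cfc_pow_eq (isHermitian_mul_star _)] at h1
  exact mul_nonpos_of_nonneg_of_nonpos (by positivity) h1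

theorem cfc_inv_pow_eq {A B : Matrix n n ℂ} (hA : A.IsHermitian)
    (hpos : ∀ i, 0 < hA.eigenvalues i) (hAB : A * B = 1) (k : ℕ) :
    cfc (fun x : ℝ => x⁻¹ ^ k) A = B ^ k := by
  have hs : IsSelfAdjoint A := hA
  have h1 : cfc (fun x : ℝ => x⁻¹) A * A = 1 := by
    have : cfc (fun x : ℝ => x⁻¹) A * cfc (fun x : ℝ => x) A = 1 := by
      rw [cfc_mul_cfc, ← cfc_const_one ℝ A]
      refine cfc_congr fun x hx => ?_
      rw [hA.spectrum_real_eq_range_eigenvalues] at hx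
      obtain ⟨i, rfl⟩ := hx
      exact inv_mul_cancel₀ (hpos i).ne'
    rwa [cfc_id' ℝ A hs] at this
  have h2 : cfc (fun x : ℝ => x⁻¹) A = B := left_inv_eq_right_inv h1 hAB
  rw [cfc_pow (fun x : ℝ => x⁻¹) k A (continuousOn_spectrum A _), h2]

/-- This is Cayley–Hamilton divided by the constant coefficient ± det T. Having the inverse as a
polynomial lets it follow the Lax equation. -/
theorem exists_aeval_inverse {T : Matrix n n ℂ} (hT : IsUnit T) :
    ∃ q : Polynomial ℂ, T * Polynomial.aeval T q = 1 := by
  have hdet : T.charpoly.coeff 0 ≠ 0 := by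
    have := Matrix.det_eq_sign_charpoly_coeff T
    intro h0
    rw [h0, mul_zero] at this
    exact ((Matrix.isUnit_iff_isUnit_det T).1 hT).ne_zero this
  refine ⟨Polynomial.C (-(T.charpoly.coeff 0)⁻¹) * T.charpoly.divX, ?_⟩
  have h := T.aeval_self_charpoly
  rw [← Polynomial.divX_mul_X_add T.charpoly, map_add, map_mul, Polynomial.aeval_X,
    Polynomial.aeval_C] at h
  have h' : Polynomial.aeval T T.charpoly.divX * T =
      -algebraMap ℂ (Matrix n n ℂ) (T.charpoly.coeff 0) := eq_neg_of_add_eq_zero_left h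
  have hc : T * Polynomial.aeval T T.charpoly.divX = Polynomial.aeval T T.charpoly.divX * T := by
    have := Polynomial.aeval_mul (x := T) (p := Polynomial.X) (q := T.charpoly.divX)
    rw [mul_comm, Polynomial.aeval_mul, Polynomial.aeval_X] at this
    exact this.symm
  rw [map_mul, Polynomial.aeval_C, Algebra.left_comm, hc, h', ← map_neg, ← map_mul, neg_mul_neg,
    inv_mul_cancel₀ hdet, map_one]

theorem eigenvalues_star_mul_self_pos {X : Matrix n n ℂ} (hX : IsUnit X) (i : n) :
    0 < (isHermitian_star_mul X).eigenvalues i := by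
  refine lt_of_le_of_ne (eigenvalues_star_mul_self_nonneg X i) fun h0 => ?_
  have h1 : IsUnit (star X * X) := hX.star.mul hX
  have h2 := (isHermitian_star_mul X).eigenvalues_mem_spectrum_real i
  rw [← h0] at h2
  exact (spectrum.zero_mem_iff ℝ).1 h2 h1

/-- The upper bound is applied to Y = X⁻¹: the eigenvalues of Y*Y are the inverses of those of XX*,
which are those of X*X. -/
theorem IsFlowLine.le_eigenvalues {X : ℝ → Matrix n n ℂ} (hX : IsFlowLine ψ₁ ψ₂ X)
    (h : IncreasingPair ψ₁ ψ₂) {β : ℝ} (hβ : 0 < β)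
    (h0 : ∀ i, β ≤ (isHermitian_star_mul (X 0)).eigenvalues i) {t : ℝ} (ht : 0 ≤ t) (i : n) :
    β ≤ (isHermitian_star_mul (X t)).eigenvalues i := by
  have hU0 : IsUnit (X 0) := by
    have h1 : IsUnit (star (X 0) * X 0) := by
      by_contra hn
      have h2 := (spectrum.zero_mem_iff ℝ).2 hn
      rw [(isHermitian_star_mul (X 0)).spectrum_real_eq_range_eigenvalues] at h2
      obtain ⟨j, hj⟩ := h2
      linarith [h0 j]
    rw [Matrix.isUnit_iff_isUnit_det, Matrix.det_mul] at h1
    exact (Matrix.isUnit_iff_isUnit_det _).2 (isUnit_of_mul_isUnit_right h1)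
  obtain ⟨q, hq⟩ := exists_aeval_inverse hU0
  set Y : ℝ → Matrix n n ℂ := fun t => Polynomial.aeval (X t) q with hY
  -- The equation X q(X) = 1 is polynomial and therefore persists, so X stays invertible with
  -- inverse q(X).
  have hXY : ∀ t, 0 ≤ t → X t * Y t = 1 := fun t ht => by
    have := hX.aeval_eq_zero h (p := Polynomial.X * q - 1) (by simp [hq]) ht
    rw [map_sub, map_mul, Polynomial.aeval_X, map_one, sub_eq_zero] at this
    exact this
  have hYX : ∀ t, 0 ≤ t → Y t * X t = 1 := fun t ht => mul_eq_one_comm.1 (hXY t ht)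
  have hU : ∀ t, 0 ≤ t → IsUnit (X t) := fun t ht =>
    IsUnit.of_mul_eq_one _ (hXY t ht)
  have hinv1 : ∀ t, 0 ≤ t → (star (X t) * X t) * (Y t * star (Y t)) = 1 := fun t ht => by
    rw [mul_assoc, ← mul_assoc (X t), hXY t ht, one_mul, ← star_mul, hYX t ht, star_one]
  have hinv2 : ∀ t, 0 ≤ t → (X t * star (X t)) * (star (Y t) * Y t) = 1 := fun t ht => by
    rw [mul_assoc, ← mul_assoc (star (X t)), ← star_mul, hYX t ht, star_one, one_mul, hXY t ht]
  have hpos := fun t (ht : 0 ≤ t) => eigenvalues_star_mul_self_pos (hU t ht)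
  have heq := fun t => ((isHermitian_star_mul (X t)).eigenvalues_eq_eigenvalues_iff
    (isHermitian_mul_star (X t))).2 (charpoly_star_mul_self (X t))
  have hpos' : ∀ t, 0 ≤ t → ∀ i, 0 < (isHermitian_mul_star (X t)).eigenvalues i := fun t ht i => by
    rw [← heq]; exact hpos t ht i
  have htr : ∀ t, 0 ≤ t → ∀ k, ((star (Y t) * Y t) ^ k).trace.re =
      ∑ i, ((isHermitian_star_mul (X t)).eigenvalues i)⁻¹ ^ k := fun t ht k => by
    rw [← cfc_inv_pow_eq (isHermitian_mul_star (X t)) (hpos' t ht) (hinv2 t ht) k,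
      trace_cfc (isHermitian_mul_star (X t)), Complex.ofReal_re, ← heq]
  have hanti : ∀ k, ((star (Y t) * Y t) ^ (k + 1)).trace.re ≤
      ((star (Y 0) * Y 0) ^ (k + 1)).trace.re := fun k => by
    refine antitoneOn_Ici_of_hasDerivWithinAt
      (fun t ht => ((hX t ht).aeval_lie q).trace_star_mul_pow (star_flowField ψ₁ ψ₂ (X t)) k)
      (fun t ht => ?_) self_mem_Ici ht ht
    -- The increasing function here is −x^(−(k+1)) on (0, ∞); its sign and the exchange of X*X and
    -- XX* under inversion compensate.
    have h1 := trace_flowField_mul_nonpos h.monotone_left h.monotone_right (X t) (S := Ioi 0)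
      (hpos t ht) (h := fun x => -(x⁻¹ ^ (k + 1))) (fun x hx y hy hxy =>
        neg_le_neg (pow_le_pow_left₀ (inv_nonneg.2 (le_of_lt hy)) (inv_anti₀ hx hxy) _))
    rw [cfc_neg, cfc_neg, cfc_inv_pow_eq (isHermitian_star_mul _) (hpos t ht) (hinv1 t ht),
      cfc_inv_pow_eq (isHermitian_mul_star _) (hpos' t ht) (hinv2 t ht), neg_sub_neg] at h1
    exact mul_nonpos_of_nonneg_of_nonpos (by positivity) h1
  have hle : ((isHermitian_star_mul (X t)).eigenvalues i)⁻¹ ≤ β⁻¹ := by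
    refine le_of_forall_pow_le_mul_pow (N := Fintype.card n)
      (inv_nonneg.2 hβ.le) fun k => ?_
    have h1 := hanti k
    rw [htr t ht, htr 0 le_rfl] at h1
    calc _ ≤ ∑ i, ((isHermitian_star_mul (X t)).eigenvalues i)⁻¹ ^ (k + 1) :=
          Finset.single_le_sum
            (f := fun i => ((isHermitian_star_mul (X t)).eigenvalues i)⁻¹ ^ (k + 1))
            (fun i _ => pow_nonneg (inv_nonneg.2 (hpos t ht i).le) _) (Finset.mem_univ i)
      _ ≤ _ := h1
      _ ≤ ∑ _i : n, β⁻¹ ^ (k + 1) := Finset.sum_le_sum fun j _ =>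
          pow_le_pow_left₀ (inv_nonneg.2 (hpos 0 le_rfl j).le) (inv_anti₀ hβ (h0 j)) _
      _ = Fintype.card n * β⁻¹ ^ (k + 1) := by simp
  exact (inv_le_inv₀ (hpos t ht i) hβ).1 hle

/-! ### The set `M_n[a, b]` -/

theorem CFC_abs_eq_cfc_sqrt (X : Matrix n n ℂ) :
    CFC.abs X = cfc Real.sqrt (star X * X) := by
  rw [CFC.abs, CFC.sqrt_eq_real_sqrt _ (star_mul_self_nonneg X),
    cfcₙ_eq_cfc (hf := ?_) (hf0 := Real.sqrt_zero)]
  exact Real.continuous_sqrt.continuousOn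

theorem spectrum_abs (X : Matrix n n ℂ) :
    spectrum ℝ (CFC.abs X) = range fun i => Real.sqrt ((isHermitian_star_mul X).eigenvalues i) := by
  have hs : IsSelfAdjoint (star X * X) := isHermitian_star_mul X
  rw [CFC_abs_eq_cfc_sqrt, cfc_map_spectrum Real.sqrt (star X * X) hs (continuousOn_spectrum _ _),
    (isHermitian_star_mul X).spectrum_real_eq_range_eigenvalues, ← range_comp]
  rfl

theorem cfc_abs_eq (φ : ℝ → ℝ) (X : Matrix n n ℂ) :
    cfc φ (CFC.abs X) = cfc (fun x => φ (Real.sqrt x)) (star X * X) := by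
  have hs : IsSelfAdjoint (star X * X) := isHermitian_star_mul X
  rw [CFC_abs_eq_cfc_sqrt]
  exact (cfc_comp' φ Real.sqrt (star X * X)
    (((Matrix.finite_real_spectrum).image _).continuousOn _)
    (continuousOn_spectrum _ _) hs).symm

theorem mem_matrixInterval_iff {m : ℕ} {a b : ℝ} (ha : 0 ≤ a) (hab : a < b)
    {X : Matrix (Fin m) (Fin m) ℂ} : X ∈ matrixInterval m a b ↔
      ∀ i, (isHermitian_star_mul X).eigenvalues i ∈ Icc (a ^ 2) (b ^ 2) := by
  change spectrum ℝ (CFC.abs X) ⊆ Icc a b ↔ _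
  rw [spectrum_abs, range_subset_iff]
  refine forall_congr' fun i => ?_
  have h0 := eigenvalues_star_mul_self_nonneg X i
  rw [mem_Icc, mem_Icc, Real.le_sqrt ha h0, Real.sqrt_le_left (ha.trans hab.le)]

theorem phiOf_eq_flowField {m : ℕ} {a b : ℝ} (ha : 0 ≤ a) (hab : a < b)
    {φ₁ φ₂ ψ₁ ψ₂ : ℝ → ℝ} (h₁ : ∀ x ∈ Icc (a ^ 2) (b ^ 2), ψ₁ x = φ₁ (Real.sqrt x))
    (h₂ : ∀ x ∈ Icc (a ^ 2) (b ^ 2), ψ₂ x = φ₂ (Real.sqrt x))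
    {X : Matrix (Fin m) (Fin m) ℂ} (hX : X ∈ matrixInterval m a b) :
    phiOf φ₁ φ₂ X = flowField ψ₁ ψ₂ X := by
  rw [mem_matrixInterval_iff ha hab] at hX
  have heq := ((isHermitian_star_mul X).eigenvalues_eq_eigenvalues_iff
    (isHermitian_mul_star X)).2 (charpoly_star_mul_self X)
  rw [phiOf, flowField, cfc_abs_eq, cfc_abs_eq, star_star]
  congr 1
  · refine cfc_congr fun x hx => ?_
    rw [(isHermitian_star_mul X).spectrum_real_eq_range_eigenvalues] at hx
    obtain ⟨i, rfl⟩ := hx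
    exact (h₁ _ (hX i)).symm
  · refine cfc_congr fun x hx => ?_
    rw [(isHermitian_mul_star X).spectrum_real_eq_range_eigenvalues, ← heq] at hx
    obtain ⟨i, rfl⟩ := hx
    exact (h₂ _ (hX i)).symm

theorem IsFlowLine.mem_matrixInterval {m : ℕ} {a b : ℝ} (ha : 0 ≤ a) (hab : a < b)
    {X : ℝ → Matrix (Fin m) (Fin m) ℂ} (hX : IsFlowLine ψ₁ ψ₂ X) (h : IncreasingPair ψ₁ ψ₂)
    (h0 : X 0 ∈ matrixInterval m a b) {t : ℝ} (ht : 0 ≤ t) : X t ∈ matrixInterval m a b := by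
  rw [mem_matrixInterval_iff ha hab] at h0 ⊢
  refine fun i => ⟨?_, hX.eigenvalues_le h (sq_nonneg b) (fun i => (h0 i).2) ht i⟩
  -- For a = 0 the lower bound is positivity of X*X; the argument through the inverse needs a > 0.
  rcases ha.eq_or_lt with rfl | ha
  · simpa using eigenvalues_star_mul_self_nonneg (X t) i
  · exact hX.le_eigenvalues h (by positivity) (fun i => (h0 i).1) ht i

end FrobeniusFlow

section FrobeniusFlow

attribute [local instance] Matrix.frobeniusNormedRing Matrix.frobeniusNormedAlgebra

variable {n : Type*} [Fintype n] [DecidableEq n]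

/-! ### Matrices annihilated by a polynomial with simple roots -/

/-- Jordan–Chevalley decomposition stated through polynomial equations only, so that both persist
along the flow with the same `Λ`, `q` and `k`. -/
theorem exists_semisimple_part (T : Matrix n n ℂ) : ∃ (Λ : Finset ℂ) (q : Polynomial ℂ) (k : ℕ),
    Polynomial.aeval T ((Polynomial.X - q) ^ k) = 0 ∧
    Polynomial.aeval (Polynomial.aeval T q) (∏ z ∈ Λ, (Polynomial.X - Polynomial.C z)) = 0 := by
  obtain ⟨g, k, hsq, -, hdvd⟩ := exists_squarefree_dvd_pow_of_ne_zero T.charpoly_monic.ne_zero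
  have hg0 : g ≠ 0 := hsq.ne_zero
  have hsep : g.Separable := PerfectField.separable_iff_squarefree.2 hsq
  have hgT : Polynomial.aeval T (g ^ k) = 0 := by
    obtain ⟨r, hr⟩ := hdvd
    rw [hr, map_mul, T.aeval_self_charpoly, zero_mul]
  -- The Newton–Hensel lift of a root of the squarefree `g` needs a commutative ring; within ℂ[T]
  -- the root found is automatically a polynomial in T.
  set S := Algebra.adjoin ℂ {T}
  set τ : S := ⟨T, Algebra.self_mem_adjoin_singleton ℂ T⟩ with hτ
  have hcoe : ∀ (x : S) (p : Polynomial ℂ), ((Polynomial.aeval x p : S) : Matrix n n ℂ) =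
      Polynomial.aeval (x : Matrix n n ℂ) p := fun x p => by
    rw [Polynomial.aeval_subalgebra_coe]
  have hnil : IsNilpotent (Polynomial.aeval τ g) := by
    refine ⟨k, Subtype.ext ?_⟩
    rw [← map_pow, hcoe, hgT]
    rfl
  have hunit : IsUnit (Polynomial.aeval τ (Polynomial.derivative g)) := by
    obtain ⟨u, v, huv⟩ : IsCoprime (g ^ k) (Polynomial.derivative g) := IsCoprime.pow_left hsep
    refine IsUnit.of_mul_eq_one_right (Polynomial.aeval τ v) (Subtype.ext ?_)
    have := congrArg (Polynomial.aeval T) huv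
    rw [map_add, map_mul, hgT, mul_zero, zero_add, map_mul, map_one] at this
    rw [← map_mul, hcoe, map_mul, this]
    rfl
  obtain ⟨s, ⟨⟨j, hj⟩, hs0⟩, -⟩ := Polynomial.existsUnique_nilpotent_sub_and_aeval_eq_zero hnil hunit
  obtain ⟨q, hq⟩ : ∃ q : Polynomial ℂ, Polynomial.aeval T q = s := by
    have : (s : Matrix n n ℂ) ∈ Algebra.adjoin ℂ {T} := s.2
    rw [Algebra.adjoin_singleton_eq_range_aeval] at this
    exact this
  refine ⟨g.roots.toFinset, q, j, ?_, ?_⟩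
  · have := congrArg Subtype.val hj
    rw [map_pow, map_sub, Polynomial.aeval_X, hq]
    simpa [hτ] using this
  · have h1 : Polynomial.aeval (s : Matrix n n ℂ) g = 0 := by rw [← hcoe, hs0]; rfl
    have hprod := (IsAlgClosed.splits g).eq_prod_roots
    have hnodup : g.roots.Nodup := Polynomial.nodup_roots hsep
    have h2 : ∏ z ∈ g.roots.toFinset, (Polynomial.X - Polynomial.C z) =
        (g.roots.map fun a => Polynomial.X - Polynomial.C a).prod := by
      rw [Finset.prod, Multiset.toFinset_val, hnodup.dedup]
    rw [hq, h2]
    rw [hprod, map_mul, Polynomial.aeval_C, ← Algebra.smul_def] at h1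
    exact (smul_eq_zero.1 h1).resolve_left (Polynomial.leadingCoeff_ne_zero.2 hg0)

variable {Λ : Finset ℂ}

theorem aeval_eq_of_eval_eq {D : Matrix n n ℂ}
    (hD : Polynomial.aeval D (∏ z ∈ Λ, (Polynomial.X - Polynomial.C z)) = 0) {p q : Polynomial ℂ}
    (h : ∀ z ∈ Λ, p.eval z = q.eval z) : Polynomial.aeval D p = Polynomial.aeval D q := by
  have hdvd : ∏ z ∈ Λ, (Polynomial.X - Polynomial.C z) ∣ p - q := by
    refine Finset.prod_dvd_of_coprime ?_ fun z hz => ?_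
    · exact (Polynomial.pairwise_coprime_X_sub_C (s := fun z : ℂ => z)
        Function.injective_id).set_pairwise _
    · rw [Polynomial.dvd_iff_isRoot, Polynomial.IsRoot, Polynomial.eval_sub, h z hz, sub_self]
  obtain ⟨r, hr⟩ := hdvd
  rw [← sub_eq_zero, ← map_sub, hr, map_mul, hD, zero_mul]

/-- The polynomial with value `conj z` at the nodes `z`. -/
noncomputable def conjInterpolant (Λ : Finset ℂ) : Polynomial ℂ :=
  Lagrange.interpolate Λ id (fun z => star z)

/-- The Lagrange polynomial of a node, which gives the spectral projection. -/
noncomputable def nodePolynomial (Λ : Finset ℂ) (z : ℂ) : Polynomial ℂ :=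
  Lagrange.basis Λ id z

theorem nodePolynomial_eval {z w : ℂ} (hz : z ∈ Λ) (hw : w ∈ Λ) :
    (nodePolynomial Λ z).eval w = if z = w then 1 else 0 := by
  split_ifs with h
  · subst h
    exact Lagrange.eval_basis_self (v := id) Function.injective_id.injOn hz
  · exact Lagrange.eval_basis_of_ne (v := id) h hw

/-- With A = P − P* and J = P + P* − 1 one has AJ = [P, P*] and J² = 1 − A². As A is skew-Hermitian,
‖AJ‖² = ‖A‖² + ‖A²‖². -/
theorem norm_sub_star_le_of_isIdempotent {P : Matrix n n ℂ} (hP : P * P = P) :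
    ‖P - star P‖ ≤ ‖P * star P - star P * P‖ := by
  have hP' : star P * star P = star P := by rw [← star_mul, hP]
  set A := P - star P with hA
  have hAs : star A = -A := by rw [hA, star_sub, star_star, neg_sub]
  set J := P + star P - 1 with hJ
  have hJs : star J = J := by rw [hJ, star_sub, star_add, star_star, star_one, add_comm]
  have hAJ : A * J = P * star P - star P * P := by
    have : A * J = P * P + P * star P - P - star P * P - star P * star P + star P := by
      rw [hA, hJ]; noncomm_ring
    rw [this, hP, hP']; abel
  have hJJ : J * J = 1 - A * A := by
    have h1 : J * J = P * P + P * star P - P + star P * P + star P * star P - star P - P - star P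
        + 1 := by rw [hJ]; noncomm_ring
    have h2 : A * A = P * P - P * star P - star P * P + star P * star P := by
      rw [hA]; noncomm_ring
    rw [h1, h2, hP, hP']; abel
  rw [← hAJ]
  refine (abs_le_of_sq_le_sq' ?_ (norm_nonneg _)).2
  have e : ‖A * J‖ ^ 2 = ‖A‖ ^ 2 + ‖A * A‖ ^ 2 := by
    rw [frobenius_norm_sq_eq_trace, frobenius_norm_sq_eq_trace, frobenius_norm_sq_eq_trace,
      star_mul, star_mul, hJs, hAs, mul_assoc, Matrix.trace_mul_comm,
      ← Complex.add_re, ← Matrix.trace_add]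
    congr 2
    rw [mul_assoc, mul_assoc, hJJ]
    noncomm_ring
  rw [e]
  have := sq_nonneg ‖A * A‖
  linarith

theorem exists_norm_nodeProjection_sub_star_le (Λ : Finset ℂ) {R : ℝ} (hR : 0 ≤ R) :
    ∃ K, 0 ≤ K ∧ ∀ D : Matrix n n ℂ, ‖D‖ ≤ R →
      Polynomial.aeval D (∏ z ∈ Λ, (Polynomial.X - Polynomial.C z)) = 0 → ∀ z ∈ Λ,
      ‖Polynomial.aeval D (nodePolynomial Λ z)‖ ≤ K ∧
      ‖Polynomial.aeval D (nodePolynomial Λ z) - star (Polynomial.aeval D (nodePolynomial Λ z))‖ ≤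
        K * ‖D * star D - star D * D‖ := by
  choose K hK hKp using fun z : ℂ => (nodePolynomial Λ z).exists_norm_commutator_le (n := n) hR
  have hsum : ∀ z ∈ Λ, K z + K z * K z ≤ ∑ z ∈ Λ, (K z + K z * K z) := fun z hz =>
    Finset.single_le_sum (f := fun z => K z + K z * K z)
      (fun z _ => add_nonneg (hK z) (mul_nonneg (hK z) (hK z))) hz
  refine ⟨∑ z ∈ Λ, (K z + K z * K z), Finset.sum_nonneg fun z _ =>
    add_nonneg (hK z) (mul_nonneg (hK z) (hK z)), fun D hDR hD z hz => ?_⟩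
  have hidem : Polynomial.aeval D (nodePolynomial Λ z) * Polynomial.aeval D (nodePolynomial Λ z) =
      Polynomial.aeval D (nodePolynomial Λ z) := by
    rw [← map_mul]
    refine aeval_eq_of_eval_eq hD fun w hw => ?_
    rw [Polynomial.eval_mul, nodePolynomial_eval hz hw]
    split_ifs <;> simp
  -- Two commutator bounds in succession, first [P, D*] by [D, D*], then [P, P*] by [D, P*], whose
  -- norm equals that of [P, D*].
  have h1 := (hKp z D D (star D) hDR hDR).2.2.1
  have h2 := (hKp z D D (star (Polynomial.aeval D (nodePolynomial Λ z))) hDR hDR).2.2.1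
  have h3 := (hKp z D D 0 hDR hDR).1
  set P := Polynomial.aeval D (nodePolynomial Λ z)
  have h4 : ‖D * star P - star P * D‖ = ‖P * star D - star D * P‖ := by
    rw [← frobenius_norm_star, star_sub, star_mul, star_mul, star_star]
  rw [h4] at h2
  have h5 := norm_sub_star_le_of_isIdempotent hidem
  have h6 := mul_le_mul_of_nonneg_left h1 (hK z)
  have h7 := hsum z hz
  refine ⟨h3.trans (le_trans (le_add_of_nonneg_right (mul_nonneg (hK z) (hK z))) h7), ?_⟩
  refine (h5.trans h2).trans (h6.trans ?_)
  rw [← mul_assoc]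
  refine mul_le_mul_of_nonneg_right (le_trans ?_ h7) (norm_nonneg _)
  exact le_add_of_nonneg_left (hK z)

theorem aeval_eq_sum_smul_nodeProjection {D : Matrix n n ℂ}
    (hD : Polynomial.aeval D (∏ z ∈ Λ, (Polynomial.X - Polynomial.C z)) = 0) (p : Polynomial ℂ) :
    Polynomial.aeval D p = ∑ z ∈ Λ, p.eval z • Polynomial.aeval D (nodePolynomial Λ z) := by
  have h : Polynomial.aeval D p =
      Polynomial.aeval D (∑ z ∈ Λ, Polynomial.C (p.eval z) * nodePolynomial Λ z) := by
    refine aeval_eq_of_eval_eq hD fun w hw => ?_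
    rw [Polynomial.eval_finsetSum, Finset.sum_eq_single w]
    · simp [nodePolynomial_eval hw hw]
    · intro z hz hzw
      simp [nodePolynomial_eval hz hw, hzw]
    · exact fun h => absurd hw h
  rw [h, map_sum]
  refine Finset.sum_congr rfl fun z _ => ?_
  rw [map_mul, Polynomial.aeval_C, ← Algebra.smul_def]

theorem conjInterpolant_eval {z : ℂ} (hz : z ∈ Λ) : (conjInterpolant Λ).eval z = star z :=
  Lagrange.eval_interpolate_at_node (v := id) _ Function.injective_id.injOn hz

theorem star_sub_conjInterpolant {D : Matrix n n ℂ}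
    (hD : Polynomial.aeval D (∏ z ∈ Λ, (Polynomial.X - Polynomial.C z)) = 0) :
    star D - Polynomial.aeval D (conjInterpolant Λ) =
      ∑ z ∈ Λ, -(star z • (Polynomial.aeval D (nodePolynomial Λ z) -
        star (Polynomial.aeval D (nodePolynomial Λ z)))) := by
  have h1 : D = ∑ z ∈ Λ, z • Polynomial.aeval D (nodePolynomial Λ z) := by
    have := aeval_eq_sum_smul_nodeProjection hD Polynomial.X
    simpa using this
  conv_lhs => rw [aeval_eq_sum_smul_nodeProjection hD (conjInterpolant Λ)]
  conv_lhs => enter [1]; rw [h1]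
  rw [star_sum, ← Finset.sum_sub_distrib]
  refine Finset.sum_congr rfl fun z hz => ?_
  rw [conjInterpolant_eval hz, star_smul]
  module

theorem exists_norm_star_sub_conjInterpolant_le (Λ : Finset ℂ) {R : ℝ} (hR : 0 ≤ R) :
    ∃ K, 0 ≤ K ∧ ∀ D : Matrix n n ℂ, ‖D‖ ≤ R →
      Polynomial.aeval D (∏ z ∈ Λ, (Polynomial.X - Polynomial.C z)) = 0 →
      ‖star D - Polynomial.aeval D (conjInterpolant Λ)‖ ≤ K * ‖D * star D - star D * D‖ := by
  obtain ⟨K, hK, h⟩ := exists_norm_nodeProjection_sub_star_le (n := n) Λ hR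
  refine ⟨∑ z ∈ Λ, ‖z‖ * K, Finset.sum_nonneg fun z _ => by positivity, fun D hDR hD => ?_⟩
  rw [star_sub_conjInterpolant hD, Finset.sum_mul]
  refine (norm_sum_le _ _).trans (Finset.sum_le_sum fun z hz => ?_)
  rw [norm_neg, norm_smul, norm_star, mul_assoc]
  exact mul_le_mul_of_nonneg_left (h D hDR hD z hz).2 (norm_nonneg _)

/-- With A = P − P*, both cases give tr(AQ) = ± tr(QA·AQ), so a trace that looks linear in A is in
fact quadratic. -/
theorem norm_trace_sub_star_mul_le {P Q : Matrix n n ℂ} (hP : P * P = P) (hQ : Q * Q = Q)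
    (h : P = Q ∨ P * Q = 0 ∧ Q * P = 0) :
    ‖((P - star P) * Q).trace‖ ≤ ‖Q‖ ^ 2 * ‖P - star P‖ ^ 2 := by
  have hP' : star P * star P = star P := by rw [← star_mul, hP]
  set A := P - star P with hA
  have hAA : A * A = P - P * star P - star P * P + star P := by
    have : A * A = P * P - P * star P - star P * P + star P * star P := by rw [hA]; noncomm_ring
    rw [this, hP, hP']
  have h1 : ‖(A * Q).trace‖ = ‖((Q * A) * (A * Q)).trace‖ := by
    rw [mul_assoc, ← mul_assoc A, hAA]
    rcases h with rfl | ⟨hPQ, hQP⟩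
    · have e : P * ((P - P * star P - star P * P + star P) * P) =
          P * P * P - P * P * (star P * P) - P * star P * (P * P) + P * star P * P := by
        noncomm_ring
      rw [e, hP, hP, hA, sub_mul, hP]
      congr 1
      simp only [Matrix.trace_sub, Matrix.trace_add]
      have t1 : (P * star P * P).trace = (star P * P).trace := by
        rw [mul_assoc, Matrix.trace_mul_comm, mul_assoc, hP]
      rw [← mul_assoc, t1]
      ring
    · have e : Q * ((P - P * star P - star P * P + star P) * Q) =
          Q * (P * Q) - (Q * P) * (star P * Q) - Q * star P * (P * Q) + Q * (star P * Q) := by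
        noncomm_ring
      rw [e, hPQ, hQP, hA, sub_mul, hPQ, Matrix.trace_sub, Matrix.trace_add, Matrix.trace_sub,
        Matrix.trace_sub, Matrix.trace_mul_comm Q (star P * Q), mul_assoc (star P), hQ]
      simp
  rw [h1]
  refine (norm_trace_mul_le _ _).trans ?_
  refine (mul_le_mul (norm_mul_le _ _) (norm_mul_le _ _) (norm_nonneg _) (by positivity)).trans
    (le_of_eq ?_)
  ring

/-- The difference is tr((D* − S)D), with S the conjugate interpolant at D. Expanded in the spectral
projections it becomes a sum of traces that are quadratic in P − P*, and P − P* is of the order of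
[D, D*]. -/
theorem exists_abs_norm_sq_sub_trace_le (Λ : Finset ℂ) {R : ℝ} (hR : 0 ≤ R) :
    ∃ K, 0 ≤ K ∧ ∀ D : Matrix n n ℂ, ‖D‖ ≤ R →
      Polynomial.aeval D (∏ z ∈ Λ, (Polynomial.X - Polynomial.C z)) = 0 →
      |‖D‖ ^ 2 - (Polynomial.aeval D (conjInterpolant Λ) * D).trace.re| ≤
        K * ‖D * star D - star D * D‖ ^ 2 := by
  obtain ⟨K, hK, h⟩ := exists_norm_nodeProjection_sub_star_le (n := n) Λ hR
  refine ⟨∑ z ∈ Λ, ∑ w ∈ Λ, ‖z‖ * ‖w‖ * (K ^ 2 * K ^ 2), by positivity, fun D hDR hD => ?_⟩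
  rw [frobenius_norm_sq_eq_trace, ← Complex.sub_re, ← Matrix.trace_sub, ← sub_mul]
  refine (Complex.abs_re_le_norm _).trans ?_
  set P : ℂ → Matrix n n ℂ := fun z => Polynomial.aeval D (nodePolynomial Λ z) with hPdef
  have h1 : D = ∑ z ∈ Λ, z • P z := by
    have := aeval_eq_sum_smul_nodeProjection hD Polynomial.X
    simpa using this
  have hmul : ∀ z ∈ Λ, ∀ w ∈ Λ, P z * P w = if z = w then P z else 0 := by
    intro z hz w hw
    rw [hPdef]
    simp only
    rw [← map_mul]
    have : (if z = w then Polynomial.aeval D (nodePolynomial Λ z) else 0) =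
        Polynomial.aeval D (if z = w then nodePolynomial Λ z else 0) := by split_ifs <;> simp
    rw [this]
    refine aeval_eq_of_eval_eq hD fun u hu => ?_
    rw [Polynomial.eval_mul, nodePolynomial_eval hz hu, nodePolynomial_eval hw hu]
    by_cases hzw : z = w
    · subst hzw
      rw [if_pos rfl, nodePolynomial_eval hz hu]
      split_ifs <;> simp
    · rw [if_neg hzw, Polynomial.eval_zero]
      split_ifs with h1 h2
      · exact absurd (h1.trans h2.symm) hzw
      all_goals simp
  have hexp : ((star D - Polynomial.aeval D (conjInterpolant Λ)) * D).trace =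
      ∑ z ∈ Λ, ∑ w ∈ Λ, -(star z * w) * ((P z - star (P z)) * P w).trace := by
    rw [star_sub_conjInterpolant hD]
    conv_lhs => enter [1, 2]; rw [h1]
    rw [Finset.sum_mul_sum, Matrix.trace_sum]
    refine Finset.sum_congr rfl fun z _ => ?_
    rw [Matrix.trace_sum]
    refine Finset.sum_congr rfl fun w _ => ?_
    rw [neg_mul, Matrix.trace_neg, smul_mul_assoc, mul_smul_comm, Matrix.trace_smul,
      Matrix.trace_smul, smul_eq_mul, smul_eq_mul, neg_mul, mul_assoc]
  rw [hexp, Finset.sum_mul]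
  refine (norm_sum_le _ _).trans (Finset.sum_le_sum fun z hz => ?_)
  rw [Finset.sum_mul]
  refine (norm_sum_le _ _).trans (Finset.sum_le_sum fun w hw => ?_)
  rw [norm_mul, norm_neg, norm_mul, norm_star, mul_assoc (‖z‖ * ‖w‖)]
  refine mul_le_mul_of_nonneg_left ?_ (by positivity)
  have hzz := hmul z hz z hz
  have hww := hmul w hw w hw
  rw [if_pos rfl] at hzz hww
  refine (norm_trace_sub_star_mul_le hzz hww ?_).trans ?_
  · rcases eq_or_ne z w with rfl | hzw
    · exact Or.inl rfl
    · refine Or.inr ⟨?_, ?_⟩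
      · rw [hmul z hz w hw, if_neg hzw]
      · rw [hmul w hw z hz, if_neg hzw.symm]
  · rw [mul_assoc, ← mul_pow K]
    exact mul_le_mul (pow_le_pow_left₀ (norm_nonneg _) (h D hDR hD w hw).1 2)
      (pow_le_pow_left₀ (norm_nonneg _) (h D hDR hD z hz).2 2) (by positivity) (by positivity)

/-! ### A uniform gap above the eigenvalue 0 of D*D -/

theorem le_eigenvalues_of_mul_mul_eq {D G : Matrix n n ℂ} (hG : D * G * D = D) {K : ℝ}
    (hK : ‖G‖ ≤ K) (i : n) : (isHermitian_star_mul D).eigenvalues i = 0 ∨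
      ((Fintype.card n) * (K ^ 2 + 1))⁻¹ ≤ (isHermitian_star_mul D).eigenvalues i := by
  have hA := isHermitian_star_mul D
  set α := (isHermitian_star_mul D).eigenvalues i with hα
  have hα0 : 0 ≤ α := eigenvalues_star_mul_self_nonneg D i
  by_cases h0 : α = 0
  · exact Or.inl h0
  right
  set χ : ℝ → ℝ := fun x => if x = α then 1 else 0 with hχ
  set E := cfc χ (star D * D) with hE
  have hsA : IsSelfAdjoint (star D * D) := hA
  have hEs : star E = E := (cfc_predicate χ (star D * D) : IsSelfAdjoint _).star_eq
  have hEE : E * E = E := by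
    rw [hE, cfc_mul_cfc]
    congr 1
    funext x
    simp [hχ]
  have hAE : star D * D * E = α • E := by
    have : cfc (fun x : ℝ => x) (star D * D) * E = α • E := by
      rw [hE, cfc_mul_cfc, ← cfc_smul α χ _ (continuousOn_spectrum _ _)]
      congr 1
      funext x
      by_cases hx : x = α <;> simp [hχ, hx]
    rwa [cfc_id' ℝ _ hsA] at this
  have hEnorm : ‖E‖ ^ 2 = ∑ j, χ ((isHermitian_star_mul D).eigenvalues j) := by
    rw [frobenius_norm_sq_eq_trace, hEs, hEE, hE, trace_cfc hA, Complex.ofReal_re]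
  have hE1 : 1 ≤ ‖E‖ ^ 2 := by
    rw [hEnorm]
    have := Finset.single_le_sum (f := fun j => χ ((isHermitian_star_mul D).eigenvalues j))
      (fun j _ => by simp only [hχ]; split_ifs <;> norm_num) (Finset.mem_univ i)
    simpa [hχ, hα] using this
  have hEn : ‖E‖ ^ 2 ≤ Fintype.card n := by
    rw [hEnorm]
    calc _ ≤ ∑ _j : n, (1 : ℝ) := Finset.sum_le_sum fun j _ => by
          simp only [hχ]; split_ifs <;> norm_num
      _ = _ := by simp
  have hEpos : 0 < ‖E‖ := by
    rcases (norm_nonneg E).eq_or_lt with h | h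
    · rw [← h] at hE1; norm_num at hE1
    · exact h
  -- E = α⁻¹ D*D E has its range in that of D*, on which D*G* is the identity because D*G*D* = D*.
  have hfix : star D * star G * E = E := by
    have h1 : star D * star G * (star D * D * E) = star D * D * E := by
      have : star D * star G * star D = star D := by
        rw [← star_mul, ← star_mul, ← mul_assoc, hG]
      simp only [← mul_assoc]
      rw [this]
    rw [hAE, mul_smul_comm] at h1
    exact smul_right_injective _ h0 h1
  have hfix' : E = E * (G * (D * E)) := by
    have := congrArg star hfix
    rw [star_mul, star_mul, star_star, star_star, hEs] at this
    calc E = E * E := hEE.symm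
      _ = (E * (G * D)) * E := by rw [this]
      _ = _ := by simp only [mul_assoc]
  have hDE : ‖D * E‖ ^ 2 = α * ‖E‖ ^ 2 := by
    rw [frobenius_norm_sq_eq_trace, star_mul, mul_assoc, ← mul_assoc (star D), hAE, mul_smul_comm,
      Matrix.trace_smul, frobenius_norm_sq_eq_trace, Complex.real_smul, Complex.re_ofReal_mul]
  have h1 : 1 ≤ ‖G‖ * ‖D * E‖ := by
    have h2 : ‖E‖ ≤ ‖E‖ * (‖G‖ * ‖D * E‖) := by
      conv_lhs => rw [hfix']
      exact (norm_mul_le _ _).trans (mul_le_mul_of_nonneg_left (norm_mul_le _ _) (norm_nonneg _))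
    exact le_of_mul_le_mul_left (by rwa [mul_one]) hEpos
  have h3 : 1 ≤ K ^ 2 * (α * Fintype.card n) := by
    calc (1 : ℝ) ≤ (‖G‖ * ‖D * E‖) ^ 2 := one_le_pow₀ h1
      _ = ‖G‖ ^ 2 * (α * ‖E‖ ^ 2) := by rw [mul_pow, hDE]
      _ ≤ _ := by gcongr
  have hn : (0 : ℝ) < Fintype.card n := lt_of_lt_of_le one_pos (hE1.trans hEn)
  rw [inv_le_iff_one_le_mul₀ (by positivity)]
  nlinarith [mul_nonneg hα0 hn.le]

theorem exists_le_eigenvalues (Λ : Finset ℂ) {R : ℝ} (hR : 0 ≤ R) :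
    ∃ σ, 0 < σ ∧ ∀ D : Matrix n n ℂ, ‖D‖ ≤ R →
      Polynomial.aeval D (∏ z ∈ Λ, (Polynomial.X - Polynomial.C z)) = 0 →
      ∀ i, (isHermitian_star_mul D).eigenvalues i = 0 ∨
        σ ≤ (isHermitian_star_mul D).eigenvalues i := by
  rcases isEmpty_or_nonempty n with hn | hn
  · exact ⟨1, one_pos, fun D _ _ i => isEmptyElim i⟩
  -- At the node 0 the convention 0⁻¹ = 0 is the right value: z g(z) z = z at every node, so g(D) is
  -- a generalized inverse of D whose norm is bounded on the ball.
  set g : Polynomial ℂ := Lagrange.interpolate Λ id (fun z => z⁻¹) with hg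
  obtain ⟨K, hK, hKg⟩ := g.exists_norm_commutator_le (n := n) hR
  refine ⟨((Fintype.card n) * (K ^ 2 + 1))⁻¹, by positivity, fun D hDR hD i => ?_⟩
  refine le_eigenvalues_of_mul_mul_eq (G := Polynomial.aeval D g) ?_ (hKg D D 0 hDR hDR).1 i
  have := aeval_eq_of_eval_eq hD (p := Polynomial.X * g * Polynomial.X) (q := Polynomial.X)
    fun z hz => by
      have : g.eval z = z⁻¹ :=
        Lagrange.eval_interpolate_at_node (v := id) _ Function.injective_id.injOn hz
      rw [Polynomial.eval_mul, Polynomial.eval_mul, Polynomial.eval_X, this]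
      rcases eq_or_ne z 0 with rfl | h0
      · simp
      · rw [mul_inv_cancel₀ h0, one_mul]
  rwa [map_mul, map_mul, Polynomial.aeval_X] at this

end FrobeniusFlow

section FrobeniusFlow

attribute [local instance] Matrix.frobeniusNormedRing Matrix.frobeniusNormedAlgebra

variable {n : Type*} [Fintype n] [DecidableEq n] {ψ₁ ψ₂ : ℝ → ℝ}

/-! ### Commutators with the semisimple part -/

/-- `D` commutes with `X`, is annihilated by a polynomial with simple roots `Λ`, and both matrices
have norm at most `R`. -/
structure IsSemisimpleCompanion (Λ : Finset ℂ) (R : ℝ) (X D : Matrix n n ℂ) : Prop where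
  norm_le_left : ‖X‖ ≤ R
  norm_le_right : ‖D‖ ≤ R
  commute : X * D = D * X
  aeval_eq_zero : Polynomial.aeval D (∏ z ∈ Λ, (Polynomial.X - Polynomial.C z)) = 0

theorem IsSemisimpleCompanion.refl_right {Λ : Finset ℂ} {R : ℝ} {X D : Matrix n n ℂ}
    (h : IsSemisimpleCompanion Λ R X D) : IsSemisimpleCompanion Λ R D D :=
  ⟨h.norm_le_right, h.norm_le_right, rfl, h.aeval_eq_zero⟩

theorem norm_mul_le_of_le_of_le {x y : Matrix n n ℂ} {s t : ℝ} (hx : ‖x‖ ≤ s) (hy : ‖y‖ ≤ t) :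
    ‖x * y‖ ≤ s * t :=
  (norm_mul_le _ _).trans (mul_le_mul hx hy (norm_nonneg _) ((norm_nonneg _).trans hx))

/-- S is a polynomial in D and so commutes with X − D. Hence [D*, X − D] = [D* − S, X − D], which is
bounded by a multiple of ‖[D, D*]‖ · ‖X − D‖. -/
theorem exists_norm_star_commutator_le (Λ : Finset ℂ) {R : ℝ} (hR : 0 ≤ R) :
    ∃ K, 0 ≤ K ∧ ∀ X D : Matrix n n ℂ, IsSemisimpleCompanion Λ R X D →
      ‖star D - Polynomial.aeval D (conjInterpolant Λ)‖ ≤ K * ‖D * star D - star D * D‖ ∧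
      ‖star (X - D) * D - D * star (X - D)‖ ≤ K * ‖D * star D - star D * D‖ * ‖X - D‖ ∧
      ‖star X * D - D * star X‖ ≤ K * ‖D * star D - star D * D‖ := by
  obtain ⟨K, hK, h⟩ := exists_norm_star_sub_conjInterpolant_le (n := n) Λ hR
  refine ⟨2 * K + 2 * K * (2 * R) + 1, by positivity, fun X D hXD => ?_⟩
  have h1 := h D hXD.norm_le_right hXD.aeval_eq_zero
  set S := Polynomial.aeval D (conjInterpolant Λ) with hS
  set c := ‖D * star D - star D * D‖ with hc
  have hc0 : 0 ≤ c := norm_nonneg _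
  have hKc : 0 ≤ K * c := mul_nonneg hK hc0
  have hRc : 0 ≤ K * R * c := mul_nonneg (mul_nonneg hK hR) hc0
  have hND : (X - D) * D = D * (X - D) := by rw [sub_mul, mul_sub, hXD.commute]
  have hNS : (X - D) * S = S * (X - D) := by
    obtain ⟨K', -, hK'⟩ := (conjInterpolant Λ).exists_norm_commutator_le (n := n) hR
    have h2 := (hK' D D (X - D) hXD.norm_le_right hXD.norm_le_right).2.2.1
    rw [← hS, hND, sub_self, norm_zero, mul_zero] at h2
    exact (sub_eq_zero.1 (norm_le_zero_iff.1 h2)).symm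
  have h2 : ‖star (X - D) * D - D * star (X - D)‖ ≤ 2 * (K * c) * ‖X - D‖ := by
    have e : star (star (X - D) * D - D * star (X - D)) =
        (star D - S) * (X - D) - (X - D) * (star D - S) := by
      have e' : (star D - S) * (X - D) - (X - D) * (star D - S) =
          star D * (X - D) - (X - D) * star D - (S * (X - D) - (X - D) * S) := by noncomm_ring
      rw [e', hNS, sub_self, sub_zero, star_sub, star_mul, star_mul, star_star]
    rw [← frobenius_norm_star, e]
    refine (norm_sub_le _ _).trans ?_
    have e1 := norm_mul_le_of_le_of_le h1 (le_refl ‖X - D‖)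
    have e2 := norm_mul_le_of_le_of_le (le_refl ‖X - D‖) h1
    linarith
  have hN : ‖X - D‖ ≤ 2 * R := (norm_sub_le _ _).trans (by
    linarith [hXD.norm_le_left, hXD.norm_le_right])
  have h3 : ‖star X * D - D * star X‖ ≤ c + 2 * (K * c) * (2 * R) := by
    have e : star X * D - D * star X =
        (star (X - D) * D - D * star (X - D)) - (D * star D - star D * D) := by
      rw [star_sub]; noncomm_ring
    rw [e]
    refine (norm_sub_le _ _).trans ?_
    have := mul_le_mul_of_nonneg_left hN (by positivity : 0 ≤ 2 * (K * c))
    linarith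
  refine ⟨h1.trans (by nlinarith), h2.trans ?_, h3.trans (by nlinarith)⟩
  refine mul_le_mul_of_nonneg_right ?_ (norm_nonneg _)
  nlinarith

theorem commutator_star_mul_self {X D : Matrix n n ℂ} (h : X * D = D * X) :
    star X * X * D - D * (star X * X) = (star X * D - D * star X) * X := by
  rw [mul_assoc, h]; noncomm_ring

theorem commutator_mul_star_self {X D : Matrix n n ℂ} (h : X * D = D * X) :
    X * star X * D - D * (X * star X) = X * (star X * D - D * star X) := by
  rw [← mul_assoc D, ← h]; noncomm_ring

theorem IncreasingPair.exists_norm_commutator_flowField_le (h : IncreasingPair ψ₁ ψ₂)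
    (Λ : Finset ℂ) {R : ℝ} (hR : 0 ≤ R) :
    ∃ K, 0 ≤ K ∧ ∀ X D : Matrix n n ℂ, IsSemisimpleCompanion Λ R X D →
      ‖⁅flowField ψ₁ ψ₂ X, D⁆‖ ≤ K * ‖D * star D - star D * D‖ := by
  obtain ⟨L₁, hL₁, h₁⟩ := h.contDiff_left.exists_norm_cfc_le (n := n) (R ^ 2)
  obtain ⟨L₂, hL₂, h₂⟩ := h.contDiff_right.exists_norm_cfc_le (n := n) (R ^ 2)
  obtain ⟨K, hK, hst⟩ := exists_norm_star_commutator_le (n := n) Λ hR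
  refine ⟨(L₁ + L₂) * (K * R), by positivity, fun X D hXD => ?_⟩
  have hX := hXD.norm_le_left
  have e1 := h₁ _ _ (isHermitian_star_mul X) (isHermitian_star_mul X)
    (norm_star_mul_self_le hX) (norm_star_mul_self_le hX) D
  have e2 := h₂ _ _ (isHermitian_mul_star X) (isHermitian_mul_star X)
    (norm_mul_star_self_le hX) (norm_mul_star_self_le hX) D
  rw [commutator_star_mul_self hXD.commute] at e1
  rw [commutator_mul_star_self hXD.commute] at e2
  have e3 := (hst X D hXD).2.2
  have e4 := mul_le_mul_of_nonneg_left (norm_mul_le_of_le_of_le e3 hX) hL₁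
  have e5 := mul_le_mul_of_nonneg_left (norm_mul_le_of_le_of_le hX e3) hL₂
  have e : ⁅flowField ψ₁ ψ₂ X, D⁆ = (cfc ψ₁ (star X * X) * D - D * cfc ψ₁ (star X * X)) -
      (cfc ψ₂ (X * star X) * D - D * cfc ψ₂ (X * star X)) := by
    rw [Ring.lie_def, flowField]; noncomm_ring
  rw [e]
  refine (norm_sub_le _ _).trans ((add_le_add (e1.trans e4) (e2.trans e5)).trans (le_of_eq ?_))
  ring

/-- The approximation error ε absorbs the terms of order `c`; those of order `c * r` are absorbed by
`r ≤ ν`. Each share is at most η/2. -/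
theorem ContDiff.exists_norm_commutator_cfc_sub_le_mul {ψ : ℝ → ℝ} (h : ContDiff ℝ 1 ψ)
    {R A B : ℝ} (hR : 0 ≤ R) (hA : 0 ≤ A) (hB : 0 ≤ B) {η : ℝ} (hη : 0 < η) :
    ∃ ν, 0 < ν ∧ ∀ (a b D : Matrix n n ℂ) (c r : ℝ), a.IsHermitian → b.IsHermitian → ‖a‖ ≤ R →
      ‖b‖ ≤ R → 0 ≤ c → 0 ≤ r → r ≤ ν → ‖a * D - D * a‖ ≤ A * c → ‖b * D - D * b‖ ≤ A * c →
      ‖a - b‖ ≤ B * r → ‖(a - b) * D - D * (a - b)‖ ≤ B * r * c →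
      ‖(cfc ψ a - cfc ψ b) * D - D * (cfc ψ a - cfc ψ b)‖ ≤ η * c := by
  set ε := η / (4 * (A + 1)) with hε
  have hε0 : 0 < ε := by positivity
  obtain ⟨K, hK, hKψ⟩ := h.exists_norm_commutator_cfc_sub_le (n := n) hR hε0
  refine ⟨η / (2 * (K * (B * (2 * A + 1)) + 1)), by positivity, ?_⟩
  intro a b D c r ha hb haR hbR hc hr hν h1 h2 h3 h4
  refine (hKψ a b ha hb haR hbR D).trans ?_
  have g : ‖a - b‖ * (‖a * D - D * a‖ + ‖b * D - D * b‖) ≤ (B * r) * (A * c + A * c) :=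
    mul_le_mul h3 (add_le_add h1 h2) (by positivity) (by positivity)
  have k1 : ε * (‖a * D - D * a‖ + ‖b * D - D * b‖) ≤ ε * (A * c + A * c) :=
    mul_le_mul_of_nonneg_left (add_le_add h1 h2) hε0.le
  have k2 := mul_le_mul_of_nonneg_left (add_le_add g h4) hK
  refine (add_le_add k1 k2).trans ?_
  have m1 : ε * (2 * A) ≤ η / 2 := by
    have : ε * (4 * (A + 1)) = η := by rw [hε]; field_simp
    linarith
  have m2 : K * (B * (2 * A + 1)) * r ≤ η / 2 := by
    rw [le_div_iff₀ (by positivity)] at hν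
    linarith
  have m3 := mul_le_mul_of_nonneg_right (add_le_add m1 m2) hc
  linarith

/-- [X*X − D*D, D] = [(X − D)*, D]X + [D*, D](X − D) because X commutes with D, and both terms are
of order ‖X − D‖ · ‖[D, D*]‖; XX* is treated in the same way. -/
theorem IncreasingPair.exists_norm_commutator_flowField_sub_le (h : IncreasingPair ψ₁ ψ₂)
    (Λ : Finset ℂ) {R : ℝ} (hR : 0 ≤ R) {η : ℝ} (hη : 0 < η) :
    ∃ ν, 0 < ν ∧ ∀ X D : Matrix n n ℂ, IsSemisimpleCompanion Λ R X D → ‖X - D‖ ≤ ν →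
      ‖(flowField ψ₁ ψ₂ X - flowField ψ₁ ψ₂ D) * D - D * (flowField ψ₁ ψ₂ X - flowField ψ₁ ψ₂ D)‖ ≤
        η * ‖D * star D - star D * D‖ := by
  obtain ⟨K, hK, hst⟩ := exists_norm_star_commutator_le (n := n) Λ hR
  have hKR : 0 ≤ K * R := mul_nonneg hK hR
  obtain ⟨ν₁, hν₁, h₁⟩ := h.contDiff_left.exists_norm_commutator_cfc_sub_le_mul (n := n)
    (sq_nonneg R) hKR (B := 2 * R + K * R + 1) (by positivity) (half_pos hη)
  obtain ⟨ν₂, hν₂, h₂⟩ := h.contDiff_right.exists_norm_commutator_cfc_sub_le_mul (n := n)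
    (sq_nonneg R) hKR (B := 2 * R + K * R + 1) (by positivity) (half_pos hη)
  refine ⟨min ν₁ ν₂, lt_min hν₁ hν₂, fun X D hXD hν => ?_⟩
  have hX := hXD.norm_le_left
  have hD := hXD.norm_le_right
  obtain ⟨-, s1, s2⟩ := hst X D hXD
  have s3 := (hst D D hXD.refl_right).2.2
  have s4 : ‖star D * D - D * star D‖ ≤ ‖D * star D - star D * D‖ := (norm_sub_rev _ _).le
  have hc0 : 0 ≤ ‖D * star D - star D * D‖ := norm_nonneg _
  have hN0 : 0 ≤ ‖X - D‖ := norm_nonneg _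
  have a3 := norm_star_mul_sub_le hX hD
  have b3 := norm_mul_star_sub_le hX hD
  have a1 := norm_mul_le_of_le_of_le s2 hX
  have a2 := norm_mul_le_of_le_of_le s3 hD
  have b1 := norm_mul_le_of_le_of_le hX s2
  have b2 := norm_mul_le_of_le_of_le hD s3
  have a4 : ‖(star X * X - star D * D) * D - D * (star X * X - star D * D)‖ ≤
      ‖(star (X - D) * D - D * star (X - D)) * X‖ + ‖(star D * D - D * star D) * (X - D)‖ := by
    refine le_trans (le_of_eq (congrArg _ ?_)) (norm_add_le _ _)
    have : (star X * X - star D * D) * D - D * (star X * X - star D * D) =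
      (star X * X * D - D * (star X * X)) - (star D * D * D - D * (star D * D)) := by noncomm_ring
    rw [this, commutator_star_mul_self hXD.commute, commutator_star_mul_self rfl, star_sub]
    noncomm_ring
  have b4 : ‖(X * star X - D * star D) * D - D * (X * star X - D * star D)‖ ≤
      ‖X * (star (X - D) * D - D * star (X - D))‖ + ‖(X - D) * (star D * D - D * star D)‖ := by
    refine le_trans (le_of_eq (congrArg _ ?_)) (norm_add_le _ _)
    have : (X * star X - D * star D) * D - D * (X * star X - D * star D) =
      (X * star X * D - D * (X * star X)) - (D * star D * D - D * (D * star D)) := by noncomm_ring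
    rw [this, commutator_mul_star_self hXD.commute, commutator_mul_star_self rfl, star_sub]
    noncomm_ring
  have a5 := norm_mul_le_of_le_of_le s1 hX
  have a6 := norm_mul_le_of_le_of_le s4 (le_refl ‖X - D‖)
  have b5 := norm_mul_le_of_le_of_le hX s1
  have b6 := norm_mul_le_of_le_of_le (le_refl ‖X - D‖) s4
  rw [← commutator_star_mul_self hXD.commute] at a1
  rw [← commutator_star_mul_self rfl] at a2
  rw [← commutator_mul_star_self hXD.commute] at b1
  rw [← commutator_mul_star_self rfl] at b2
  have f1 := h₁ (star X * X) (star D * D) D ‖D * star D - star D * D‖ ‖X - D‖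
    (isHermitian_star_mul X) (isHermitian_star_mul D)
    (norm_star_mul_self_le hX) (norm_star_mul_self_le hD) hc0 hN0 (hν.trans (min_le_left _ _))
  have f2 := h₂ (X * star X) (D * star D) D ‖D * star D - star D * D‖ ‖X - D‖
    (isHermitian_mul_star X) (isHermitian_mul_star D)
    (norm_mul_star_self_le hX) (norm_mul_star_self_le hD) hc0 hN0 (hν.trans (min_le_right _ _))
  have e : (flowField ψ₁ ψ₂ X - flowField ψ₁ ψ₂ D) * D -
      D * (flowField ψ₁ ψ₂ X - flowField ψ₁ ψ₂ D) =
      ((cfc ψ₁ (star X * X) - cfc ψ₁ (star D * D)) * D -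
        D * (cfc ψ₁ (star X * X) - cfc ψ₁ (star D * D))) -
      ((cfc ψ₂ (X * star X) - cfc ψ₂ (D * star D)) * D -
        D * (cfc ψ₂ (X * star X) - cfc ψ₂ (D * star D))) := by
    rw [flowField, flowField]; noncomm_ring
  rw [e]
  generalize ‖D * star D - star D * D‖ = c at *
  generalize ‖X - D‖ = r at *
  have z1 : 0 ≤ R * r := mul_nonneg hR hN0
  have z2 : 0 ≤ K * R * r := mul_nonneg hKR hN0
  have z3 : 0 ≤ R * r * c := mul_nonneg z1 hc0
  have k1 := f1 (a1.trans (by linarith)) (a2.trans (by linarith)) (a3.trans (by linarith))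
    (a4.trans (by linarith))
  have k2 := f2 (b1.trans (by linarith)) (b2.trans (by linarith)) (b3.trans (by linarith))
    (b4.trans (by linarith))
  refine (norm_sub_le _ _).trans ((add_le_add k1 k2).trans (le_of_eq ?_))
  ring

/-- Any S commuting with D may be subtracted from D* in the trace. With S close to D* this supplies
a second small factor next to [M, D]. -/
theorem trace_mul_commutator (M D S : Matrix n n ℂ) (hS : D * S = S * D) :
    (M * (D * star D - star D * D)).trace = ((M * D - D * M) * (star D - S)).trace := by
  have e : (M * D - D * M) * (star D - S) =
      M * D * star D - D * (M * star D) - M * (D * S) + D * (M * S) := by noncomm_ring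
  rw [e, Matrix.trace_add, Matrix.trace_sub, Matrix.trace_sub, Matrix.trace_mul_comm D (M * star D),
    Matrix.trace_mul_comm D (M * S), mul_sub, Matrix.trace_sub, hS]
  simp only [mul_assoc]
  ring

/-- Near its semisimple part, the dissipation of a matrix controls the squared norm of the
self-commutator of the semisimple part. -/
theorem IncreasingPair.exists_trace_flowField_mul_le (h : IncreasingPair ψ₁ ψ₂) (Λ : Finset ℂ)
    {R : ℝ} (hR : 0 ≤ R) : ∃ c ν, 0 < c ∧ 0 < ν ∧ ∀ X D : Matrix n n ℂ,
      IsSemisimpleCompanion Λ R X D → ‖X - D‖ ≤ ν →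
      (flowField ψ₁ ψ₂ X * (D * star D - star D * D)).trace.re ≤
        -(c * ‖D * star D - star D * D‖ ^ 2) := by
  obtain ⟨σ, hσ, hev⟩ := exists_le_eigenvalues (n := n) Λ hR
  obtain ⟨c, hc, hcX⟩ := h.exists_trace_flowField_le (n := n) hσ R
  obtain ⟨K, hK, hst⟩ := exists_norm_star_commutator_le (n := n) Λ hR
  -- The dissipation of H(D) is at least c‖[D, D*]‖². Replacing H(D) by H(X) costs at most ηK‖[D,
  -- D*]‖², and this η makes the cost at most half of it.
  obtain ⟨ν, hν, hXν⟩ := h.exists_norm_commutator_flowField_sub_le (n := n) Λ hR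
    (η := c / (2 * (K + 1))) (by positivity)
  refine ⟨c / 2, ν, by positivity, hν, fun X D hXD hle => ?_⟩
  have h1 := hcX D hXD.norm_le_right (hev D hXD.norm_le_right hXD.aeval_eq_zero)
  have h2 := hXν X D hXD hle
  have h3 := (hst X D hXD).1
  have hS : D * Polynomial.aeval D (conjInterpolant Λ) =
      Polynomial.aeval D (conjInterpolant Λ) * D := by
    have := Polynomial.aeval_mul (x := D) (p := Polynomial.X) (q := conjInterpolant Λ)
    rw [mul_comm, Polynomial.aeval_mul, Polynomial.aeval_X] at this
    exact this.symm
  have h4 := trace_mul_commutator (flowField ψ₁ ψ₂ X - flowField ψ₁ ψ₂ D) D _ hS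
  set x := ‖D * star D - star D * D‖
  have h6 : ((flowField ψ₁ ψ₂ X - flowField ψ₁ ψ₂ D) * (D * star D - star D * D)).trace.re ≤
      c / (2 * (K + 1)) * x * (K * x) := by
    rw [h4]
    refine (Complex.re_le_norm _).trans ((norm_trace_mul_le _ _).trans ?_)
    exact mul_le_mul h2 h3 (norm_nonneg _) (by positivity)
  rw [sub_mul, Matrix.trace_sub, Complex.sub_re] at h6
  have h7 : c / (2 * (K + 1)) * x * (K * x) ≤ c / 2 * x ^ 2 := by
    have : c / (2 * (K + 1)) * x * (K * x) = c / 2 * x ^ 2 * (K / (K + 1)) := by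
      field_simp
    rw [this]
    exact mul_le_of_le_one_right (by positivity) ((div_le_one (by positivity)).2 (by linarith))
  linarith

end FrobeniusFlow

/-! ### Convergence from an exponentially decaying Lyapunov function -/

theorem exists_tendsto_of_norm_sub_le {E : Type*} [NormedAddCommGroup E] [CompleteSpace E]
    {u : ℝ → E} {B : ℝ → ℝ} {t₀ b : ℝ} (hB : ∀ t, t₀ ≤ t → B t ≤ b)
    (h : ∀ s t, t₀ ≤ s → s ≤ t → ‖u t - u s‖ ≤ B t - B s) : ∃ x, Tendsto u atTop (𝓝 x) := by
  refine cauchySeq_tendsto_of_complete (Metric.cauchySeq_iff'.2 fun ε hε => ?_)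
  have hne : (B '' Ici t₀).Nonempty := ⟨B t₀, mem_image_of_mem B self_mem_Ici⟩
  have hbdd : BddAbove (B '' Ici t₀) := ⟨b, by rintro _ ⟨t, ht, rfl⟩; exact hB t ht⟩
  obtain ⟨_, ⟨s, hs, rfl⟩, hlt⟩ := exists_lt_of_lt_csSup hne (sub_lt_self (sSup (B '' Ici t₀)) hε)
  refine ⟨s, fun t ht => ?_⟩
  rw [dist_eq_norm]
  have h1 := h s t hs ht
  have h2 := le_csSup hbdd (mem_image_of_mem B (hs.trans ht : t ∈ Ici t₀))
  linarith

/-- V decays exponentially, and so does ∫κ² over [t, ∞); weighting by exponentials turns this into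
integrability of κ. The bounded function B below packages the argument, with ‖u'‖ ≤ B'. -/
theorem exists_tendsto_of_dissipation {E : Type*} [NormedAddCommGroup E] [NormedSpace ℝ E]
    [CompleteSpace E] {u u' : ℝ → E} {V V' κ : ℝ → ℝ} {t₀ c K : ℝ} (hc : 0 < c) (hK : 0 < K)
    (hu : ∀ t, t₀ ≤ t → HasDerivWithinAt u (u' t) (Ici t₀) t)
    (hV : ∀ t, t₀ ≤ t → HasDerivWithinAt V (V' t) (Ici t₀) t)
    (hV0 : ∀ t, t₀ ≤ t → 0 ≤ V t) (hVκ : ∀ t, t₀ ≤ t → V t ≤ K * κ t ^ 2)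
    (hV' : ∀ t, t₀ ≤ t → V' t ≤ -(c * κ t ^ 2)) (hu' : ∀ t, t₀ ≤ t → ‖u' t‖ ≤ K * κ t) :
    ∃ x, Tendsto u atTop (𝓝 x) := by
  -- With this rate γV ≤ (c/2)κ², so γV + V' still leaves −(c/2)κ².
  set γ := c / (2 * K) with hγ
  have hγ0 : 0 < γ := by positivity
  have hγK : γ * K = c / 2 := by rw [hγ]; field_simp
  let B : ℝ → ℝ := fun t => -(K / γ) * Real.exp (-γ * t) - (2 * K / c) * (Real.exp (γ * t) * V t)
  let B' : ℝ → ℝ := fun t => -(K / γ) * (Real.exp (-γ * t) * -γ) -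
    (2 * K / c) * (Real.exp (γ * t) * γ * V t + Real.exp (γ * t) * V' t)
  have hB : ∀ t, t₀ ≤ t → HasDerivWithinAt B (B' t) (Ici t₀) t := fun t ht => by
    have e1 : HasDerivAt (fun t => Real.exp (-γ * t)) (Real.exp (-γ * t) * -γ) t := by
      simpa using ((hasDerivAt_id t).const_mul (-γ)).exp
    have e2 : HasDerivAt (fun t => Real.exp (γ * t)) (Real.exp (γ * t) * γ) t := by
      simpa using ((hasDerivAt_id t).const_mul γ).exp
    exact (e1.hasDerivWithinAt.const_mul _).sub ((e2.hasDerivWithinAt.mul (hV t ht)).const_mul _)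
  have hB0 : ∀ t, t₀ ≤ t → B t ≤ 0 := fun t ht => by
    have h1 : 0 ≤ K / γ * Real.exp (-γ * t) := by positivity
    have h2 : 0 ≤ (2 * K / c) * (Real.exp (γ * t) * V t) :=
      mul_nonneg (by positivity) (mul_nonneg (Real.exp_pos _).le (hV0 t ht))
    simp only [B]
    linarith
  have hbound : ∀ t, t₀ ≤ t → ‖u' t‖ ≤ B' t := fun t ht => by
    have hx : 0 < Real.exp (γ * t) := Real.exp_pos _
    have hxy : Real.exp (-γ * t) * Real.exp (γ * t) = 1 := by
      rw [← Real.exp_add]; simp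
    have hy : 0 < Real.exp (-γ * t) := Real.exp_pos _
    have hV1 := hV' t ht
    have hV2 := mul_le_mul_of_nonneg_left (hVκ t ht) hγ0.le
    have h1 : γ * V t + V' t ≤ -(c / 2 * κ t ^ 2) := by
      have : γ * (K * κ t ^ 2) = c / 2 * κ t ^ 2 := by rw [← mul_assoc, hγK]
      linarith
    have h2 : K * (Real.exp (γ * t) * κ t ^ 2) ≤
        -((2 * K / c) * (Real.exp (γ * t) * γ * V t + Real.exp (γ * t) * V' t)) := by
      have := mul_le_mul_of_nonneg_left h1 (by positivity : 0 ≤ 2 * K / c * Real.exp (γ * t))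
      have e : 2 * K / c * Real.exp (γ * t) * -(c / 2 * κ t ^ 2) =
          -(K * (Real.exp (γ * t) * κ t ^ 2)) := by field_simp
      linarith
    -- The arithmetic–geometric mean inequality, 2κ ≤ e^(−γt) + e^(γt) κ².
    have h3 : κ t ≤ Real.exp (-γ * t) + Real.exp (γ * t) * κ t ^ 2 := by
      have : 0 ≤ Real.exp (-γ * t) * (1 - Real.exp (γ * t) * κ t) ^ 2 :=
        mul_nonneg hy.le (sq_nonneg _)
      have e : Real.exp (-γ * t) * (1 - Real.exp (γ * t) * κ t) ^ 2 =
          Real.exp (-γ * t) - 2 * (Real.exp (-γ * t) * Real.exp (γ * t)) * κ t +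
          (Real.exp (-γ * t) * Real.exp (γ * t)) * (Real.exp (γ * t) * κ t ^ 2) := by ring
      rw [hxy] at e
      have : 0 ≤ Real.exp (γ * t) * κ t ^ 2 := by positivity
      rcases le_or_gt (κ t) 0 with h0 | h0 <;> linarith
    have h4 := mul_le_mul_of_nonneg_left h3 hK.le
    have e : -(K / γ) * (Real.exp (-γ * t) * -γ) = K * Real.exp (-γ * t) := by field_simp
    simp only [B']
    have := hu' t ht
    linarith
  refine exists_tendsto_of_norm_sub_le hB0 fun s t hs hst => ?_
  have hsub : ∀ r, s ≤ r → Ici r ⊆ Ici t₀ := fun r hr => Ici_subset_Ici.2 (hs.trans hr)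
  have := image_norm_le_of_norm_deriv_right_le_deriv_boundary' (f := fun r => u r - u s) (f' := u')
    (B := fun r => B r - B s) (B' := B') (a := s) (b := t)
    (fun r hr => ((hu r (hs.trans hr.1)).continuousWithinAt.sub continuousWithinAt_const).mono
      (Icc_subset_Ici_self.trans (hsub s le_rfl)))
    (fun r hr => ((hu r (hs.trans hr.1)).mono (hsub r hr.1)).sub_const _) (by simp)
    (fun r hr => ((hB r (hs.trans hr.1)).continuousWithinAt.sub continuousWithinAt_const).mono
      (Icc_subset_Ici_self.trans (hsub s le_rfl)))
    (fun r hr => ((hB r (hs.trans hr.1)).mono (hsub r hr.1)).sub_const _)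
    (fun r hr => hbound r (hs.trans hr.1))
  exact this (right_mem_Icc.2 hst)

section FrobeniusFlow

attribute [local instance] Matrix.frobeniusNormedRing Matrix.frobeniusNormedAlgebra

variable {n : Type*} [Fintype n] [DecidableEq n] {ψ₁ ψ₂ : ℝ → ℝ}

/-! ### Convergence of the flow lines -/

theorem IsFlowLine.norm_sq_deriv {X : ℝ → Matrix n n ℂ} (hX : IsFlowLine ψ₁ ψ₂ X) {t : ℝ}
    (ht : 0 ≤ t) : HasDerivWithinAt (fun t => ‖X t‖ ^ 2)
      (2 * (flowField ψ₁ ψ₂ (X t) * (X t * star (X t) - star (X t) * X t)).trace.re) (Ici 0) t :=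
  (hX t ht).frobenius_norm_sq (star_flowField _ _ _)

theorem IncreasingPair.continuousOn_flowField (h : IncreasingPair ψ₁ ψ₂) {R : ℝ} (hR : 0 ≤ R) :
    ContinuousOn (flowField ψ₁ ψ₂ : Matrix n n ℂ → Matrix n n ℂ) (Metric.closedBall 0 R) := by
  obtain ⟨L, hL, hLip⟩ := h.exists_norm_flowField_sub_le (n := n) hR
  refine (LipschitzOnWith.of_dist_le_mul (K := ⟨L, hL⟩) fun X hX Y hY => ?_).continuousOn
  rw [dist_eq_norm, dist_eq_norm]
  exact hLip X Y (mem_closedBall_zero_iff.1 hX) (mem_closedBall_zero_iff.1 hY)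

theorem continuous_trace_re {m : Type*} [Fintype m] :
    Continuous fun M : Matrix m m ℂ => M.trace.re :=
  Complex.continuous_re.comp (Continuous.matrix_trace continuous_id)

/-- A continuous function that vanishes at the normal matrices satisfying the polynomial equation
of the initial value tends to zero along the flow line. -/
theorem IsFlowLine.tendsto_zero {X : ℝ → Matrix n n ℂ} (hX : IsFlowLine ψ₁ ψ₂ X)
    (h : IncreasingPair ψ₁ ψ₂) {p : Polynomial ℂ} (hp : Polynomial.aeval (X 0) p = 0)
    {f : Matrix n n ℂ → ℝ} (hf : Continuous f) (hf0 : ∀ Y : Matrix n n ℂ,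
      Y * star Y = star Y * Y → Polynomial.aeval Y p = 0 → f Y = 0) :
    Tendsto (fun t => f (X t)) atTop (𝓝 0) := by
  set R := ‖X 0‖ with hR
  have hR0 : 0 ≤ R := norm_nonneg _
  have hXR : ∀ t, 0 ≤ t → ‖X t‖ ≤ R := fun t ht => hX.norm_le h ht
  let G : Matrix n n ℂ → ℝ := fun Y =>
    -(2 * (flowField ψ₁ ψ₂ Y * (Y * star Y - star Y * Y)).trace.re)
  have hGc : ContinuousOn G (Metric.closedBall 0 R) := by
    have h1 : Continuous fun Y : Matrix n n ℂ => Y * star Y - star Y * Y := by fun_prop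
    exact (((continuous_trace_re (m := n)).comp_continuousOn
      ((h.continuousOn_flowField hR0).mul h1.continuousOn)).const_smul (2 : ℝ)).neg
  have hGpos : ∀ Y : Matrix n n ℂ, Y * star Y ≠ star Y * Y → 0 < G Y := fun Y hY => by
    obtain ⟨c, hc, hcY⟩ := h.exists_trace_flowField_le_self Y
    have : 0 < ‖Y * star Y - star Y * Y‖ := norm_pos_iff.2 (sub_ne_zero.2 hY)
    have : 0 < c * ‖Y * star Y - star Y * Y‖ ^ 2 := by positivity
    simp only [G]
    linarith
  rw [Metric.tendsto_atTop]
  intro ε hε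
  have hball : IsCompact (Metric.closedBall (0 : Matrix n n ℂ) R) := by
    have : ProperSpace (Matrix n n ℂ) := FiniteDimensional.proper ℝ _
    exact isCompact_closedBall _ _
  -- On this compact set no matrix is normal, so the dissipation G is bounded below by some γ > 0.
  set S := Metric.closedBall (0 : Matrix n n ℂ) R ∩
    ({Y | Polynomial.aeval Y p = 0} ∩ {Y | ε / 2 ≤ |f Y|}) with hS
  have hScomp : IsCompact S := hball.inter_right
    ((isClosed_eq (Polynomial.continuous_aeval p) continuous_const).inter
      (isClosed_le continuous_const hf.abs))
  have hGS : ∃ γ, 0 < γ ∧ ∀ Y ∈ S, γ ≤ G Y := by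
    rcases S.eq_empty_or_nonempty with he | hne
    · exact ⟨1, one_pos, by simp [he]⟩
    · obtain ⟨Z, hZ, hmin⟩ := hScomp.exists_isMinOn hne (hGc.mono inter_subset_left)
      refine ⟨G Z, hGpos Z fun hnorm => ?_, fun Y hY => hmin hY⟩
      have h1 : ε / 2 ≤ |f Z| := hZ.2.2
      rw [hf0 Z hnorm hZ.2.1, abs_zero] at h1
      linarith
  obtain ⟨γ, hγ, hγS⟩ := hGS
  obtain ⟨δ, hδ, hfδ⟩ := Metric.uniformContinuousOn_iff.1
    (hball.uniformContinuousOn_of_continuous hf.continuousOn) (ε / 2) (half_pos hε)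
  obtain ⟨M, hM, hFM⟩ := h.exists_norm_flowField_le (n := n) R
  have hspeed : ∀ s t, 0 ≤ s → s ≤ t → ‖X t - X s‖ ≤ (2 * M * R) * (t - s) := fun s t hs hst => by
    refine (convex_Icc s t).norm_image_sub_le_of_norm_hasDerivWithin_le (f := X)
      (f' := fun r => ⁅flowField ψ₁ ψ₂ (X r), X r⁆) (C := 2 * M * R)
      (fun r hr => (hX r (hs.trans hr.1)).mono (Icc_subset_Ici_self.trans (Ici_subset_Ici.2 hs)))
      (fun r hr => (norm_lie_le _ _).trans ?_) (left_mem_Icc.2 hst) (right_mem_Icc.2 hst)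
      |>.trans_eq ?_
    · have := mul_le_mul (hFM _ (hXR r (hs.trans hr.1))) (hXR r (hs.trans hr.1)) (norm_nonneg _) hM
      linarith
    · rw [Real.norm_eq_abs, abs_of_nonneg (sub_nonneg.2 hst)]
  -- During time τ the curve moves by less than δ, so f changes by less than ε/2.
  set τ := δ / (2 * M * R + 1) with hτ
  have hτ0 : 0 < τ := by positivity
  have hτδ : (2 * M * R) * τ < δ := by
    have : (2 * M * R + 1) * τ = δ := by rw [hτ]; field_simp
    linarith
  set W : ℝ → ℝ := fun t => ‖X t‖ ^ 2 with hW
  have hWanti : AntitoneOn W (Ici 0) := fun s hs t ht hst => by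
    refine antitoneOn_Ici_of_hasDerivWithinAt (fun t ht => hX.norm_sq_deriv ht)
      (fun t ht => ?_) hs ht hst
    obtain ⟨c, hc, hcY⟩ := h.exists_trace_flowField_le_self (X t)
    have : 0 ≤ c * ‖X t * star (X t) - star (X t) * X t‖ ^ 2 := by positivity
    linarith
  have hne : (W '' Ici 0).Nonempty := ⟨W 0, mem_image_of_mem W self_mem_Ici⟩
  have hbdd : BddBelow (W '' Ici 0) := ⟨0, by rintro _ ⟨t, -, rfl⟩; positivity⟩
  -- From t₀ on, ‖X‖² can drop by less than γτ in total, so each interval of length τ contains a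
  -- time at which G < γ and X is outside the compact set.
  obtain ⟨_, ⟨t₀, ht₀, rfl⟩, hlt⟩ := exists_lt_of_csInf_lt hne
    (lt_add_of_pos_right (sInf (W '' Ici 0)) (mul_pos hγ hτ0))
  refine ⟨t₀, fun t htt => ?_⟩
  have ht : 0 ≤ t := le_trans ht₀ htt
  have hdrop : W t - W (t + τ) < γ * τ := by
    have h1 := hWanti ht₀ ht htt
    have h2 := csInf_le hbdd (mem_image_of_mem W (add_nonneg ht hτ0.le : t + τ ∈ Ici 0))
    linarith
  obtain ⟨s, hs, hslope⟩ := exists_hasDerivAt_eq_slope W (fun s => -(G (X s)))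
    (lt_add_of_pos_right t hτ0)
    (fun s hs => (hX.norm_sq_deriv (ht.trans hs.1)).continuousWithinAt.mono
      (Icc_subset_Ici_self.trans (Ici_subset_Ici.2 ht)))
    (fun s hs => by
      have := (hX.norm_sq_deriv (ht.trans hs.1.le)).hasDerivAt (Ici_mem_nhds (ht.trans_lt hs.1))
      simpa only [G, neg_neg] using this)
  have hGs : G (X s) < γ := by
    rw [add_sub_cancel_left, eq_div_iff hτ0.ne'] at hslope
    have : G (X s) * τ < γ * τ := by linarith
    exact lt_of_mul_lt_mul_right this hτ0.le
  have hs0 : 0 ≤ s := ht.trans hs.1.le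
  have hfs : |f (X s)| < ε / 2 := by
    by_contra! hge
    refine absurd (hγS (X s) ⟨mem_closedBall_zero_iff.2 (hXR s hs0),
      hX.aeval_eq_zero h hp hs0, hge⟩) (not_le.2 hGs)
  have hclose : dist (f (X s)) (f (X t)) < ε / 2 := by
    refine hfδ _ (mem_closedBall_zero_iff.2 (hXR s hs0)) _
      (mem_closedBall_zero_iff.2 (hXR t ht)) ?_
    rw [dist_eq_norm]
    refine (hspeed t s ht hs.1.le).trans_lt (lt_of_le_of_lt ?_ hτδ)
    have := hs.2.le
    exact mul_le_mul_of_nonneg_left (by linarith) (by positivity)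
  rw [Real.dist_eq] at hclose
  rw [Real.dist_eq, sub_zero]
  have := abs_sub_abs_le_abs_sub (f (X t)) (f (X s))
  rw [abs_sub_comm] at this
  linarith

theorem eq_zero_of_normal_of_pow_eq_zero {M : Matrix n n ℂ} (hM : M * star M = star M * M) {k : ℕ}
    (hk : M ^ k = 0) : M = 0 := by
  have hcomm : Commute (star M) M := hM.symm
  have h1 : (star M * M) ^ (k + 1) = 0 := by
    rw [hcomm.mul_pow, pow_succ M, hk, zero_mul, mul_zero]
  have h2 := (isHermitian_star_mul M).trace_pow_re (k + 1)
  rw [h1, Matrix.trace_zero, Complex.zero_re] at h2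
  have h3 : ∀ i, (isHermitian_star_mul M).eigenvalues i = 0 := fun i => by
    have := (Finset.sum_eq_zero_iff_of_nonneg (fun i _ =>
      pow_nonneg (eigenvalues_star_mul_self_nonneg M i) (k + 1))).1 h2.symm i (Finset.mem_univ i)
    exact pow_eq_zero_iff (Nat.succ_ne_zero k) |>.1 this
  have h4 : ‖M‖ ^ 2 = 0 := by
    have := (isHermitian_star_mul M).trace_pow_re 1
    rw [pow_one] at this
    rw [frobenius_norm_sq_eq_trace, this]
    simp [h3]
  exact norm_eq_zero.1 (pow_eq_zero_iff two_ne_zero |>.1 h4)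

/-- What commutes with Y commutes with q(Y); this is used for Y* and, after taking adjoints, for
q(Y)*. -/
theorem aeval_normal_of_normal {Y : Matrix n n ℂ} (hY : Y * star Y = star Y * Y)
    (q : Polynomial ℂ) : Polynomial.aeval Y q * star (Polynomial.aeval Y q) =
      star (Polynomial.aeval Y q) * Polynomial.aeval Y q := by
  obtain ⟨K, -, hK⟩ := q.exists_norm_commutator_le (n := n) (norm_nonneg Y)
  have key : ∀ Z : Matrix n n ℂ, Y * Z = Z * Y → Polynomial.aeval Y q * Z = Z * Polynomial.aeval Y q :=
    fun Z hZ => by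
      have := (hK Y Y Z le_rfl le_rfl).2.2.1
      rw [hZ, sub_self, norm_zero, mul_zero] at this
      exact sub_eq_zero.1 (norm_le_zero_iff.1 this)
  refine key _ ?_
  have := congrArg star (key (star Y) hY)
  rw [star_mul, star_mul, star_star] at this
  exact this

/-- The flow lines converge to normal matrices. -/
theorem IsFlowLine.exists_tendsto {X : ℝ → Matrix n n ℂ} (hX : IsFlowLine ψ₁ ψ₂ X)
    (h : IncreasingPair ψ₁ ψ₂) :
    ∃ N : Matrix n n ℂ, IsStarNormal N ∧ Tendsto X atTop (𝓝 N) := by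
  obtain ⟨Λ, q, k, hnil, hss⟩ := exists_semisimple_part (X 0)
  obtain ⟨Kq, hKq, hKqb⟩ := q.exists_norm_commutator_le (n := n) (norm_nonneg (X 0))
  set D : ℝ → Matrix n n ℂ := fun t => Polynomial.aeval (X t) q with hDdef
  set R := max ‖X 0‖ Kq with hRdef
  have hR : 0 ≤ R := le_max_of_le_right hKq
  have hcomp : ∀ t, 0 ≤ t → IsSemisimpleCompanion Λ R (X t) (D t) := fun t ht => by
    refine ⟨(hX.norm_le h ht).trans (le_max_left _ _),
      ((hKqb (X t) (X t) 0 (hX.norm_le h ht) (hX.norm_le h ht)).1).trans (le_max_right _ _), ?_, ?_⟩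
    · have := Polynomial.aeval_mul (x := X t) (p := Polynomial.X) (q := q)
      rw [mul_comm, Polynomial.aeval_mul, Polynomial.aeval_X] at this
      exact this.symm
    · rw [hDdef, ← Polynomial.aeval_comp]
      refine hX.aeval_eq_zero h ?_ ht
      rw [Polynomial.aeval_comp]
      exact hss
  have hqc : Continuous fun Y : Matrix n n ℂ => Polynomial.aeval Y q := Polynomial.continuous_aeval q
  -- A normal Y with (Y − q(Y))^k = 0 satisfies Y = q(Y), since Y − q(Y) is normal and nilpotent.
  have hN0 : Tendsto (fun t => ‖X t - D t‖) atTop (𝓝 0) := by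
    refine hX.tendsto_zero h hnil (f := fun Y => ‖Y - Polynomial.aeval Y q‖) (by fun_prop) ?_
    intro Y hY hYp
    have e : Y - Polynomial.aeval Y q = Polynomial.aeval Y (Polynomial.X - q) := by simp
    rw [norm_eq_zero, e]
    refine eq_zero_of_normal_of_pow_eq_zero (aeval_normal_of_normal hY _) (k := k) ?_
    rw [← map_pow]
    exact hYp
  have hC0 : Tendsto (fun t => ‖D t * star (D t) - star (D t) * D t‖) atTop (𝓝 0) := by
    refine hX.tendsto_zero h hnil (f := fun Y => ‖Polynomial.aeval Y q * star (Polynomial.aeval Y q) -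
      star (Polynomial.aeval Y q) * Polynomial.aeval Y q‖) (by fun_prop) ?_
    intro Y hY _
    rw [aeval_normal_of_normal hY q, sub_self, norm_zero]
  obtain ⟨c, ν, hc, hν, hdiss⟩ := h.exists_trace_flowField_mul_le (n := n) Λ hR
  obtain ⟨K₁, hK₁, hKv⟩ := exists_abs_norm_sq_sub_trace_le (n := n) Λ hR
  obtain ⟨K₂, hK₂, hKd⟩ := h.exists_norm_commutator_flowField_le (n := n) Λ hR
  obtain ⟨t₁, ht₁⟩ := eventually_atTop.1 (hN0.eventually (gt_mem_nhds hν))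
  set t₀ := max t₁ 0 with ht₀
  have h0 : ∀ t, t₀ ≤ t → 0 ≤ t := fun t ht => (le_max_right _ _).trans ht
  have hsub : Ici t₀ ⊆ Ici 0 := Ici_subset_Ici.2 (le_max_right _ _)
  have hDd : ∀ t, t₀ ≤ t → HasDerivWithinAt D ⁅flowField ψ₁ ψ₂ (X t), D t⁆ (Ici t₀) t :=
    fun t ht => ((hX t (h0 t ht)).aeval_lie q).mono hsub
  -- This is Σ|λ|² over the eigenvalues of D, written as the trace of a polynomial in X and hence
  -- constant in time.
  set v := (Polynomial.aeval (D 0) (conjInterpolant Λ) * D 0).trace.re with hv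
  have hvt : ∀ t, t₀ ≤ t → (Polynomial.aeval (D t) (conjInterpolant Λ) * D t).trace.re = v :=
    fun t ht => by
      have := hX.trace_aeval ((conjInterpolant Λ).comp q * q) (h0 t ht)
      simpa only [map_mul, Polynomial.aeval_comp] using this
  set V : ℝ → ℝ := fun t => ‖D t‖ ^ 2 - v with hV
  have hVd : ∀ t, t₀ ≤ t → HasDerivWithinAt V (2 * (flowField ψ₁ ψ₂ (X t) *
      (D t * star (D t) - star (D t) * D t)).trace.re) (Ici t₀) t := fun t ht =>
    ((hDd t ht).frobenius_norm_sq (star_flowField _ _ _)).sub_const v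
  have hVabs : ∀ t, t₀ ≤ t → |V t| ≤ K₁ * ‖D t * star (D t) - star (D t) * D t‖ ^ 2 :=
    fun t ht => by
      have := hKv (D t) (hcomp t (h0 t ht)).norm_le_right (hcomp t (h0 t ht)).aeval_eq_zero
      rwa [hvt t ht] at this
  have hVdec : ∀ t, t₀ ≤ t → 2 * (flowField ψ₁ ψ₂ (X t) *
      (D t * star (D t) - star (D t) * D t)).trace.re ≤
      -(2 * c * ‖D t * star (D t) - star (D t) * D t‖ ^ 2) := fun t ht => by
    have := hdiss (X t) (D t) (hcomp t (h0 t ht)) (ht₁ t ((le_max_left _ _).trans ht)).le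
    linarith
  have hVanti : AntitoneOn V (Ici t₀) := antitoneOn_Ici_of_hasDerivWithinAt hVd fun t ht =>
    (hVdec t ht).trans (neg_nonpos.2 (by positivity))
  have hVlim : Tendsto V atTop (𝓝 0) := by
    refine squeeze_zero_norm' (a := fun t => K₁ * ‖D t * star (D t) - star (D t) * D t‖ ^ 2) ?_ ?_
    · filter_upwards [eventually_ge_atTop t₀] with t ht using hVabs t ht
    · simpa using (hC0.pow 2).const_mul K₁
  -- V decreases and is O(κ²) with κ → 0, so it decreases to zero.
  have hV0 : ∀ t, t₀ ≤ t → 0 ≤ V t := fun t ht => by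
    refine le_of_tendsto hVlim ?_
    filter_upwards [eventually_ge_atTop t] with s hs using hVanti ht (ht.trans hs) hs
  have : CompleteSpace (Matrix n n ℂ) := FiniteDimensional.complete ℝ _
  obtain ⟨L, hL⟩ := exists_tendsto_of_dissipation (u := D) (V := V)
    (κ := fun t => ‖D t * star (D t) - star (D t) * D t‖) (t₀ := t₀) (c := 2 * c)
    (K := K₁ + K₂ + 1) (by positivity) (by positivity) hDd hVd hV0
    (fun t ht => ((le_abs_self _).trans (hVabs t ht)).trans
      (mul_le_mul_of_nonneg_right (by linarith) (by positivity))) hVdec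
    (fun t ht => (hKd (X t) (D t) (hcomp t (h0 t ht))).trans
      (mul_le_mul_of_nonneg_right (by linarith) (norm_nonneg _)))
  have hXL : Tendsto X atTop (𝓝 L) := by
    have h1 := (tendsto_zero_iff_norm_tendsto_zero.2 hN0).add hL
    simp only [sub_add_cancel, zero_add] at h1
    exact h1
  refine ⟨L, ⟨?_⟩, hXL⟩
  have h1 : Tendsto (fun t => ‖D t * star (D t) - star (D t) * D t‖) atTop
      (𝓝 ‖L * star L - star L * L‖) := by
    have hcont : Continuous fun Y : Matrix n n ℂ => ‖Y * star Y - star Y * Y‖ := by fun_prop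
    exact (hcont.tendsto L).comp hL
  have h2 := tendsto_nhds_unique h1 hC0
  exact (sub_eq_zero.1 (norm_eq_zero.1 h2)).symm

end FrobeniusFlow

/-! ### Extension of the coefficient functions and the main theorem -/

/-- The derivative is continued by its end point values and integrated; it stays continuous and
nonnegative. -/
theorem ContDiffOn.exists_monotone_extension {ψ : ℝ → ℝ} {A B : ℝ} (hAB : A < B)
    (hψ : ContDiffOn ℝ 1 ψ (Icc A B)) (hmono : MonotoneOn ψ (Icc A B)) :
    ∃ χ : ℝ → ℝ, ContDiff ℝ 1 χ ∧ Monotone χ ∧ EqOn χ ψ (Icc A B) ∧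
      ∀ x, deriv χ x = derivWithin ψ (Icc A B) (projIcc A B hAB.le x) := by
  set g : ℝ → ℝ := fun x => derivWithin ψ (Icc A B) (projIcc A B hAB.le x) with hg
  have hud := uniqueDiffOn_Icc hAB
  have hgc : Continuous g :=
    (hψ.continuousOn_derivWithin hud le_rfl).domRestrict.comp continuous_projIcc
  have hg0 : ∀ x, 0 ≤ g x := fun x => hmono.derivWithin_nonneg
  set χ : ℝ → ℝ := fun x => ψ A + ∫ t in A..x, g t with hχ
  have hd : ∀ x, HasDerivAt χ (g x) x := fun x =>
    ((hgc.integral_hasStrictDerivAt A x).hasDerivAt).const_add (ψ A)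
  have hderiv : deriv χ = g := funext fun x => (hd x).deriv
  refine ⟨χ, ?_, ?_, ?_, fun x => (hd x).deriv⟩
  · rw [contDiff_one_iff_deriv, hderiv]
    exact ⟨fun x => (hd x).differentiableAt, hgc⟩
  · exact monotone_of_deriv_nonneg (fun x => (hd x).differentiableAt)
      (fun x => by rw [hderiv]; exact hg0 x)
  · intro x hx
    have hdiff : ∀ y ∈ Icc A B, HasDerivWithinAt (fun y => χ y - ψ y) 0 (Icc A B) y := fun y hy => by
      have h1 := ((hψ.differentiableOn one_ne_zero) y hy).hasDerivWithinAt
      have h2 := (hd y).hasDerivWithinAt (s := Icc A B) |>.sub h1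
      have : g y = derivWithin ψ (Icc A B) y := by
        rw [hg]; simp only; rw [projIcc_of_mem hAB.le hy]
      rwa [this, sub_self] at h2
    have h3 := (convex_Icc A B).norm_image_sub_le_of_norm_hasDerivWithin_le (C := 0) hdiff
      (fun y _ => by simp) (left_mem_Icc.2 hAB.le) hx
    have h4 : χ A - ψ A = 0 := by simp [hχ]
    rw [h4, zero_mul, sub_zero] at h3
    exact sub_eq_zero.1 (norm_le_zero_iff.1 h3)

theorem sqrt_mem_Icc {a b x : ℝ} (hb : 0 ≤ b) (hx : x ∈ Icc (a ^ 2) (b ^ 2)) :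
    Real.sqrt x ∈ Icc a b :=
  ⟨Real.le_sqrt_of_sq_le hx.1, (Real.sqrt_le_left hb).2 hx.2⟩

theorem derivWithin_comp_sqrt {φ : ℝ → ℝ} {a b x : ℝ} (ha : 0 ≤ a) (hab : a < b)
    (hφ : ContDiffOn ℝ 1 φ (Icc a b)) (hx : x ∈ Icc (a ^ 2) (b ^ 2)) (hx0 : 0 < x) :
    derivWithin (fun x => φ (Real.sqrt x)) (Icc (a ^ 2) (b ^ 2)) x =
      derivWithin φ (Icc a b) (Real.sqrt x) * (1 / (2 * Real.sqrt x)) := by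
  have hmaps : MapsTo Real.sqrt (Icc (a ^ 2) (b ^ 2)) (Icc a b) := fun y hy =>
    sqrt_mem_Icc (ha.trans hab.le) hy
  have h1 := ((hφ.differentiableOn one_ne_zero) _ (hmaps hx)).hasDerivWithinAt
  have h2 := (Real.hasDerivAt_sqrt hx0.ne').hasDerivWithinAt (s := Icc (a ^ 2) (b ^ 2))
  have hlt : a ^ 2 < b ^ 2 := pow_lt_pow_left₀ hab ha two_ne_zero
  exact (h1.comp x h2 hmaps).derivWithin (uniqueDiffOn_Icc hlt x hx)

theorem CondC1.exists_increasingPair {φ₁ φ₂ : ℝ → ℝ} {a b : ℝ} (ha : 0 ≤ a) (hab : a < b)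
    (hφ : CondC1 φ₁ φ₂ a b)
    (hψ₁ : ContDiffOn ℝ 1 (fun x => φ₁ (Real.sqrt x)) (Icc (a ^ 2) (b ^ 2)))
    (hψ₂ : ContDiffOn ℝ 1 (fun x => φ₂ (Real.sqrt x)) (Icc (a ^ 2) (b ^ 2))) :
    ∃ ψ₁ ψ₂ : ℝ → ℝ, IncreasingPair ψ₁ ψ₂ ∧
      (∀ x ∈ Icc (a ^ 2) (b ^ 2), ψ₁ x = φ₁ (Real.sqrt x)) ∧
      (∀ x ∈ Icc (a ^ 2) (b ^ 2), ψ₂ x = φ₂ (Real.sqrt x)) := by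
  have hb : 0 ≤ b := ha.trans hab.le
  have hlt : a ^ 2 < b ^ 2 := pow_lt_pow_left₀ hab ha two_ne_zero
  have hmono : ∀ {φ : ℝ → ℝ}, MonotoneOn φ (Icc a b) →
      MonotoneOn (fun x => φ (Real.sqrt x)) (Icc (a ^ 2) (b ^ 2)) := fun h x hx y hy hxy =>
    h (sqrt_mem_Icc hb hx) (sqrt_mem_Icc hb hy) (Real.sqrt_le_sqrt hxy)
  obtain ⟨ψ₁, h11, h12, h13, h14⟩ := hψ₁.exists_monotone_extension hlt (hmono hφ.monotoneOn_left)
  obtain ⟨ψ₂, h21, h22, h23, h24⟩ := hψ₂.exists_monotone_extension hlt (hmono hφ.monotoneOn_right)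
  refine ⟨ψ₁, ψ₂, ⟨h11, h21, h12, h22, fun x hx => ?_⟩, h13, h23⟩
  rw [h14, h24]
  -- As b > 0, a positive x projects to a positive y even if a = 0. There the chain rule through √
  -- applies, with the positive factor 1/(2√y).
  set y : ℝ := ↑(projIcc (a ^ 2) (b ^ 2) hlt.le x) with hy
  have hyI : y ∈ Icc (a ^ 2) (b ^ 2) := (projIcc (a ^ 2) (b ^ 2) hlt.le x).2
  have hy0 : 0 < y := by
    rw [hy, coe_projIcc]
    exact lt_max_of_lt_right (lt_min ((sq_nonneg a).trans_lt hlt) hx)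
  rw [derivWithin_comp_sqrt ha hab hφ.contDiffOn_left hyI hy0,
    derivWithin_comp_sqrt ha hab hφ.contDiffOn_right hyI hy0, ← add_mul]
  have hs : 0 < Real.sqrt y := Real.sqrt_pos.2 hy0
  refine mul_pos (hφ.deriv_add_pos _ ⟨sqrt_mem_Icc hb hyI, hs.ne'⟩) (by positivity)

/-- The flow is defined through an arbitrary choice of solution, determined only for t ≥ 0;
uniqueness transfers the limit to it. -/
theorem phiFlow_of_unique {n : ℕ} {φ₁ φ₂ : ℝ → ℝ} {a b : ℝ} {T : Matrix (Fin n) (Fin n) ℂ}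
    {X : ℝ → Matrix (Fin n) (Fin n) ℂ} (hX : IsGlobalSolution φ₁ φ₂ a b T X)
    (huniq : ∀ Y, IsGlobalSolution φ₁ φ₂ a b T Y → ∀ t, 0 ≤ t → Y t = X t)
    {N : Matrix (Fin n) (Fin n) ℂ} (hN : IsStarNormal N) (hlim : Tendsto X atTop (𝓝 N)) :
    IsGlobalSolution φ₁ φ₂ a b T (fun t => phiFlow φ₁ φ₂ a b t T) ∧
    (∀ X : ℝ → Matrix (Fin n) (Fin n) ℂ, IsGlobalSolution φ₁ φ₂ a b T X →
      ∀ t, 0 ≤ t → X t = phiFlow φ₁ φ₂ a b t T) ∧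
    ∃ N : Matrix (Fin n) (Fin n) ℂ, IsStarNormal N ∧
      Tendsto (fun t => phiFlow φ₁ φ₂ a b t T) atTop (𝓝 N) := by
  have hex : ∃ X, IsGlobalSolution φ₁ φ₂ a b T X := ⟨X, hX⟩
  have hflow : (fun t => phiFlow φ₁ φ₂ a b t T) = hex.choose := by
    funext t
    rw [phiFlow, dif_pos hex]
  have heq : ∀ t, 0 ≤ t → phiFlow φ₁ φ₂ a b t T = X t := fun t ht => by
    rw [← huniq _ hex.choose_spec t ht, ← hflow]
  refine ⟨hflow ▸ hex.choose_spec, fun Y hY t ht => (huniq Y hY t ht).trans (heq t ht).symm,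
    N, hN, hlim.congr' ?_⟩
  filter_upwards [eventually_ge_atTop 0] with t ht using (heq t ht).symm

theorem lie_eq_zero_of_subsingleton {n : ℕ} (hn : n = 1) (A B : Matrix (Fin n) (Fin n) ℂ) :
    ⁅A, B⁆ = 0 := by
  subst hn
  rw [Ring.lie_def]
  ext i j
  fin_cases i; fin_cases j
  simp [Matrix.mul_apply, mul_comm]

section FrobeniusFlow

attribute [local instance] Matrix.frobeniusNormedRing Matrix.frobeniusNormedAlgebra

theorem eq_of_hasDerivWithinAt_zero {n : ℕ} {X : ℝ → Matrix (Fin n) (Fin n) ℂ}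
    (hX : ∀ t, 0 ≤ t → HasDerivWithinAt X 0 (Ici 0) t) {t : ℝ} (ht : 0 ≤ t) : X t = X 0 := by
  have := (convex_Ici (0 : ℝ)).norm_image_sub_le_of_norm_hasDerivWithin_le (f := X)
    (f' := fun _ => 0) (C := 0) hX (fun _ _ => by simp) self_mem_Ici ht
  rw [zero_mul] at this
  exact sub_eq_zero.1 (norm_le_zero_iff.1 this)

theorem hasDerivWithinAt_const_matrix {n : ℕ} (T : Matrix (Fin n) (Fin n) ℂ) (s : Set ℝ) (t : ℝ) :
    HasDerivWithinAt (fun _ => T) 0 s t :=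
  hasDerivWithinAt_const t s T

end FrobeniusFlow

theorem mainTheorem2 (n : ℕ) (hn : 1 ≤ n) (a b : ℝ) (ha : 0 ≤ a) (hab : a < b)
    (φ₁ φ₂ : ℝ → ℝ) (hφ : CondC1 φ₁ φ₂ a b)
    (hψ₁ : ContDiffOn ℝ (n - 1 : ℕ) (fun x => φ₁ (Real.sqrt x)) (Icc (a ^ 2) (b ^ 2)))
    (hψ₂ : ContDiffOn ℝ (n - 1 : ℕ) (fun x => φ₂ (Real.sqrt x)) (Icc (a ^ 2) (b ^ 2)))
    (T : Matrix (Fin n) (Fin n) ℂ) (hT : T ∈ matrixInterval n a b) :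
    -- the flow is well defined: it is the unique global solution starting at `T`
    IsGlobalSolution φ₁ φ₂ a b T (fun t => phiFlow φ₁ φ₂ a b t T) ∧
    (∀ X : ℝ → Matrix (Fin n) (Fin n) ℂ, IsGlobalSolution φ₁ φ₂ a b T X →
      ∀ t, 0 ≤ t → X t = phiFlow φ₁ φ₂ a b t T) ∧
    -- and it converges to a normal matrix
    ∃ N : Matrix (Fin n) (Fin n) ℂ, IsStarNormal N ∧
      Tendsto (fun t => phiFlow φ₁ φ₂ a b t T) atTop (𝓝 N) := by
  rcases hn.eq_or_lt with h1 | h2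
  -- For n = 1 the smoothness assumption on ψᵢ is mere continuity; scalars commute, so the flow is
  -- constant.
  · have hlie := lie_eq_zero_of_subsingleton h1.symm
    have hconst : IsGlobalSolution φ₁ φ₂ a b T fun _ => T :=
      ⟨rfl, fun _ _ => hT, fun t _ => by rw [hlie]; exact hasDerivWithinAt_const_matrix T _ t⟩
    refine phiFlow_of_unique hconst (fun Y hY t ht => ?_) (N := T) ⟨?_⟩ tendsto_const_nhds
    · rw [← hY.initial]
      exact eq_of_hasDerivWithinAt_zero
        (fun t ht => by have := hY.hasDeriv t ht; rwa [hlie] at this) ht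
    · have := hlie (star T) T
      rw [Ring.lie_def] at this
      exact sub_eq_zero.1 this
  · have hle : (1 : WithTop ℕ∞) ≤ ((n - 1 : ℕ) : WithTop ℕ∞) := by
      have : 1 ≤ n - 1 := by omega
      exact_mod_cast this
    obtain ⟨ψ₁, ψ₂, h, he₁, he₂⟩ := hφ.exists_increasingPair ha hab (hψ₁.of_le hle) (hψ₂.of_le hle)
    -- Solutions stay in M_n[a, b], where the extended functions agree with φᵢ ∘ √ on the spectra,
    -- so the two equations coincide.
    have hline : ∀ Y, IsGlobalSolution φ₁ φ₂ a b T Y → IsFlowLine ψ₁ ψ₂ Y := fun Y hY t ht => by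
      have := hY.hasDeriv t ht
      rwa [phiOf_eq_flowField ha hab he₁ he₂ (hY.mem t ht)] at this
    obtain ⟨X, hX0, hX⟩ := h.exists_isFlowLine T
    have hmem : ∀ t, 0 ≤ t → X t ∈ matrixInterval n a b := fun t ht =>
      hX.mem_matrixInterval ha hab h (hX0 ▸ hT) ht
    have hsol : IsGlobalSolution φ₁ φ₂ a b T X :=
      ⟨hX0, hmem, fun t ht => by
        rw [phiOf_eq_flowField ha hab he₁ he₂ (hmem t ht)]
        exact hX t ht⟩
    obtain ⟨N, hN, hlim⟩ := hX.exists_tendsto h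
    exact phiFlow_of_unique hsol (fun Y hY t ht =>
      (hline Y hY).eq_of_eq_zero h hX (hY.initial.trans hX0.symm) ht) hN hlim
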